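/- **Setting.** Let $G=(V,E)$ be a finite connected undirected graph (loops and parallel edges are allowed). The *cake* is the space obtained from one copy of $[0,1]$ for each edge by gluing the ends of edges at common vertices. A *piece* is a finite union of closed intervals of edges; a *share* is a piece in which any two points are joined by a path inside the piece. There are $n\ge 2$ agents; agent $i$ has a valuation $\mu_i$, which assigns a nonnegative real to each piece and is normalized ($\mu_i(\text{cake})=1$), divisible (for each interval $[x,y]$ of an edge and each $\lambda\in[0,1]$ there is $z\in[x,y]$ with $\mu_i([x,z])=\lambda\,\mu_i([x,y])$) and additive ($\mu_i(A\cup B)=\mu_i(A)+\mu_i(B)$ for pieces $A,B$ with finite intersection). The valuations are *identical* if $\mu_i(A)=\mu_j(A)$ for all agents $i,j$ and all shares $A$. A *connected allocation* is a list $(A_1,\dots,A_n)$ of shares, any two of which meet in finitely many points, and which together cover the cake. It is *$\alpha$-EF* if $\mu_i(A_i)\ge \mu_i(A_j)/\alpha$ for all $i,j$. **Model of computation.** An algorithm is a program of a real RAM: its memory consists of cells for natural numbers (with constants, addition, truncated subtraction, comparison, and indirect addressing) and cells for reals (with rational constants, conversion from natural numbers, the four arithmetic operations, and comparison); each operation takes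 one time step. Its input is $n$, the graph $G$ (numbers of vertices and edges, endpoints of each edge) and $\varepsilon$. The valuations are accessible only through Robertson–Webb queries, which take one step each: $\mathrm{Eval}_i(e,x,y)$ returns $\mu_i([x,y])$ for $0\le x\le y\le 1$ on edge $e$, and $\mathrm{Cut}_i(e,x,a)$ returns, if $0\le x\le 1$ and $0\le a\le\mu_i([x,1])$ on edge $e$, some point $y\in[x,1]$ of $e$ with $\mu_i([x,y])=a$. The output is a list of intervals of edges, each labelled with the agent who receives it. **Theorem.** For any finite connected graph $G$, any $n\ge 2$ agents with identical valuations and any $\varepsilon>0$, there is a connected $(2+\varepsilon)$-EF allocation. Moreover, there are a single algorithm and a single polynomial $P$ such that for all $n\ge2$, all finite connected graphs $G$, all identical valuations $\mu_1,\dots,\mu_n$ on $G$, all $\varepsilon>0$ and all correct ways of answering the queries, the algorithm terminates after at most $P(n,1/\varepsilon,|G|)$ steps, where $|G|=|V|+|E|$, and outputs a connected $(2+\varepsilon)$-EF allocation. -/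

import Mathlib

open scoped unitInterval

namespace GraphCake

/-! ### The cake -/

/-- A finite undirected graph with vertices `0, …, k - 1` and edges `0, …, m - 1`; edge `e` joins
`src e` and `tgt e`. The order of the two endpoints only fixes which end of the edge has
coordinate `0`. Loops and parallel edges are allowed. -/
structure Graph where
  k : ℕ
  m : ℕ
  src : Fin m → Fin k
  tgt : Fin m → Fin k

namespace Graph

variable (G : Graph)

/-- The size `|V| + |E|` of the graph. -/
def size : ℕ := G.k + G.m

/-- The adjacency relation of the graph, without loops and multiplicities. -/
def adjacency : SimpleGraph (Fin G.k) :=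
  SimpleGraph.fromRel fun u v => ∃ e, G.src e = u ∧ G.tgt e = v

/-- The graph is connected (in particular it has a vertex). -/
def IsConnectedGraph : Prop := G.adjacency.Connected

/-- `G.AtVertex p v` says that the point `p = (e, t)` of edge `e` is an end of `e`, and that this
end is the vertex `v`. -/
def AtVertex (p : Fin G.m × I) (v : Fin G.k) : Prop :=
  (p.2 = 0 ∧ G.src p.1 = v) ∨ (p.2 = 1 ∧ G.tgt p.1 = v)

theorem AtVertex.unique {G : Graph} {p : Fin G.m × I} {v w : Fin G.k}
    (hv : G.AtVertex p v) (hw : G.AtVertex p w) : v = w := by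
  rcases hv with ⟨h, rfl⟩ | ⟨h, rfl⟩ <;> rcases hw with ⟨h', rfl⟩ | ⟨h', rfl⟩
  · rfl
  · exact absurd (h.symm.trans h') zero_ne_one
  · exact absurd (h'.symm.trans h) zero_ne_one
  · rfl

/-- Two points of the disjoint union of the edges are glued if they are the same vertex. -/
def glue : Setoid (Fin G.m × I) where
  r p q := p = q ∨ ∃ v, G.AtVertex p v ∧ G.AtVertex q v
  iseqv :=
    { refl := fun _ => Or.inl rfl
      symm := by
        rintro p q (rfl | ⟨v, hp, hq⟩)
        · exact Or.inl rfl
        · exact Or.inr ⟨v, hq, hp⟩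
      trans := by
        rintro p q r (rfl | ⟨v, hp, hq⟩) (rfl | ⟨w, hq', hr⟩)
        · exact Or.inl rfl
        · exact Or.inr ⟨w, hq', hr⟩
        · exact Or.inr ⟨v, hp, hq⟩
        · exact Or.inr ⟨v, hp, (hq.unique hq') ▸ hr⟩ }

/-- The points of the cake: one copy of `[0, 1]` for each edge, glued along common vertices. -/
def Point : Type := Quotient G.glue

instance : TopologicalSpace G.Point := inferInstanceAs (TopologicalSpace (Quotient G.glue))

/-- The point of edge `e` with coordinate `u`. -/
def point (e : Fin G.m) (u : I) : G.Point := Quotient.mk G.glue (e, u)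

/-- The interval `[x, y]` of edge `e`. -/
def interval (e : Fin G.m) (x y : ℝ) : Set G.Point :=
  {p | ∃ u : I, x ≤ (u : ℝ) ∧ (u : ℝ) ≤ y ∧ p = G.point e u}

/-- A piece of cake: a finite union of closed intervals of edges. (Overlapping intervals of one edge
can be merged, so the intervals may be taken with pairwise finite intersections.) -/
def IsPiece (A : Set G.Point) : Prop :=
  ∃ F : Finset (Fin G.m × ℝ × ℝ),
    (∀ f ∈ F, 0 ≤ f.2.1 ∧ f.2.1 ≤ f.2.2 ∧ f.2.2 ≤ 1) ∧
    A = ⋃ f ∈ F, G.interval f.1 f.2.1 f.2.2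

/-- A share: a piece in which any two points are joined by a path that stays in the piece. -/
def IsShare (A : Set G.Point) : Prop :=
  G.IsPiece A ∧ ∀ p ∈ A, ∀ q ∈ A, JoinedIn A p q

end Graph

/-- A valuation function: nonnegative, normalized, divisible, and additive on pieces that meet in
finitely many points. Its values outside pieces are irrelevant. -/
structure Valuation (G : Graph) where
  val : Set G.Point → ℝ
  nonneg : ∀ A, G.IsPiece A → 0 ≤ val A
  normalized : val Set.univ = 1
  divisible : ∀ (e : Fin G.m) (x y l : ℝ), 0 ≤ x → x ≤ y → y ≤ 1 → 0 ≤ l → l ≤ 1 →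
    ∃ z, x ≤ z ∧ z ≤ y ∧ val (G.interval e x z) = l * val (G.interval e x y)
  additive : ∀ A B, G.IsPiece A → G.IsPiece B → (A ∩ B).Finite → val (A ∪ B) = val A + val B

/-- The agents have identical valuations. -/
def Identical {G : Graph} {n : ℕ} (μ : Fin n → Valuation G) : Prop :=
  ∀ i j A, G.IsShare A → (μ i).val A = (μ j).val A

/-- A (connected) allocation of the whole cake: every agent gets a share, two different agents' shares
meet in finitely many points, and every point of the cake is allocated. -/
structure IsAllocation (G : Graph) {n : ℕ} (A : Fin n → Set G.Point) : Prop where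
  share : ∀ i, G.IsShare (A i)
  disjoint : ∀ i j, i ≠ j → (A i ∩ A j).Finite
  cover : ⋃ i, A i = Set.univ

/-- `α`-envy-freeness: no agent envies another agent by a factor of more than `α`. -/
def IsEF {G : Graph} {n : ℕ} (μ : Fin n → Valuation G) (α : ℝ) (A : Fin n → Set G.Point) : Prop :=
  ∀ i j, (μ i).val (A i) ≥ (μ i).val (A j) / α

/-! ### The model of computation: a real RAM with Robertson–Webb queries -/

/-- Answers to the two kinds of queries; the arguments are the number of an agent, the number of an
edge, and two reals. -/
structure Oracle where
  evalAnswer : ℕ → ℕ → ℝ → ℝ → ℝ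
  cutAnswer : ℕ → ℕ → ℝ → ℝ → ℝ

/-- The oracle answers the queries truthfully: `Eval` returns the value of an interval `[x, y]` of an
edge to an agent, and `Cut` returns some point `y` of the edge such that `[x, y]` has the required
value, if that value does not exceed the value of the rest of the edge. Nothing is known about the
answers to any other queries. -/
def Oracle.Truthful {G : Graph} {n : ℕ} (O : Oracle) (μ : Fin n → Valuation G) : Prop :=
  ∀ (i : Fin n) (e : Fin G.m) (x : ℝ), 0 ≤ x → x ≤ 1 →
    (∀ y, x ≤ y → y ≤ 1 → O.evalAnswer i e x y = (μ i).val (G.interval e x y)) ∧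
    (∀ a, 0 ≤ a → a ≤ (μ i).val (G.interval e x 1) →
      x ≤ O.cutAnswer i e x a ∧ O.cutAnswer i e x a ≤ 1 ∧
        (μ i).val (G.interval e x (O.cutAnswer i e x a)) = a)

/-- The memory: arrays of natural numbers and arrays of reals. The first argument is the number of
the array, the second one is the index of the cell. -/
structure Store where
  nat : ℕ → ℕ → ℕ
  real : ℕ → ℕ → ℝ

/-- The store after writing `v` into a cell of an array of natural numbers. -/
def Store.setNat (s : Store) (a i v : ℕ) : Store :=
  { s with nat := Function.update s.nat a (Function.update (s.nat a) i v) }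

/-- The store after writing `v` into a cell of an array of reals. -/
noncomputable def Store.setReal (s : Store) (a i : ℕ) (v : ℝ) : Store :=
  { s with real := Function.update s.real a (Function.update (s.real a) i v) }

/-- Expressions for natural numbers (used as indices and counters): constants, cells with a computed
index, addition and truncated subtraction. -/
inductive NatExpr where
  | const (c : ℕ)
  | cell (a : ℕ) (i : NatExpr)
  | add (x y : NatExpr)
  | sub (x y : NatExpr)

/-- The value of an expression for a natural number. -/
def NatExpr.value (s : Store) : NatExpr → ℕ
  | const c => c
  | cell a i => s.nat a (i.value s)
  | add x y => x.value s + y.value s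
  | sub x y => x.value s - y.value s

/-- Expressions for reals: rational constants, cells with a computed index, natural numbers, and the
four arithmetic operations. Reals cannot be rounded or converted to natural numbers. -/
inductive RealExpr where
  | const (c : ℚ)
  | cell (a : ℕ) (i : NatExpr)
  | ofNat (x : NatExpr)
  | add (x y : RealExpr)
  | sub (x y : RealExpr)
  | mul (x y : RealExpr)
  | div (x y : RealExpr)

/-- The value of an expression for a real (a division by `0` gives `0`). -/
noncomputable def RealExpr.value (s : Store) : RealExpr → ℝ
  | const c => (c : ℝ)
  | cell a i => s.real a (i.value s)
  | ofNat x => (x.value s : ℝ)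
  | add x y => x.value s + y.value s
  | sub x y => x.value s - y.value s
  | mul x y => x.value s * y.value s
  | div x y => x.value s / y.value s

/-- Tests: comparisons of natural numbers and of reals, and their Boolean combinations. -/
inductive Test where
  | natLE (x y : NatExpr)
  | realLE (x y : RealExpr)
  | not (b : Test)
  | and (b c : Test)

/-- The test succeeds. -/
def Test.Holds (s : Store) : Test → Prop
  | natLE x y => x.value s ≤ y.value s
  | realLE x y => x.value s ≤ y.value s
  | not b => ¬ b.Holds s
  | and b c => b.Holds s ∧ c.Holds s

/-- Programs. `setNat a i x` and `setReal a i x` write the value of `x` into cell `i` of array `a`.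
`evalQuery a i g e x y` writes the answer to the query `Eval` of agent `g` about the interval `[x, y]`
of edge `e` into cell `i` of the real array `a`; `cutQuery a i g e x v` writes there the answer to the
query `Cut` of agent `g` on edge `e` with starting point `x` and value `v`. -/
inductive Program where
  | skip
  | setNat (a : ℕ) (i : NatExpr) (x : NatExpr)
  | setReal (a : ℕ) (i : NatExpr) (x : RealExpr)
  | evalQuery (a : ℕ) (i : NatExpr) (g e : NatExpr) (x y : RealExpr)
  | cutQuery (a : ℕ) (i : NatExpr) (g e : NatExpr) (x v : RealExpr)
  | seq (c d : Program)
  | ite (b : Test) (c d : Program)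
  | loop (b : Test) (c : Program)

/-- `Runs O c s s' T`: the program `c`, started on the store `s` and with queries answered by `O`,
terminates on the store `s'` after `T` steps. Every assignment, every query and every evaluation of a
test takes one step. (The expressions in a program have a fixed size, so this is the number of
elementary operations up to a constant factor that depends only on the program.) -/
inductive Runs (O : Oracle) : Program → Store → Store → ℕ → Prop
  | skip (s : Store) : Runs O .skip s s 1
  | setNat (s : Store) (a : ℕ) (i x : NatExpr) :
      Runs O (.setNat a i x) s (s.setNat a (i.value s) (x.value s)) 1
  | setReal (s : Store) (a : ℕ) (i : NatExpr) (x : RealExpr) :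
      Runs O (.setReal a i x) s (s.setReal a (i.value s) (x.value s)) 1
  | evalQuery (s : Store) (a : ℕ) (i g e : NatExpr) (x y : RealExpr) :
      Runs O (.evalQuery a i g e x y) s
        (s.setReal a (i.value s)
          (O.evalAnswer (g.value s) (e.value s) (x.value s) (y.value s))) 1
  | cutQuery (s : Store) (a : ℕ) (i g e : NatExpr) (x v : RealExpr) :
      Runs O (.cutQuery a i g e x v) s
        (s.setReal a (i.value s)
          (O.cutAnswer (g.value s) (e.value s) (x.value s) (v.value s))) 1
  | seq {c d : Program} {s s' s'' : Store} {T T' : ℕ} :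
      Runs O c s s' T → Runs O d s' s'' T' → Runs O (.seq c d) s s'' (T + T')
  | iteTrue {b : Test} {c d : Program} {s s' : Store} {T : ℕ} :
      b.Holds s → Runs O c s s' T → Runs O (.ite b c d) s s' (T + 1)
  | iteFalse {b : Test} {c d : Program} {s s' : Store} {T : ℕ} :
      ¬ b.Holds s → Runs O d s s' T → Runs O (.ite b c d) s s' (T + 1)
  | loopTrue {b : Test} {c : Program} {s s' s'' : Store} {T T' : ℕ} :
      b.Holds s → Runs O c s s' T → Runs O (.loop b c) s' s'' T' →
        Runs O (.loop b c) s s'' (T + T' + 1)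
  | loopFalse {b : Test} {c : Program} {s : Store} :
      ¬ b.Holds s → Runs O (.loop b c) s s 1

/-- The input of a program. The natural array `0` holds the number of agents, the number of vertices
and the number of edges; the natural arrays `1` and `2` hold the two endpoints of each edge; cell `0`
of the real array `0` holds `ε`. All other cells hold `0`. The valuations are not part of the input:
they are accessible only through queries. -/
noncomputable def inputStore (G : Graph) (n : ℕ) (ε : ℝ) : Store where
  nat a i :=
    if a = 0 then (if i = 0 then n else if i = 1 then G.k else if i = 2 then G.m else 0)
    else if a = 1 then (if h : i < G.m then (G.src ⟨i, h⟩ : ℕ) else 0)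
    else if a = 2 then (if h : i < G.m then (G.tgt ⟨i, h⟩ : ℕ) else 0)
    else 0
  real a i := if a = 0 ∧ i = 0 then ε else 0

/-- The output of a program is a list of records, each of which gives an interval of an edge to an
agent. Cell `0` of the natural array `3` holds the number of records; record `r` gives to agent
`s.nat 4 r` the interval of edge `s.nat 5 r` between the coordinates `s.real 1 r` and `s.real 2 r`.
This says that all records are meaningful. -/
def OutputValid (G : Graph) (n : ℕ) (s : Store) : Prop :=
  ∀ r < s.nat 3 0, s.nat 4 r < n ∧ s.nat 5 r < G.m ∧
    0 ≤ s.real 1 r ∧ s.real 1 r ≤ s.real 2 r ∧ s.real 2 r ≤ 1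

/-- What each agent gets according to the output: the union of the intervals in the agent's records. -/
def outputShares (G : Graph) (n : ℕ) (s : Store) (i : Fin n) : Set G.Point :=
  {p | ∃ r < s.nat 3 0, s.nat 4 r = (i : ℕ) ∧
    ∃ e : Fin G.m, s.nat 5 r = (e : ℕ) ∧ p ∈ G.interval e (s.real 1 r) (s.real 2 r)}

end GraphCake

namespace GraphCake

/-! ### A Hoare logic for programs -/

/-- The arrays of natural numbers into which a program writes. -/
def Program.natArrays : Program → List ℕ
  | .skip => []
  | .setNat a _ _ => [a]
  | .setReal _ _ _ => []
  | .evalQuery _ _ _ _ _ _ => []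
  | .cutQuery _ _ _ _ _ _ => []
  | .seq c d => c.natArrays ++ d.natArrays
  | .ite _ c d => c.natArrays ++ d.natArrays
  | .loop _ c => c.natArrays

/-- The arrays of reals into which a program writes. -/
def Program.realArrays : Program → List ℕ
  | .skip => []
  | .setNat _ _ _ => []
  | .setReal a _ _ => [a]
  | .evalQuery a _ _ _ _ _ => [a]
  | .cutQuery a _ _ _ _ _ => [a]
  | .seq c d => c.realArrays ++ d.realArrays
  | .ite _ c d => c.realArrays ++ d.realArrays
  | .loop _ c => c.realArrays

/-- A bound for the running time of a program each of whose loops makes at most `L` iterations. -/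
def Program.cost {R : Type*} [CommSemiring R] (L : R) : Program → R
  | .skip => 1
  | .setNat _ _ _ => 1
  | .setReal _ _ _ => 1
  | .evalQuery _ _ _ _ _ _ => 1
  | .cutQuery _ _ _ _ _ _ => 1
  | .seq c d => c.cost L + d.cost L
  | .ite _ c d => c.cost L + d.cost L + 1
  | .loop _ c => L * (c.cost L + 1) + 1

theorem Program.map_cost {R S : Type*} [CommSemiring R] [CommSemiring S] (f : R →+* S) (L : R)
    (c : Program) : f (c.cost L) = c.cost (f L) := by
  induction c <;> simp_all [Program.cost]

theorem Program.cost_nonneg {L : ℝ} (h : 0 ≤ L) (c : Program) : 0 ≤ c.cost L := by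
  induction c <;> simp only [Program.cost] <;> positivity

theorem Program.cost_mono {L L' : ℝ} (h : 0 ≤ L) (h' : L ≤ L') (c : Program) :
    c.cost L ≤ c.cost L' := by
  induction c with
  | seq c d hc hd => simp only [Program.cost]; gcongr
  | ite b c d hc hd => simp only [Program.cost]; gcongr
  | loop b c hc =>
    have := c.cost_nonneg h
    have := h.trans h'
    simp only [Program.cost]
    gcongr
  | _ => simp [Program.cost]

/-- The stores `s` and `s'` agree except on the arrays into which `c` writes. -/
structure Frame (c : Program) (s s' : Store) : Prop where
  nat : ∀ a, a ∉ c.natArrays → s'.nat a = s.nat a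
  real : ∀ a, a ∉ c.realArrays → s'.real a = s.real a

theorem Frame.refl (c : Program) (s : Store) : Frame c s s := ⟨fun _ _ => rfl, fun _ _ => rfl⟩

theorem Frame.trans {c : Program} {s s' s'' : Store} (h : Frame c s s') (h' : Frame c s' s'') :
    Frame c s s'' :=
  ⟨fun a ha => (h'.nat a ha).trans (h.nat a ha), fun a ha => (h'.real a ha).trans (h.real a ha)⟩

theorem Frame.mono {c d : Program} {s s' : Store} (h : Frame c s s')
    (hn : c.natArrays ⊆ d.natArrays) (hr : c.realArrays ⊆ d.realArrays) : Frame d s s' :=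
  ⟨fun a ha => h.nat a fun h' => ha (hn h'), fun a ha => h.real a fun h' => ha (hr h')⟩

@[simp] theorem Store.setNat_nat (s : Store) (a i v b j : ℕ) :
    (s.setNat a i v).nat b j = if b = a ∧ j = i then v else s.nat b j := by
  simp only [Store.setNat, Function.update_apply]
  split_ifs <;> simp_all

@[simp] theorem Store.setNat_real (s : Store) (a i v : ℕ) : (s.setNat a i v).real = s.real := rfl

@[simp] theorem Store.setReal_nat (s : Store) (a i : ℕ) (v : ℝ) :
    (s.setReal a i v).nat = s.nat := rfl

@[simp] theorem Store.setReal_real (s : Store) (a i : ℕ) (v : ℝ) (b j : ℕ) :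
    (s.setReal a i v).real b j = if b = a ∧ j = i then v else s.real b j := by
  simp only [Store.setReal, Function.update_apply]
  split_ifs <;> simp_all

theorem Store.setNat_nat_of_ne (s : Store) {a b : ℕ} (i v : ℕ) (h : b ≠ a) :
    (s.setNat a i v).nat b = s.nat b := by
  simp [Store.setNat, h]

theorem Store.setReal_real_of_ne (s : Store) {a b : ℕ} (i : ℕ) (v : ℝ) (h : b ≠ a) :
    (s.setReal a i v).real b = s.real b := by
  simp [Store.setReal, h]

theorem Runs.frame {O : Oracle} {c : Program} {s s' : Store} {T : ℕ} (h : Runs O c s s' T) :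
    Frame c s s' := by
  induction h with
  | skip s => exact Frame.refl _ _
  | setNat s a i x =>
    exact ⟨fun b hb => s.setNat_nat_of_ne _ _ (by simpa [Program.natArrays] using hb),
      fun _ _ => rfl⟩
  | setReal s a i x =>
    exact ⟨fun _ _ => rfl,
      fun b hb => s.setReal_real_of_ne _ _ (by simpa [Program.realArrays] using hb)⟩
  | evalQuery s a i g e x y =>
    exact ⟨fun _ _ => rfl,
      fun b hb => s.setReal_real_of_ne _ _ (by simpa [Program.realArrays] using hb)⟩
  | cutQuery s a i g e x y =>
    exact ⟨fun _ _ => rfl,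
      fun b hb => s.setReal_real_of_ne _ _ (by simpa [Program.realArrays] using hb)⟩
  | seq _ _ h1 h2 =>
    exact (h1.mono (List.subset_append_left _ _) (List.subset_append_left _ _)).trans
      (h2.mono (List.subset_append_right _ _) (List.subset_append_right _ _))
  | iteTrue _ _ h1 => exact h1.mono (List.subset_append_left _ _) (List.subset_append_left _ _)
  | iteFalse _ _ h1 =>
    exact h1.mono (List.subset_append_right _ _) (List.subset_append_right _ _)
  | loopTrue _ _ _ h1 h2 => exact Frame.trans (h1.mono (d := .loop _ _) (fun _ h => h) (fun _ h => h)) h2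
  | loopFalse _ => exact Frame.refl _ _

/-- Started on `s`, the program `c` terminates within `c.cost L` steps on a store that
satisfies `Q`. -/
def Does (O : Oracle) (L : ℕ) (c : Program) (s : Store) (Q : Store → Prop) : Prop :=
  ∃ s' T, Runs O c s s' T ∧ T ≤ c.cost L ∧ Q s'

namespace Does

variable {O : Oracle} {L : ℕ} {c d : Program} {s : Store} {Q Q' : Store → Prop}

theorem imp (h : Does O L c s Q) (hQ : ∀ s', Frame c s s' → Q s' → Q' s') : Does O L c s Q' := by
  obtain ⟨s', T, h, hT, h'⟩ := h
  exact ⟨s', T, h, hT, hQ _ h.frame h'⟩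

theorem skip (h : Q s) : Does O L .skip s Q := ⟨_, _, .skip s, le_refl _, h⟩

theorem setNat {a : ℕ} {i x : NatExpr} (h : Q (s.setNat a (i.value s) (x.value s))) :
    Does O L (.setNat a i x) s Q := ⟨_, _, .setNat s a i x, le_refl _, h⟩

theorem setReal {a : ℕ} {i : NatExpr} {x : RealExpr}
    (h : Q (s.setReal a (i.value s) (x.value s))) :
    Does O L (.setReal a i x) s Q := ⟨_, _, .setReal s a i x, le_refl _, h⟩

theorem evalQuery {a : ℕ} {i g e : NatExpr} {x y : RealExpr}
    (h : Q (s.setReal a (i.value s)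
      (O.evalAnswer (g.value s) (e.value s) (x.value s) (y.value s)))) :
    Does O L (.evalQuery a i g e x y) s Q := ⟨_, _, .evalQuery s a i g e x y, le_refl _, h⟩

theorem cutQuery {a : ℕ} {i g e : NatExpr} {x y : RealExpr}
    (h : Q (s.setReal a (i.value s)
      (O.cutAnswer (g.value s) (e.value s) (x.value s) (y.value s)))) :
    Does O L (.cutQuery a i g e x y) s Q := ⟨_, _, .cutQuery s a i g e x y, le_refl _, h⟩

theorem seq (h : Does O L c s fun s' => Does O L d s' Q) : Does O L (.seq c d) s Q := by
  obtain ⟨s', T, h, hT, s'', T', h', hT', hQ⟩ := h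
  exact ⟨s'', _, h.seq h', Nat.add_le_add hT hT', hQ⟩

theorem ite {b : Test} (h : b.Holds s → Does O L c s Q) (h' : ¬ b.Holds s → Does O L d s Q) :
    Does O L (.ite b c d) s Q := by
  by_cases hb : b.Holds s
  · obtain ⟨s', T, h, hT, hQ⟩ := h hb
    exact ⟨s', _, .iteTrue hb h, by simp only [Program.cost]; omega, hQ⟩
  · obtain ⟨s', T, h, hT, hQ⟩ := h' hb
    exact ⟨s', _, .iteFalse hb h, by simp only [Program.cost]; omega, hQ⟩

theorem loop {b : Test} (Inv : Store → Prop) (var : Store → ℕ) (h0 : Inv s) (hL : var s ≤ L)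
    (step : ∀ s', Frame (.loop b c) s s' → Inv s' → b.Holds s' →
      Does O L c s' fun s'' => Inv s'' ∧ var s'' < var s')
    (post : ∀ s', Frame (.loop b c) s s' → Inv s' → ¬ b.Holds s' → Q s') :
    Does O L (.loop b c) s Q := by
  have key : ∀ k s', Frame (.loop b c) s s' → Inv s' → var s' ≤ k →
      ∃ s'' T, Runs O (.loop b c) s' s'' T ∧ T ≤ k * (c.cost L + 1) + 1 ∧ Q s'' := by
    intro k
    induction k with
    | zero =>
      intro s' hf hi hv
      by_cases hb : b.Holds s'
      · obtain ⟨_, _, _, _, _, h⟩ := step s' hf hi hb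
        omega
      · exact ⟨s', 1, .loopFalse hb, by omega, post s' hf hi hb⟩
    | succ k ih =>
      intro s' hf hi hv
      by_cases hb : b.Holds s'
      · obtain ⟨s1, T1, r1, hT1, hi1, hv1⟩ := step s' hf hi hb
        have f1 : Frame (.loop b c) s' s1 := r1.frame.mono (fun _ h => h) (fun _ h => h)
        obtain ⟨s2, T2, r2, hT2, hq⟩ := ih s1 (hf.trans f1) hi1 (by omega)
        refine ⟨s2, _, .loopTrue hb r1 r2, ?_, hq⟩
        rw [Nat.succ_mul]
        omega
      · exact ⟨s', 1, .loopFalse hb, by omega, post s' hf hi hb⟩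
  obtain ⟨s'', T, r, hT, hq⟩ := key L s (Frame.refl _ _) h0 hL
  exact ⟨s'', T, r, by simpa [Program.cost] using hT, hq⟩

end Does

/-! ### Abbreviations for expressions, tests and programs -/

/-- The value of a scalar variable. -/
abbrev NatExpr.var (a : ℕ) : NatExpr := .cell a (.const 0)

/-- The value of a scalar variable. -/
abbrev RealExpr.var (a : ℕ) : RealExpr := .cell a (.const 0)

/-- Equality of natural numbers. -/
def Test.eq (x y : NatExpr) : Test := .and (.natLE x y) (.natLE y x)

/-- Disjunction. -/
def Test.or (b c : Test) : Test := .not (.and (.not b) (.not c))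

@[simp] theorem Test.holds_eq (s : Store) (x y : NatExpr) :
    (Test.eq x y).Holds s ↔ x.value s = y.value s := by
  simp [Test.eq, Test.Holds, le_antisymm_iff]

@[simp] theorem Test.holds_or (s : Store) (b c : Test) :
    (Test.or b c).Holds s ↔ b.Holds s ∨ c.Holds s := by
  simp only [Test.or, Test.Holds]; tauto

attribute [simp] Test.Holds NatExpr.value RealExpr.value

/-- `for i < b do c`. -/
def Program.forUpTo (i : ℕ) (b : NatExpr) (c : Program) : Program :=
  .seq (.setNat i (.const 0) (.const 0))
    (.loop (.not (.natLE b (.var i)))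
      (.seq c (.setNat i (.const 0) (.add (.var i) (.const 1)))))

/-- Store in `x` some `i < b` that passes the test, if there is one. -/
def Program.find (i : ℕ) (b : NatExpr) (t : Test) (x : ℕ) : Program :=
  .forUpTo i b (.ite t (.setNat x (.const 0) (.var i)) .skip)

/-- Store in `acc` the sum of the entries of the array `w` at those `i < b` that pass the test. -/
def Program.sumIf (i : ℕ) (b : NatExpr) (t : Test) (acc w : ℕ) : Program :=
  .seq (.setReal acc (.const 0) (.const 0))
    (.forUpTo i b
      (.ite t (.setReal acc (.const 0) (.add (.var acc) (.cell w (.var i)))) .skip))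

/-- Fill the first `b` cells of an array with `x` if the test succeeds and with `y` otherwise. -/
def Program.fill (i : ℕ) (b : NatExpr) (arr : ℕ) (t : Test) (x y : NatExpr) : Program :=
  .forUpTo i b (.ite t (.setNat arr (.var i) x) (.setNat arr (.var i) y))

namespace Does

variable {O : Oracle} {L : ℕ} {c d : Program} {s : Store} {Q Q' : Store → Prop}

theorem forUpTo {i : ℕ} {b : NatExpr} (B : ℕ) (Inv : ℕ → Store → Prop) (hB : B ≤ L)
    (hi : i ∉ c.natArrays)
    (hb : ∀ s', Frame (.forUpTo i b c) s s' → b.value s' = B)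
    (h0 : Inv 0 (s.setNat i 0 0))
    (step : ∀ k < B, ∀ s', Frame (.forUpTo i b c) s s' → s'.nat i 0 = k → Inv k s' →
      Does O L c s' fun s'' => Inv (k + 1) (s''.setNat i 0 (k + 1)))
    (post : ∀ s', Frame (.forUpTo i b c) s s' → Inv B s' → Q s') :
    Does O L (.forUpTo i b c) s Q := by
  refine Does.seq (Does.setNat ?_)
  simp only [NatExpr.value]
  set s0 := s.setNat i 0 0 with hs0
  have f0 : Frame (.forUpTo i b c) s s0 :=
    ⟨fun a ha => s.setNat_nat_of_ne _ _ (by rintro rfl; simp [Program.forUpTo, Program.natArrays] at ha),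
      fun _ _ => rfl⟩
  have fl : ∀ s', Frame (.loop (.not (.natLE b (.var i)))
      (.seq c (.setNat i (.const 0) (.add (.var i) (.const 1))))) s0 s' →
      Frame (.forUpTo i b c) s s' := fun s' h =>
    f0.trans (h.mono (by simp [Program.forUpTo, Program.natArrays]) (by
      simp [Program.forUpTo, Program.realArrays]))
  refine Does.loop (fun s' => s'.nat i 0 ≤ B ∧ Inv (s'.nat i 0) s') (fun s' => B - s'.nat i 0)
    ⟨by simp [s0], by simpa [s0] using h0⟩ (by omega) ?_ ?_
  · rintro s' hf ⟨hk, hInv⟩ ht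
    have hbB := hb s' (fl s' hf)
    simp only [Test.Holds, NatExpr.value, hbB, not_le] at ht
    refine Does.seq (Does.imp (step _ ht s' (fl s' hf) rfl hInv) ?_)
    intro s'' hf' h
    refine Does.setNat ?_
    have e : s''.nat i 0 = s'.nat i 0 := by rw [hf'.nat i hi]
    simp only [NatExpr.value, e]
    refine ⟨⟨by simp; omega, by simpa using h⟩, by simp; omega⟩
  · rintro s' hf ⟨hk, hInv⟩ ht
    have hbB := hb s' (fl s' hf)
    simp only [Test.Holds, NatExpr.value, hbB, not_not] at ht
    exact post s' (fl s' hf) (by rwa [le_antisymm hk ht] at hInv)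

theorem find {i x : ℕ} {b : NatExpr} {t : Test} (B : ℕ) (p : ℕ → Prop) (hB : B ≤ L) (hx : i ≠ x)
    (hb : ∀ s', Frame (.find i b t x) s s' → b.value s' = B)
    (ht : ∀ s', Frame (.find i b t x) s s' → s'.nat i 0 < B →
      (t.Holds s' ↔ p (s'.nat i 0)))
    (post : ∀ s', Frame (.find i b t x) s s' →
      (s'.nat x 0 = s.nat x 0 ∧ ∀ a < B, ¬ p a) ∨ (s'.nat x 0 < B ∧ p (s'.nat x 0)) → Q s') :
    Does O L (.find i b t x) s Q := by
  refine Does.forUpTo B (fun k s' => (s'.nat x 0 = s.nat x 0 ∧ ∀ a < k, ¬ p a) ∨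
    (s'.nat x 0 < B ∧ p (s'.nat x 0))) hB (by simp [Program.natArrays, hx]) hb ?_ ?_ post
  · left; simp [hx.symm]
  · intro k hk s' hf hik hInv
    have htk := ht s' hf (by omega)
    rw [hik] at htk
    refine Does.ite (fun h => Does.setNat ?_) (fun h => Does.skip ?_)
    · right
      simp [hik, hk, htk.1 h, hx.symm]
    · simp only [Store.setNat_nat, hx.symm, false_and, if_false]
      refine hInv.imp_left fun h' => ⟨h'.1, fun a ha => ?_⟩
      rcases Nat.lt_succ_iff_lt_or_eq.1 ha with ha | rfl
      · exact h'.2 a ha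
      · exact fun hp => h (htk.2 hp)

theorem sumIf {i acc w : ℕ} {b : NatExpr} {t : Test} (B : ℕ) (p : ℕ → Prop) [DecidablePred p]
    (hB : B ≤ L) (hw : w ≠ acc)
    (hb : ∀ s', Frame (.sumIf i b t acc w) s s' → b.value s' = B)
    (ht : ∀ s', Frame (.sumIf i b t acc w) s s' → s'.nat i 0 < B →
      (t.Holds s' ↔ p (s'.nat i 0)))
    (post : ∀ s', Frame (.sumIf i b t acc w) s s' →
      s'.real acc 0 = ∑ a ∈ (Finset.range B).filter p, s.real w a → Q s') :
    Does O L (.sumIf i b t acc w) s Q := by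
  refine Does.seq (Does.setReal ?_)
  simp only [NatExpr.value, RealExpr.value, Rat.cast_zero]
  have f0 : Frame (.sumIf i b t acc w) s (s.setReal acc 0 0) :=
    ⟨fun _ _ => rfl, fun a ha => s.setReal_real_of_ne _ _
      (by rintro rfl; simp [Program.sumIf, Program.realArrays] at ha)⟩
  have fl : ∀ s', Frame (.forUpTo i b
      (.ite t (.setReal acc (.const 0) (.add (.var acc) (.cell w (.var i)))) .skip))
      (s.setReal acc 0 0) s' → Frame (.sumIf i b t acc w) s s' := fun s' h =>
    f0.trans (h.mono (by simp [Program.sumIf, Program.natArrays]) (by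
      simp [Program.sumIf, Program.realArrays]))
  refine Does.forUpTo B
    (fun k s' => s'.real acc 0 = ∑ a ∈ (Finset.range k).filter p, s.real w a) hB
    (by simp [Program.natArrays]) (fun s' h => hb s' (fl s' h)) (by simp) ?_
    (fun s' h h' => post s' (fl s' h) h')
  intro k hk s' hf hik hInv
  have htk := ht s' (fl s' hf) (by omega)
  have ew : s'.real w = s.real w := (fl s' hf).real w (by
    simp [Program.sumIf, Program.forUpTo, Program.realArrays, hw])
  rw [hik] at htk
  refine Does.ite (fun h => Does.setReal ?_) (fun h => Does.skip ?_)
  · simp [Finset.range_add_one, Finset.filter_insert, htk.1 h, hInv, hik, ew, add_comm]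
  · simp [Finset.range_add_one, Finset.filter_insert, (not_congr htk).1 h, hInv]

theorem fill {i arr : ℕ} {b x y : NatExpr} {t : Test} (B : ℕ) (f : ℕ → ℕ) (hB : B ≤ L)
    (hi : i ≠ arr)
    (hb : ∀ s', Frame (.fill i b arr t x y) s s' → b.value s' = B)
    (ht : ∀ s', Frame (.fill i b arr t x y) s s' → s'.nat i 0 < B →
      s'.nat arr (s'.nat i 0) = s.nat arr (s'.nat i 0) →
      (t.Holds s' → x.value s' = f (s'.nat i 0)) ∧ (¬ t.Holds s' → y.value s' = f (s'.nat i 0)))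
    (post : ∀ s', Frame (.fill i b arr t x y) s s' → (∀ a < B, s'.nat arr a = f a) → Q s') :
    Does O L (.fill i b arr t x y) s Q := by
  refine Does.forUpTo B
    (fun k s' => (∀ a < k, s'.nat arr a = f a) ∧ ∀ a, k ≤ a → s'.nat arr a = s.nat arr a) hB
    (by simp [Program.natArrays, hi]) hb (by simp [hi.symm]) ?_
    (fun s' h h' => post s' h h'.1)
  intro k hk s' hf hik hInv
  have htk := ht s' hf (by omega) (by rw [hik]; exact hInv.2 k le_rfl)
  rw [hik] at htk
  refine Does.ite (fun h => Does.setNat ?_) (fun h => Does.setNat ?_)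
  all_goals
    simp only [NatExpr.value, hik, Store.setNat_nat, hi.symm, false_and, if_false, true_and,
      htk.1, htk.2, h, not_false_eq_true]
    refine ⟨fun a ha => ?_, fun a ha => ?_⟩
    · split_ifs with e
      · rw [e]
      · exact hInv.1 a (by omega)
    · rw [if_neg (by omega)]
      exact hInv.2 a (by omega)

end Does

/-! ### Connected sets of atoms -/

open Relation (ReflTransGen)

/-- Any two elements of `S` are joined by a path in `S`. -/
def Conn (adj : ℕ → ℕ → Prop) (S : Finset ℕ) : Prop :=
  ∀ a ∈ S, ∀ b ∈ S, ReflTransGen (fun x y => y ∈ S ∧ adj x y) a b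

/-- Atom `a` joins the nodes `U a` and `V a`; two atoms are adjacent if they share a node. -/
def Adj (U V : ℕ → ℕ) (a b : ℕ) : Prop := U a = U b ∨ U a = V b ∨ V a = U b ∨ V a = V b

theorem Adj.symm {U V : ℕ → ℕ} {a b : ℕ} (h : Adj U V a b) : Adj U V b a := by
  unfold Adj at *; tauto

theorem Adj.claw_free {U V : ℕ → ℕ} {r a b c : ℕ} (ha : Adj U V a r) (hb : Adj U V b r)
    (hc : Adj U V c r) : Adj U V a b ∨ Adj U V a c ∨ Adj U V b c := by
  unfold Adj at *; grind

theorem exists_exit {R : ℕ → ℕ → Prop} {p : ℕ → Prop} {a b : ℕ} (h : ReflTransGen R a b)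
    (ha : p a) (hb : ¬ p b) : ∃ y z, p y ∧ ¬ p z ∧ R y z := by
  induction h with
  | refl => exact absurd ha hb
  | @tail y z _ hyz ih =>
    by_cases hy : p y
    · exact ⟨y, z, hy, hb, hyz⟩
    · exact ih hy

section

variable {U V : ℕ → ℕ} {S T C K : Finset ℕ} {r : ℕ}

theorem path_mono (hST : S ⊆ T) {a b : ℕ}
    (h : ReflTransGen (fun x y => y ∈ S ∧ Adj U V x y) a b) :
    ReflTransGen (fun x y => y ∈ T ∧ Adj U V x y) a b :=
  ReflTransGen.mono (fun _ _ h => ⟨hST h.1, h.2⟩) _ _ h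

theorem path_symm {a b : ℕ} (ha : a ∈ S)
    (h : ReflTransGen (fun x y => y ∈ S ∧ Adj U V x y) a b) :
    ReflTransGen (fun x y => y ∈ S ∧ Adj U V x y) b a := by
  suffices b ∈ S ∧ ReflTransGen (fun x y => y ∈ S ∧ Adj U V x y) b a from this.2
  induction h with
  | refl => exact ⟨ha, .refl⟩
  | tail _ h ih => exact ⟨h.1, .head ⟨ih.1, h.2.symm⟩ ih.2⟩

theorem conn_of_root (hr : r ∈ S)
    (h : ∀ a ∈ S, ReflTransGen (fun x y => y ∈ S ∧ Adj U V x y) r a) : Conn (Adj U V) S :=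
  fun a ha b hb => (path_symm hr (h a ha)).trans (h b hb)

theorem conn_empty : Conn (Adj U V) ∅ := fun a ha => by simp at ha

theorem conn_singleton (a : ℕ) : Conn (Adj U V) {a} := by
  intro x hx y hy
  rw [Finset.mem_singleton] at hx hy
  rw [hx, hy]

theorem Conn.union (hS : Conn (Adj U V) S) (hT : Conn (Adj U V) T) {a b : ℕ} (ha : a ∈ S)
    (hb : b ∈ T) (hab : Adj U V a b) : Conn (Adj U V) (S ∪ T) := by
  refine conn_of_root (Finset.mem_union_left T ha) fun x hx => ?_
  rcases Finset.mem_union.1 hx with hx | hx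
  · exact path_mono Finset.subset_union_left (hS a ha x hx)
  · exact .head ⟨Finset.mem_union_right S hb, hab⟩
      (path_mono Finset.subset_union_right (hT b hb x hx))

/-- A union of components of `C.erase r` reaches a neighbour of `r`. -/
theorem exists_path_to_nbr (hC : Conn (Adj U V) C) (hr : r ∈ C) (hK : K ⊆ C.erase r)
    (hcl : ∀ y ∈ K, ∀ z ∈ C.erase r, Adj U V y z → z ∈ K) {a : ℕ} (ha : a ∈ K) :
    ∃ c ∈ K, Adj U V c r ∧ ReflTransGen (fun x y => y ∈ K ∧ Adj U V x y) a c := by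
  obtain ⟨y, z, hy, hz, hzC, hyz⟩ := exists_exit
    (p := fun y => y ∈ K ∧ ReflTransGen (fun x y => y ∈ K ∧ Adj U V x y) a y)
    (hC a (Finset.mem_of_mem_erase (hK ha)) r hr) ⟨ha, .refl⟩
    (fun h => by simpa using hK h.1)
  by_cases h : z = r
  · exact ⟨y, hy.1, h ▸ hyz, hy.2⟩
  · have hzK := hcl y hy.1 z (Finset.mem_erase.2 ⟨h, hzC⟩) hyz
    exact absurd ⟨hzK, hy.2.tail ⟨hzK, hyz⟩⟩ hz

theorem closed_sdiff (hcl : ∀ y ∈ K, ∀ z ∈ C.erase r, Adj U V y z → z ∈ K) :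
    ∀ y ∈ C.erase r \ K, ∀ z ∈ C.erase r, Adj U V y z → z ∈ C.erase r \ K := by
  intro y hy z hz hyz
  rw [Finset.mem_sdiff] at hy ⊢
  exact ⟨hz, fun h => hy.2 (hcl z h y hy.1 hyz.symm)⟩

/-- By claw-freeness, `C.erase r` has at most two components. -/
theorem conn_sdiff (hC : Conn (Adj U V) C) (hr : r ∈ C) (hK : K ⊆ C.erase r)
    (hcl : ∀ y ∈ K, ∀ z ∈ C.erase r, Adj U V y z → z ∈ K) (hne : K.Nonempty) :
    Conn (Adj U V) (C.erase r \ K) := by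
  have hcl' := closed_sdiff hcl
  obtain ⟨k, hk⟩ := hne
  obtain ⟨n, hn, hnr, -⟩ := exists_path_to_nbr hC hr hK hcl hk
  have hout : ∀ c ∈ C.erase r \ K, ¬ Adj U V n c := fun c hc h => by
    rw [Finset.mem_sdiff] at hc
    exact hc.2 (hcl n hn c hc.1 h)
  intro a ha b hb
  obtain ⟨c, hc, hcr, hac⟩ := exists_path_to_nbr hC hr Finset.sdiff_subset hcl' ha
  obtain ⟨d, hd, hdr, hbd⟩ := exists_path_to_nbr hC hr Finset.sdiff_subset hcl' hb
  rcases hnr.claw_free hcr hdr with h | h | h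
  · exact absurd h (hout c hc)
  · exact absurd h (hout d hd)
  · exact (hac.tail ⟨hd, h⟩).trans (path_symm hb hbd)

/-- One step of peeling: removing `r` and all of `C.erase r` but one component `X` leaves connected
sets. -/
theorem peel_step {M X : Finset ℕ} (hC : Conn (Adj U V) C) (hr : r ∈ C) (hCM : C ⊆ M)
    (hR' : Conn (Adj U V) (insert r (M \ C)))
    (hX : X ⊆ C.erase r) (hcl : ∀ y ∈ X, ∀ z ∈ C.erase r, Adj U V y z → z ∈ X)
    (hXc : Conn (Adj U V) (C.erase r \ X)) (hne : X.Nonempty) :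
    Conn (Adj U V) (M \ X) ∧ r ∈ M \ X ∧ ∃ c ∈ X, Adj U V c r := by
  have e : M \ X = insert r (M \ C) ∪ (C.erase r \ X) := by
    ext a
    have h1 := @hCM a
    have h2 := @hX a
    simp only [Finset.mem_sdiff, Finset.mem_union, Finset.mem_insert, Finset.mem_erase] at *
    by_cases h : a = r
    · subst h; simp [hCM hr] at *; tauto
    · tauto
  refine ⟨?_, ?_, ?_⟩
  · rw [e]
    rcases (C.erase r \ X).eq_empty_or_nonempty with h | ⟨x, hx⟩
    · rwa [h, Finset.union_empty]
    · obtain ⟨c, hc, hcr, -⟩ :=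
        exists_path_to_nbr hC hr Finset.sdiff_subset (closed_sdiff hcl) hx
      exact hR'.union hXc (Finset.mem_insert_self _ _) hc hcr.symm
  · rw [e]; simp
  · obtain ⟨x, hx⟩ := hne
    obtain ⟨c, hc, hcr, -⟩ := exists_path_to_nbr hC hr hX hcl hx
    exact ⟨c, hc, hcr⟩

end

/-! ### Labels -/

/-- The labels `lab` describe a search of the component of `x` in `{a < N | sel a = 1}`: the atoms
found have positive labels, and each of them but `x` has a neighbour with a smaller positive label. -/
structure IsSearch (N : ℕ) (adj : ℕ → ℕ → Prop) (sel : ℕ → ℕ) (x : ℕ) (lab : ℕ → ℕ) : Prop where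
  root : lab x ≠ 0
  le : ∀ a < N, lab a ≤ N
  selected : ∀ a < N, lab a ≠ 0 → sel a = 1
  pred : ∀ a < N, lab a ≠ 0 → a ≠ x → ∃ b < N, lab b ≠ 0 ∧ lab b < lab a ∧ adj b a
  closed : ∀ a < N, ∀ b < N, sel a = 1 → lab b ≠ 0 → adj b a → lab a ≠ 0

/-- The atoms marked by `f`. -/
def marked (N : ℕ) (f : ℕ → ℕ) (v : ℕ) : Finset ℕ := (Finset.range N).filter fun a => f a = v

@[simp] theorem mem_marked {N : ℕ} {f : ℕ → ℕ} {v a : ℕ} : a ∈ marked N f v ↔ a < N ∧ f a = v := by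
  simp [marked]

/-- The atoms with positive label. -/
def found (N : ℕ) (lab : ℕ → ℕ) : Finset ℕ := (Finset.range N).filter fun a => lab a ≠ 0

@[simp] theorem mem_found {N : ℕ} {lab : ℕ → ℕ} {a : ℕ} : a ∈ found N lab ↔ a < N ∧ lab a ≠ 0 := by
  simp [found]

section

variable {N : ℕ} {U V sel lab : ℕ → ℕ} {x : ℕ}

theorem IsSearch.conn (h : IsSearch N (Adj U V) sel x lab) (hx : x < N) :
    Conn (Adj U V) (found N lab) := by
  refine conn_of_root (r := x) (by simp [hx, h.root]) fun a ha => ?_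
  induction hl : lab a using Nat.strong_induction_on generalizing a with
  | _ l ih =>
    rw [mem_found] at ha
    by_cases hax : a = x
    · rw [hax]
    · obtain ⟨b, hb, hb0, hba, hadj⟩ := h.pred a ha.1 ha.2 hax
      exact (ih _ (hl ▸ hba) b (by simp [hb, hb0]) rfl).tail ⟨by simp [ha], hadj⟩

theorem IsSearch.subset (h : IsSearch N (Adj U V) sel x lab) : found N lab ⊆ marked N sel 1 :=
  fun a ha => by
    rw [mem_found] at ha
    exact mem_marked.2 ⟨ha.1, h.selected a ha.1 ha.2⟩

theorem IsSearch.found_closed (h : IsSearch N (Adj U V) sel x lab) :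
    ∀ y ∈ found N lab, ∀ z ∈ marked N sel 1, Adj U V y z → z ∈ found N lab := by
  intro y hy z hz hyz
  rw [mem_found] at *
  rw [mem_marked] at hz
  exact ⟨hz.1, h.closed z hz.1 y hy.1 hz.2 hy.2 hyz⟩

theorem IsSearch.pos_of_conn (h : IsSearch N (Adj U V) sel x lab) (hx : x < N)
    (hc : Conn (Adj U V) (marked N sel 1)) {a : ℕ} (ha : a ∈ marked N sel 1) : lab a ≠ 0 := by
  by_contra h0
  have hxm : x ∈ marked N sel 1 := by simp [hx, h.selected x hx h.root]
  obtain ⟨y, z, hy, hz, hzm, hyz⟩ := exists_exit (p := fun y => y ∈ found N lab)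
    (hc x hxm a ha) (by simp [hx, h.root]) (by simp [h0])
  exact hz (h.found_closed y hy z hzm hyz)

end

/-! ### Names of the arrays and variables of the algorithm -/

notation "aIn" => (0 : ℕ)
notation "aSrc" => (1 : ℕ)
notation "aTgt" => (2 : ℕ)
notation "aN" => (3 : ℕ)
notation "aOwn" => (4 : ℕ)
notation "aEdge" => (5 : ℕ)
notation "aU" => (6 : ℕ)
notation "aV" => (7 : ℕ)
notation "vI" => (8 : ℕ)
notation "vJ" => (9 : ℕ)
notation "vNode" => (10 : ℕ)
notation "aSel" => (11 : ℕ)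
notation "aLab" => (12 : ℕ)
notation "aDist" => (13 : ℕ)
notation "vCnt" => (14 : ℕ)
notation "vFound" => (15 : ℕ)
notation "vNew" => (16 : ℕ)
notation "vX" => (17 : ℕ)
notation "vBig" => (18 : ℕ)
notation "vSmall" => (19 : ℕ)
notation "vM" => (20 : ℕ)
notation "vQ" => (21 : ℕ)
notation "vR" => (22 : ℕ)
notation "vTop" => (23 : ℕ)
notation "vDone" => (24 : ℕ)
notation "vK" => (25 : ℕ)
notation "vNbr" => (26 : ℕ)
notation "vDest" => (27 : ℕ)
notation "vLevel" => (28 : ℕ)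
notation "rEps" => (0 : ℕ)
notation "rX" => (1 : ℕ)
notation "rY" => (2 : ℕ)
notation "rW" => (3 : ℕ)
notation "rEta" => (4 : ℕ)
notation "rT" => (5 : ℕ)
notation "rCur" => (6 : ℕ)
notation "rEv" => (7 : ℕ)
notation "rSum" => (8 : ℕ)
notation "rSum'" => (9 : ℕ)
notation "rWt" => (10 : ℕ)
notation "rCut" => (11 : ℕ)

/-- The number of atoms. -/
abbrev NatExpr.atoms : NatExpr := .var aN

/-- Entry `vI` of an array. -/
abbrev NatExpr.at (a : ℕ) : NatExpr := .cell a (.var vI)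

/-- The adjacency of two atoms. -/
def Test.adj (a b : NatExpr) : Test :=
  .or (.eq (.cell aU a) (.cell aU b)) (.or (.eq (.cell aU a) (.cell aV b))
    (.or (.eq (.cell aV a) (.cell aU b)) (.eq (.cell aV a) (.cell aV b))))

@[simp] theorem Test.holds_adj (s : Store) (a b : NatExpr) :
    (Test.adj a b).Holds s ↔ Adj (s.nat aU) (s.nat aV) (a.value s) (b.value s) := by
  simp [Test.adj, Adj]

/-! ### Searching a component -/

/-- The unlabelled selected atom `vI` is adjacent to the labelled atom `vJ`. -/
def Program.reachTest : Test :=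
  .and (.and (.eq (.at aSel) (.const 1)) (.eq (.at aLab) (.const 0)))
    (.and (.natLE (.const 1) (.cell aLab (.var vJ))) (.adj (.var vJ) (.var vI)))

/-- Look for a pair of adjacent selected atoms exactly one of which has a label. -/
def Program.reachScan : Program :=
  .seq (.setNat vFound (.const 0) (.const 0))
    (.forUpTo vI .atoms (.forUpTo vJ .atoms
      (.ite Program.reachTest
        (.seq (.setNat vNew (.const 0) (.var vI)) (.setNat vFound (.const 0) (.const 1)))
        .skip)))

/-- Label the component of the atom `vX` among the atoms that are marked in `aSel`. -/
def Program.reach : Program :=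
  .seq (.fill vI .atoms aLab (.natLE (.const 0) (.const 0)) (.const 0) (.const 0))
    (.seq (.setNat aLab (.var vX) (.const 1))
    (.seq (.setNat vCnt (.const 0) (.const 1))
    (.seq (.setNat vFound (.const 0) (.const 1))
    (.loop (.natLE (.const 1) (.var vFound))
      (.seq Program.reachScan
        (.ite (.natLE (.const 1) (.var vFound))
          (.seq (.setNat vCnt (.const 0) (.add (.var vCnt) (.const 1)))
            (.setNat aLab (.var vNew) (.var vCnt)))
          .skip))))))

namespace Does

variable {O : Oracle} {L : ℕ} {s : Store} {Q : Store → Prop}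

theorem reachScan (hN : s.nat aN 0 ≤ L)
    (post : ∀ s', Frame Program.reachScan s s' →
      (s'.nat vFound 0 = 0 ∧ ∀ a < s.nat aN 0, ∀ b < s.nat aN 0, s.nat aSel a = 1 →
        s.nat aLab b ≠ 0 → Adj (s.nat aU) (s.nat aV) b a → s.nat aLab a ≠ 0) ∨
      (s'.nat vFound 0 = 1 ∧ s'.nat vNew 0 < s.nat aN 0 ∧ s.nat aSel (s'.nat vNew 0) = 1 ∧
        s.nat aLab (s'.nat vNew 0) = 0 ∧ ∃ b < s.nat aN 0, s.nat aLab b ≠ 0 ∧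
          Adj (s.nat aU) (s.nat aV) b (s'.nat vNew 0)) → Q s') :
    Does O L .reachScan s Q := by
  set N := s.nat aN 0 with hNd
  let P : ℕ → ℕ → Prop := fun a b => (s.nat aSel a = 1 ∧ s.nat aLab a = 0) ∧
    (1 ≤ s.nat aLab b ∧ Adj (s.nat aU) (s.nat aV) b a)
  let F : Store → Prop := fun s' => s'.nat vFound 0 = 1 ∧ s'.nat vNew 0 < N ∧
    ∃ b < N, P (s'.nat vNew 0) b
  suffices Does O L .reachScan s fun s' =>
      (s'.nat vFound 0 = 0 ∧ ∀ a < N, ∀ b < N, ¬ P a b) ∨ F s' by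
    refine this.imp fun s' hf h => post s' hf (h.imp ?_ ?_)
    · rintro ⟨h0, h⟩
      refine ⟨h0, fun a ha b hb h1 h2 h3 h4 => h a ha b hb ⟨⟨h1, h4⟩, by omega, h3⟩⟩
    · rintro ⟨h0, h1, b, hb, ⟨h2, h3⟩, h4, h5⟩
      exact ⟨h0, h1, h2, h3, b, hb, by omega, h5⟩
  refine Does.seq (Does.setNat ?_)
  refine Does.forUpTo N
    (fun k s' => (s'.nat vFound 0 = 0 ∧ ∀ a < k, ∀ b < N, ¬ P a b) ∨ F s') hN (by decide)
    (fun s' h => by simp [h.nat aN (by decide), N]) (by simp) ?_ (fun s' _ h => h)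
  intro k hk s1 hf1 hik hInv
  refine Does.forUpTo N
    (fun j s' => (s'.nat vFound 0 = 0 ∧ (∀ a < k, ∀ b < N, ¬ P a b) ∧ ∀ b < j, ¬ P k b) ∨ F s')
    hN (by decide)
    (fun s' h => by simp [h.nat aN (by decide), hf1.nat aN (by decide), N]) ?_ ?_ ?_
  · simpa [F] using hInv
  · intro j hj s2 hf2 hjk hInv2
    have e : s2.nat vI = s1.nat vI := hf2.nat _ (by decide)
    have ht : Program.reachTest.Holds s2 ↔ P k j := by
      have h1 : s2.nat aSel = s.nat aSel := by
        rw [hf2.nat _ (by decide), hf1.nat _ (by decide)]; funext; simp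
      have h2 : s2.nat aLab = s.nat aLab := by
        rw [hf2.nat _ (by decide), hf1.nat _ (by decide)]; funext; simp
      have h3 : s2.nat aU = s.nat aU := by
        rw [hf2.nat _ (by decide), hf1.nat _ (by decide)]; funext; simp
      have h4 : s2.nat aV = s.nat aV := by
        rw [hf2.nat _ (by decide), hf1.nat _ (by decide)]; funext; simp
      simp only [Program.reachTest, Test.Holds, Test.holds_eq, Test.holds_adj, NatExpr.value,
        h1, h2, h3, h4, e, hik, hjk, P]
    refine Does.ite (fun h => Does.seq (Does.setNat (Does.setNat ?_))) (fun h => Does.skip ?_)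
    · right
      simp only [F, NatExpr.value, Store.setNat_nat, e, hik]
      simp only [Nat.reduceEqDiff, false_and, and_self, if_true, if_false]
      exact ⟨trivial, hk, j, hj, ht.1 h⟩
    · simp only [F, Store.setNat_nat] at hInv2 ⊢
      simp only [Nat.reduceEqDiff, false_and, if_false]
      refine hInv2.imp_left fun h' => ⟨h'.1, h'.2.1, fun b hb => ?_⟩
      rcases Nat.lt_succ_iff_lt_or_eq.1 hb with hb | rfl
      · exact h'.2.2 b hb
      · exact fun hp => h (ht.2 hp)
  · intro s2 hf2 h
    simp only [F, Store.setNat_nat] at h ⊢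
    simp only [Nat.reduceEqDiff, false_and, if_false]
    refine h.imp_left fun h' => ⟨h'.1, fun a ha b hb => ?_⟩
    rcases Nat.lt_succ_iff_lt_or_eq.1 ha with ha | rfl
    · exact h'.2.1 a ha b hb
    · exact h'.2.2 b hb

theorem reach (hN : s.nat aN 0 ≤ L) (hx : s.nat vX 0 < s.nat aN 0)
    (hsel : s.nat aSel (s.nat vX 0) = 1)
    (post : ∀ s', Frame Program.reach s s' →
      IsSearch (s.nat aN 0) (Adj (s.nat aU) (s.nat aV)) (s.nat aSel) (s.nat vX 0) (s'.nat aLab) →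
        Q s') :
    Does O L .reach s Q := by
  suffices Does O L .reach s fun s' => IsSearch (s.nat aN 0) (Adj (s.nat aU) (s.nat aV))
      (s.nat aSel) (s.nat vX 0) (s'.nat aLab) from this.imp post
  set N := s.nat aN 0 with hNd
  set x := s.nat vX 0 with hxd
  set adj := Adj (s.nat aU) (s.nat aV) with hadj
  refine Does.seq (Does.fill N (fun _ => 0) hN (by decide)
    (fun s' h => by simp [h.nat aN (by decide), N]) (fun s' h _ _ => by simp) fun s1 hf1 h1 => ?_)
  refine Does.seq (Does.setNat (Does.seq (Does.setNat (Does.seq (Does.setNat ?_)))))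
  have ex1 : s1.nat vX 0 = x := by rw [hf1.nat _ (by decide)]
  simp only [NatExpr.value, ex1]
  set s2 := ((s1.setNat aLab x 1).setNat vCnt 0 1).setNat vFound 0 1 with hs2
  have e2 : ∀ a, a ≠ aLab → a ≠ vCnt → a ≠ vFound → a ≠ vI → s2.nat a = s.nat a := by
    intro a ha hb hc hd
    rw [← hf1.nat a (by simp [Program.fill, Program.forUpTo, Program.natArrays, ha, hd])]
    funext j
    simp [s2, ha, hb, hc]
  have lab2 : ∀ a < N, s2.nat aLab a = if a = x then 1 else 0 := by
    intro a ha
    by_cases hax : a = x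
    · simp [s2, hax]
    · simp [s2, hax, h1 a ha]
  refine Does.loop (fun s' => s'.nat vCnt 0 = (GraphCake.found N (s'.nat aLab)).card ∧
      s'.nat aLab x ≠ 0 ∧
      (∀ a < N, s'.nat aLab a ≤ s'.nat vCnt 0) ∧
      (∀ a < N, s'.nat aLab a ≠ 0 → s.nat aSel a = 1) ∧
      (∀ a < N, s'.nat aLab a ≠ 0 → a ≠ x →
        ∃ b < N, s'.nat aLab b ≠ 0 ∧ s'.nat aLab b < s'.nat aLab a ∧ adj b a) ∧
      (s'.nat vFound 0 = 0 → ∀ a < N, ∀ b < N, s.nat aSel a = 1 → s'.nat aLab b ≠ 0 → adj b a →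
        s'.nat aLab a ≠ 0))
    (fun s' => if s'.nat vFound 0 = 0 then 0 else 1 + N - s'.nat vCnt 0) ?_ ?_ ?_ ?_
  · have hfx : GraphCake.found N (s2.nat aLab) = {x} := by
      ext a
      simp only [mem_found, Finset.mem_singleton]
      constructor
      · rintro ⟨ha, h⟩
        by_contra hax
        simp [lab2 a ha, hax] at h
      · rintro rfl
        exact ⟨hx, by simp [lab2 x hx]⟩
    have hc : s2.nat vCnt 0 = 1 := by simp [s2]
    refine ⟨by rw [hfx, hc]; rfl, by simp [lab2 x hx], ?_, ?_, ?_, fun h => ?_⟩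
    · intro a ha
      rw [hc, lab2 a ha]
      split_ifs <;> omega
    · intro a ha h
      by_cases hax : a = x
      · rw [hax]; exact hsel
      · simp [lab2 a ha, hax] at h
    · intro a ha h hax
      simp [lab2 a ha, hax] at h
    · simp [s2] at h
  · simp [s2]; omega
  · rintro s3 hf3 ⟨hcnt, hroot, hle, hselected, hpred, -⟩ ht
    have hcN : s3.nat vCnt 0 ≤ N := by
      rw [hcnt]
      exact (Finset.card_le_card (Finset.filter_subset _ _)).trans (by simp)
    have e3 : ∀ a, a ≠ aLab → a ≠ vCnt → a ≠ vFound → a ≠ vI → a ≠ vJ → a ≠ vNew →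
        s3.nat a = s.nat a := by
      intro a ha hb hc hd he hf
      rw [← e2 a ha hb hc hd, ← hf3.nat a (by
        simp [Program.reachScan, Program.forUpTo, Program.natArrays, ha, hb, hc, hd, he, hf])]
    simp only [Test.Holds, NatExpr.value] at ht
    have eN : s3.nat aN 0 = N := by rw [e3 aN] <;> decide
    refine Does.seq (Does.reachScan (by rw [eN]; exact hN) fun s4 hf4 h4 => ?_)
    rw [eN, e3 aSel (by decide) (by decide) (by decide) (by decide) (by decide) (by decide),
      e3 aU (by decide) (by decide) (by decide) (by decide) (by decide) (by decide),
      e3 aV (by decide) (by decide) (by decide) (by decide) (by decide) (by decide)] at h4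
    have el : s4.nat aLab = s3.nat aLab := hf4.nat _ (by decide)
    have ec : s4.nat vCnt = s3.nat vCnt := hf4.nat _ (by decide)
    refine Does.ite (fun h => ?_) (fun h => Does.skip ?_)
    · simp only [Test.Holds, NatExpr.value] at h
      obtain ⟨h0, hnew, hs, hl, b, hb, hlb, hba⟩ := h4.resolve_left fun h' => by omega
      refine Does.seq (Does.setNat (Does.setNat ?_))
      simp only [NatExpr.value, Store.setNat_nat, el, ec]
      simp only [Nat.reduceEqDiff, false_and, and_self, if_true, if_false, true_and, h0]
      set y := s4.nat vNew 0 with hy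
      set c := s3.nat vCnt 0 with hc
      set lab := s3.nat aLab with hlab
      have hf : GraphCake.found N ((((s4.setNat vCnt 0 (c + 1)).setNat aLab y (c + 1))).nat aLab) =
          insert y (GraphCake.found N lab) := by
        ext a
        simp only [mem_found, Store.setNat_nat, Finset.mem_insert, true_and]
        by_cases hay : a = y
        · simp [hay, hnew]
        · simp [hay, el]
      have hyx : y ≠ x := by rintro e; rw [e] at hl; exact hroot hl
      refine ⟨⟨?_, ?_, ?_, ?_, ?_, ?_⟩, ?_⟩
      · rw [hf, Finset.card_insert_of_notMem (by simp [hl]), ← hcnt]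
      · rw [if_neg hyx.symm]; exact hroot
      · intro a ha
        split_ifs
        · exact le_rfl
        · exact (hle a ha).trans (Nat.le_succ _)
      · intro a ha h
        by_cases hay : a = y
        · rw [hay]; exact hs
        · rw [if_neg hay] at h; exact hselected a ha h
      · intro a ha h hax
        by_cases hay : a = y
        · refine ⟨b, hb, ?_, ?_, hay ▸ hba⟩
          · split_ifs
            · omega
            · exact hlb
          · rw [if_pos hay, if_neg (by rintro rfl; exact hlb hl)]
            exact Nat.lt_succ_of_le (hle b hb)
        · rw [if_neg hay] at h ⊢
          obtain ⟨b', hb', h1, h2, h3⟩ := hpred a ha h hax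
          have : b' ≠ y := by rintro rfl; exact h1 hl
          exact ⟨b', hb', by rwa [if_neg this], by rwa [if_neg this], h3⟩
      · simp
      · rw [if_neg (by omega)]
        omega
    · simp only [Test.Holds, NatExpr.value] at h
      have h4 := h4.resolve_right fun h' => by omega
      rw [el, ec]
      refine ⟨⟨hcnt, hroot, hle, hselected, hpred, fun _ => h4.2⟩, ?_⟩
      rw [if_pos h4.1, if_neg (by omega)]
      omega
  · rintro s3 hf3 ⟨hcnt, hroot, hle, hselected, hpred, hcl⟩ ht
    simp only [Test.Holds, NatExpr.value] at ht
    refine ⟨hroot, fun a ha => (hle a ha).trans ?_, hselected, hpred, hcl (by omega)⟩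
    rw [hcnt]
    exact (Finset.card_le_card (Finset.filter_subset _ _)).trans (by simp)

end Does

/-! ### Peeling a heavy set of atoms -/

/-- The expression `2 t + η`, above which a share is too big. -/
abbrev RealExpr.cap : RealExpr := .add (.mul (.const 2) (.var rT)) (.var rEta)

/-- Whether the atom `vI` belongs to the found component. -/
abbrev Test.inComponent : Test := .natLE (.const 1) (.at aLab)

/-- Whether the atom `vI` is marked but does not belong to the found component. -/
abbrev Test.offComponent : Test := .and (.eq (.at aSel) (.const 1)) (.eq (.at aLab) (.const 0))

/-- Replace the marked set by the heavier part. -/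
def Program.keepHeavier : Program :=
  .ite (.realLE (.var rSum') (.var rSum))
    (.seq (.fill vI .atoms aSel .inComponent (.const 1) (.const 0))
      (.setReal rWt (.const 0) (.var rSum)))
    (.seq (.fill vI .atoms aSel .offComponent (.const 1) (.const 0))
      (.setReal rWt (.const 0) (.var rSum')))

/-- Remove the atom `vR` and the lighter part of the rest from the marked set. -/
def Program.peelStep : Program :=
  .seq (.setNat aSel (.var vR) (.const 0))
    (.seq (.find vI .atoms (.eq (.at aSel) (.const 1)) vX)
    (.seq .reach
    (.seq (.sumIf vI .atoms .inComponent rSum rW)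
    (.seq (.sumIf vI .atoms .offComponent rSum' rW)
    (.seq .keepHeavier
    (.seq (.find vI .atoms (.and (.eq (.at aSel) (.const 1)) (.adj (.var vI) (.var vR))) vNbr)
      (.setNat vR (.const 0) (.var vNbr))))))))

/-- Mark a connected part of moderate weight of the share `vM` such that the rest is connected and
contains the atom `vR`. -/
def Program.peel : Program :=
  .seq (.fill vI .atoms aSel (.eq (.at aOwn) (.var vM)) (.const 1) (.const 0))
    (.loop (.not (.realLE (.var rWt) .cap)) .peelStep)

namespace Does

variable {O : Oracle} {L : ℕ} {s : Store} {Q : Store → Prop}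

theorem peelStep {N : ℕ} {C M : Finset ℕ} {U V : ℕ → ℕ} {w : ℕ → ℝ} {t η : ℝ}
    (hN : s.nat aN 0 = N) (hL : N ≤ L) (hU : s.nat aU = U) (hV : s.nat aV = V)
    (hw : s.real rW = w) (hη : ∀ a < N, w a ≤ η) (ht : 0 < t)
    (hC : marked N (s.nat aSel) 1 = C) (hCM : C ⊆ M) (hCc : Conn (Adj U V) C)
    (hr : s.nat vR 0 ∈ C) (hR : Conn (Adj U V) (insert (s.nat vR 0) (M \ C)))
    (hbig : 2 * t + η < ∑ a ∈ C, w a)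
    (post : ∀ s' X, Frame Program.peelStep s s' → marked N (s'.nat aSel) 1 = X →
      X ⊆ C.erase (s.nat vR 0) →
      Conn (Adj U V) X → Conn (Adj U V) (M \ X) → s'.nat vR 0 ∈ X →
      Conn (Adj U V) (insert (s'.nat vR 0) (M \ X)) → s'.real rWt 0 = ∑ a ∈ X, w a →
      t ≤ ∑ a ∈ X, w a → Q s') :
    Does O L .peelStep s Q := by
  set r := s.nat vR 0 with hrd
  have hrN : r < N := by rw [← hC] at hr; exact (mem_marked.1 hr).1
  suffices Does O L .peelStep s fun s' => ∃ X, marked N (s'.nat aSel) 1 = X ∧ X ⊆ C.erase r ∧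
      Conn (Adj U V) X ∧ Conn (Adj U V) (M \ X) ∧ s'.nat vR 0 ∈ X ∧
      Conn (Adj U V) (insert (s'.nat vR 0) (M \ X)) ∧ s'.real rWt 0 = ∑ a ∈ X, w a ∧
      t ≤ ∑ a ∈ X, w a by
    refine this.imp fun s' hf h => ?_
    obtain ⟨X, h1, h2, h3, h4, h5, h6, h7, h8⟩ := h
    exact post s' X hf h1 h2 h3 h4 h5 h6 h7 h8
  have hsum : ∑ a ∈ C, w a = w r + ∑ a ∈ C.erase r, w a := (Finset.add_sum_erase C w hr).symm
  refine Does.seq (Does.setNat ?_)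
  simp only [NatExpr.value]
  set s1 := s.setNat aSel r 0 with hs1
  have e1 : ∀ a, a ≠ aSel → s1.nat a = s.nat a := fun a ha => s.setNat_nat_of_ne _ _ ha
  have hC1 : marked N (s1.nat aSel) 1 = C.erase r := by
    rw [← hC]
    ext a
    by_cases h : a = r <;> simp [s1, h]
  refine Does.seq (Does.find N (fun a => s1.nat aSel a = 1) hL (by decide)
    (fun s' h => by simp [h.nat aN (by decide), e1, hN])
    (fun s' h _ => by simp [h.nat aSel (by decide)]) fun s2 hf2 h2 => ?_)
  have h2 := h2.resolve_left fun h => by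
    have : C.erase r = ∅ := by
      rw [← hC1]
      ext a
      simpa using h.2 a
    rw [this] at hsum
    simp only [Finset.sum_empty] at hsum
    linarith [hη r hrN]
  have sel2 : s2.nat aSel = s1.nat aSel := hf2.nat _ (by decide)
  have N2 : s2.nat aN 0 = N := by rw [hf2.nat _ (by decide), e1 _ (by decide), hN]
  have U2 : s2.nat aU = U := by rw [hf2.nat _ (by decide), e1 _ (by decide), hU]
  have V2 : s2.nat aV = V := by rw [hf2.nat _ (by decide), e1 _ (by decide), hV]
  refine Does.seq (Does.reach (by rw [N2]; exact hL) (by rw [N2]; exact h2.1)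
    (by rw [sel2]; exact h2.2) fun s3 hf3 h3 => ?_)
  rw [N2, U2, V2, sel2] at h3
  set x := s2.nat vX 0 with hx
  set lab := s3.nat aLab with hlab
  set K := GraphCake.found N lab with hK
  have hKs : K ⊆ C.erase r := hC1 ▸ h3.subset
  have hKcl : ∀ y ∈ K, ∀ z ∈ C.erase r, Adj U V y z → z ∈ K := hC1 ▸ h3.found_closed
  have hKc : Conn (Adj U V) K := h3.conn h2.1
  have hKne : K.Nonempty := ⟨x, by simp [K, h2.1, h3.root]⟩
  have hKc' : Conn (Adj U V) (C.erase r \ K) := conn_sdiff hCc hr hKs hKcl hKne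
  have N3 : s3.nat aN 0 = N := by rw [hf3.nat _ (by decide), N2]
  have sel3 : s3.nat aSel = s1.nat aSel := by rw [hf3.nat _ (by decide), sel2]
  have w3 : s3.real rW = w := by rw [hf3.real _ (by decide), hf2.real _ (by decide), ← hw]; rfl
  have r3 : s3.nat vR 0 = r := by
    rw [hf3.nat _ (by decide), hf2.nat _ (by decide), e1 _ (by decide)]
  refine Does.seq (Does.sumIf N (fun a => lab a ≠ 0) hL (by decide)
    (fun s' h => by simp [h.nat aN (by decide), N3])
    (fun s' h _ => by simp [h.nat aLab (by decide), lab, Nat.one_le_iff_ne_zero])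
    fun s4 hf4 h4 => ?_)
  refine Does.seq (Does.sumIf N (fun a => s1.nat aSel a = 1 ∧ lab a = 0) hL (by decide)
    (fun s' h => by simp [h.nat aN (by decide), hf4.nat aN (by decide), N3])
    (fun s' h _ => by
      simp [h.nat aLab (by decide), hf4.nat aLab (by decide), h.nat aSel (by decide),
        hf4.nat aSel (by decide), sel3, lab])
    fun s5 hf5 h5 => ?_)
  have hK' : (Finset.range N).filter (fun a => s1.nat aSel a = 1 ∧ lab a = 0) =
      C.erase r \ K := by
    rw [← hC1]
    ext a
    simp only [Finset.mem_filter, Finset.mem_range, Finset.mem_sdiff, mem_marked, hK, mem_found]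
    tauto
  have h4' : s5.real rSum 0 = ∑ a ∈ K, w a := by
    rw [hf5.real _ (by decide), h4, w3]; rfl
  have h5' : s5.real rSum' 0 = ∑ a ∈ C.erase r \ K, w a := by
    rw [h5, hf4.real _ (by decide), w3, hK']
  have hsplit := Finset.sum_sdiff (f := w) hKs
  have N5 : s5.nat aN 0 = N := by rw [hf5.nat _ (by decide), hf4.nat _ (by decide), N3]
  have lab5 : s5.nat aLab = lab := by rw [hf5.nat _ (by decide), hf4.nat _ (by decide)]
  have sel5 : s5.nat aSel = s1.nat aSel := by
    rw [hf5.nat _ (by decide), hf4.nat _ (by decide), sel3]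
  have mid : Does O L .keepHeavier s5 fun s6 => ∃ X, marked N (s6.nat aSel) 1 = X ∧
      X ⊆ C.erase r ∧ (∀ y ∈ X, ∀ z ∈ C.erase r, Adj U V y z → z ∈ X) ∧ Conn (Adj U V) X ∧
      Conn (Adj U V) (C.erase r \ X) ∧ s6.real rWt 0 = ∑ a ∈ X, w a ∧ t ≤ ∑ a ∈ X, w a := by
    refine Does.ite (fun h => Does.seq ?_) (fun h => Does.seq ?_)
    · refine Does.fill N (fun a => if lab a ≠ 0 then 1 else 0) hL (by decide)
        (fun s' h => by simp [h.nat aN (by decide), N5])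
        (fun s' h _ _ => by
          simp [h.nat aLab (by decide), lab5, Nat.one_le_iff_ne_zero]) fun s6 hf6 h6 => Does.setReal ?_
      simp only [Test.Holds, RealExpr.value, NatExpr.value, h4', h5'] at h
      refine ⟨K, ?_, hKs, hKcl, hKc, hKc', ?_, ?_⟩
      · ext a
        simp only [mem_marked, hK, mem_found, Store.setReal_nat]
        refine and_congr_right fun ha => ?_
        rw [h6 a ha]
        by_cases hl : lab a = 0 <;> simp [hl]
      · simp [hf6.real rSum (by decide), h4']
      · linarith [hη r hrN]
    · refine Does.fill N (fun a => if s1.nat aSel a = 1 ∧ lab a = 0 then 1 else 0) hL (by decide)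
        (fun s' h => by simp [h.nat aN (by decide), N5])
        (fun s' h _ he => by
          rw [sel5] at he
          simp only [Test.Holds, Test.holds_eq, NatExpr.value, h.nat aLab (by decide), lab5, he]
          constructor <;> intro <;> grind) fun s6 hf6 h6 => Does.setReal ?_
      simp only [Test.Holds, RealExpr.value, NatExpr.value, h4', h5', not_le] at h
      refine ⟨C.erase r \ K, ?_, Finset.sdiff_subset, closed_sdiff hKcl, hKc', ?_, ?_, ?_⟩
      · rw [← hK']
        ext a
        simp only [mem_marked, Finset.mem_filter, Finset.mem_range, Store.setReal_nat]
        refine and_congr_right fun ha => ?_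
        rw [h6 a ha]
        split_ifs with hl <;> simp [hl]
      · rwa [Finset.sdiff_sdiff_eq_self hKs]
      · simp [hf6.real rSum' (by decide), h5']
      · linarith [hη r hrN]
  refine Does.seq (mid.imp fun s6 hf6 h6 => ?_)
  obtain ⟨X, hX, hXs, hXcl, hXc, hXc', hwt, htX⟩ := h6
  have hXne : X.Nonempty := by
    rw [Finset.nonempty_iff_ne_empty]
    rintro rfl
    simp at htX
    linarith
  obtain ⟨hMX, hrX, c, hc, hcr⟩ := peel_step hCc hr hCM hR hXs hXcl hXc' hXne
  have N6 : s6.nat aN 0 = N := by rw [hf6.nat _ (by decide), N5]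
  have r6 : s6.nat vR 0 = r := by
    rw [hf6.nat _ (by decide), hf5.nat _ (by decide), hf4.nat _ (by decide), r3]
  have U6 : s6.nat aU = U := by
    rw [hf6.nat _ (by decide), hf5.nat _ (by decide), hf4.nat _ (by decide),
      hf3.nat _ (by decide), U2]
  have V6 : s6.nat aV = V := by
    rw [hf6.nat _ (by decide), hf5.nat _ (by decide), hf4.nat _ (by decide),
      hf3.nat _ (by decide), V2]
  refine Does.seq (Does.find N (fun a => s6.nat aSel a = 1 ∧ Adj U V a r) hL (by decide)
    (fun s' h => by simp [h.nat aN (by decide), N6])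
    (fun s' h _ => by
      simp [h.nat aSel (by decide), h.nat aU (by decide), h.nat aV (by decide),
        h.nat vR (by decide), U6, V6, r6]) fun s7 hf7 h7 => Does.setNat ?_)
  rw [← hX, mem_marked] at hc
  have h7 := h7.resolve_left fun h => h.2 c hc.1 ⟨hc.2, hcr⟩
  refine ⟨X, ?_, hXs, hXc, hMX, ?_, ?_, ?_, htX⟩
  · rw [← hX, ← hf7.nat aSel (by decide)]
    ext a
    simp
  · rw [← hX]
    simpa using ⟨h7.1, h7.2.1⟩
  · have := (conn_singleton (U := U) (V := V) (s7.nat vNbr 0)).union hMX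
      (Finset.mem_singleton_self _) hrX h7.2.2
    simpa [Finset.singleton_union] using this
  · simp [hf7.real rWt (by decide), hwt]

theorem peel {N : ℕ} {M : Finset ℕ} {U V : ℕ → ℕ} {w : ℕ → ℝ} {t η : ℝ}
    (hN : s.nat aN 0 = N) (hL : N ≤ L) (hU : s.nat aU = U) (hV : s.nat aV = V)
    (hw : s.real rW = w) (hη : ∀ a < N, w a ≤ η)
    (htv : s.real rT 0 = t) (hηv : s.real rEta 0 = η) (ht : 0 < t) (hη0 : 0 < η)
    (hM : marked N (s.nat aOwn) (s.nat vM 0) = M) (hMc : Conn (Adj U V) M)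
    (hr : s.nat vR 0 ∈ M) (hwt : s.real rWt 0 = ∑ a ∈ M, w a)
    (hbig : 2 * t + η < ∑ a ∈ M, w a)
    (post : ∀ s' C, Frame Program.peel s s' → marked N (s'.nat aSel) 1 = C → C ⊆ M →
      Conn (Adj U V) C → Conn (Adj U V) (M \ C) → s.nat vR 0 ∈ M \ C →
      t ≤ ∑ a ∈ C, w a → ∑ a ∈ C, w a ≤ 2 * t + η → Q s') :
    Does O L .peel s Q := by
  set r := s.nat vR 0 with hrd
  refine Does.seq (Does.fill N (fun a => if s.nat aOwn a = s.nat vM 0 then 1 else 0) hL (by decide)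
    (fun s' h => by simp [h.nat aN (by decide), hN])
    (fun s' h _ _ => by
      simp [h.nat aOwn (by decide), h.nat vM (by decide)]) fun s1 hf1 h1 => ?_)
  have hC1 : marked N (s1.nat aSel) 1 = M := by
    rw [← hM]
    ext a
    simp only [mem_marked]
    refine and_congr_right fun ha => ?_
    rw [h1 a ha]
    split_ifs with h <;> simp [h]
  refine Does.loop (fun s' => ∃ C, marked N (s'.nat aSel) 1 = C ∧ C ⊆ M ∧ Conn (Adj U V) C ∧
      Conn (Adj U V) (M \ C) ∧ s'.nat vR 0 ∈ C ∧
      Conn (Adj U V) (insert (s'.nat vR 0) (M \ C)) ∧ s'.real rWt 0 = ∑ a ∈ C, w a ∧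
      t ≤ ∑ a ∈ C, w a ∧ ((2 * t + η < ∑ a ∈ C, w a ∧ s'.nat vR 0 = r) ∨ r ∈ M \ C))
    (fun s' => (marked N (s'.nat aSel) 1).card) ?_ ?_ ?_ ?_
  · have r1 : s1.nat vR 0 = r := by rw [hf1.nat _ (by decide)]
    refine ⟨M, hC1, subset_rfl, hMc, ?_, ?_, ?_, ?_, by linarith, .inl ⟨hbig, r1⟩⟩
    · simpa using conn_empty
    · rwa [r1]
    · simpa using conn_singleton _
    · rw [hf1.real _ (by decide), hwt]
  · rw [hC1, ← hM]
    exact (Finset.card_le_card (Finset.filter_subset _ _)).trans (by simpa using hL)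
  · rintro s2 hf2 ⟨C, hC, hCM, hCc, hCc', hrC, hRc, hwC, htC, hor⟩ hb
    simp only [Test.Holds, RealExpr.value, NatExpr.value, not_le, hf2.real rT (by decide),
      hf1.real rT (by decide), hf2.real rEta (by decide), hf1.real rEta (by decide), htv, hηv,
      hwC, Rat.cast_ofNat] at hb
    refine Does.peelStep (N := N) (C := C) (M := M) (U := U) (V := V) (w := w) (t := t) (η := η)
      ?_ hL ?_ ?_ ?_ hη ht hC hCM hCc hrC hRc hb ?_
    · rw [hf2.nat _ (by decide), hf1.nat _ (by decide), hN]
    · rw [hf2.nat _ (by decide), hf1.nat _ (by decide), hU]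
    · rw [hf2.nat _ (by decide), hf1.nat _ (by decide), hV]
    · rw [hf2.real _ (by decide), hf1.real _ (by decide), hw]
    · intro s3 X hf3 hX hXs hXc hMX hrX hR hwX htX
      have hXC : X ⊆ C := hXs.trans (Finset.erase_subset _ _)
      refine ⟨⟨X, hX, hXC.trans hCM, hXc, hMX, hrX, hR, hwX, htX, ?_⟩, ?_⟩
      · right
        rcases hor with ⟨-, h⟩ | h
        · rw [← h, Finset.mem_sdiff]
          exact ⟨hCM hrC, fun h' => by simpa using hXs h'⟩
        · rw [Finset.mem_sdiff] at h ⊢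
          exact ⟨h.1, fun h' => h.2 (hXC h')⟩
      · rw [hX, hC]
        exact (Finset.card_le_card hXs).trans_lt (Finset.card_erase_lt_of_mem hrC)
  · rintro s2 hf2 ⟨C, hC, hCM, hCc, hCc', hrC, hRc, hwC, htC, hor⟩ hb
    simp only [Test.Holds, RealExpr.value, NatExpr.value, not_not, hf2.real rT (by decide),
      hf1.real rT (by decide), hf2.real rEta (by decide), hf1.real rEta (by decide), htv, hηv,
      hwC, Rat.cast_ofNat] at hb
    have hf : Frame Program.peel s s2 :=
      (hf1.mono (by simp [Program.peel, Program.natArrays])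
        (by simp [Program.peel, Program.realArrays])).trans
        (hf2.mono (by simp [Program.peel, Program.natArrays])
        (by simp [Program.peel, Program.realArrays]))
    refine post s2 C hf hC hCM hCc hCc' (hor.resolve_left fun h => ?_) htC hb
    linarith [h.1]

end Does

/-! ### Partitions of the atoms into connected shares -/

/-- The atoms are connected, and their weights are small and sum up to `1`. -/
structure AreAtoms (N : ℕ) (U V : ℕ → ℕ) (w : ℕ → ℝ) (η : ℝ) : Prop where
  pos : 0 < η
  nonneg : ∀ a < N, 0 ≤ w a
  le : ∀ a < N, w a ≤ η
  total : ∑ a ∈ Finset.range N, w a = 1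
  conn : Conn (Adj U V) (Finset.range N)

/-- The owners partition the atoms into `n` nonempty connected shares. -/
structure IsPartition (N n : ℕ) (U V : ℕ → ℕ) (own : ℕ → ℕ) : Prop where
  lt : ∀ a < N, own a < n
  conn : ∀ i < n, Conn (Adj U V) (marked N own i)
  nonempty : ∀ i < n, (marked N own i).Nonempty

/-- The weight of the share of agent `i`. -/
def weight (N : ℕ) (w : ℕ → ℝ) (own : ℕ → ℕ) (i : ℕ) : ℝ := ∑ a ∈ marked N own i, w a

open Classical in
/-- The agents whose shares are too small or too big. -/
noncomputable def bad (N n : ℕ) (w : ℕ → ℝ) (t η : ℝ) (own : ℕ → ℕ) : Finset ℕ :=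
  (Finset.range n).filter fun i => weight N w own i < t ∨ 2 * t + η < weight N w own i

@[simp] theorem mem_bad {N n : ℕ} {w : ℕ → ℝ} {t η : ℝ} {own : ℕ → ℕ} {i : ℕ} :
    i ∈ bad N n w t η own ↔ i < n ∧ (weight N w own i < t ∨ 2 * t + η < weight N w own i) := by
  simp [bad]

theorem card_bad_le {N n : ℕ} {w : ℕ → ℝ} {t η : ℝ} {own : ℕ → ℕ} :
    (bad N n w t η own).card ≤ n :=
  (Finset.card_le_card (Finset.filter_subset _ _)).trans (by simp)

theorem sum_weight {N n : ℕ} {w : ℕ → ℝ} {own : ℕ → ℕ} (h : ∀ a < N, own a < n) :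
    ∑ i ∈ Finset.range n, weight N w own i = ∑ a ∈ Finset.range N, w a :=
  Finset.sum_fiberwise_of_maps_to (fun a ha => by simpa using h a (by simpa using ha)) w

/-- `own'` arises from `own` by giving the part of the share of `i` outside `C` to `j`. -/
structure IsTransfer (N : ℕ) (own own' : ℕ → ℕ) (i j : ℕ) (C : Finset ℕ) : Prop where
  source : marked N own' i = C
  target : marked N own' j = marked N own j ∪ (marked N own i \ C)
  other : ∀ k, k ≠ i → k ≠ j → marked N own' k = marked N own k

theorem isTransfer {N : ℕ} {own own' : ℕ → ℕ} {i j : ℕ} {C : Finset ℕ} (hij : i ≠ j)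
    (hC : C ⊆ marked N own i)
    (h : ∀ a < N, own' a = if own a = i ∧ a ∉ C then j else own a) :
    IsTransfer N own own' i j C := by
  refine ⟨?_, ?_, fun k hki hkj => ?_⟩
  all_goals
    ext a
    have := @hC a
    simp only [mem_marked, Finset.mem_union, Finset.mem_sdiff] at *
    by_cases ha : a < N
    · rw [h a ha]
      split_ifs with hh <;> grind
    · simp [ha]
      try tauto

section

variable {N n : ℕ} {U V own own' : ℕ → ℕ} {w : ℕ → ℝ} {t η : ℝ} {i j : ℕ} {C : Finset ℕ}

theorem IsTransfer.isPartition (h : IsTransfer N own own' i j C) (hp : IsPartition N n U V own)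
    (hi : i < n) (hj : j < n) (hne : C.Nonempty) (hC : Conn (Adj U V) C)
    (hR : Conn (Adj U V) (marked N own i \ C)) {q r : ℕ} (hq : q ∈ marked N own j)
    (hr : r ∈ marked N own i \ C) (hqr : Adj U V q r) : IsPartition N n U V own' where
  lt a ha := by
    by_cases h1 : own' a = i
    · rwa [h1]
    by_cases h2 : own' a = j
    · rwa [h2]
    have : a ∈ marked N own' (own' a) := by simp [ha]
    rw [h.other _ h1 h2, mem_marked] at this
    rw [← this.2]
    exact hp.lt a ha
  conn k hk := by
    by_cases h1 : k = i
    · rw [h1, h.source]; exact hC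
    by_cases h2 : k = j
    · rw [h2, h.target]; exact (hp.conn j hj).union hR hq hr hqr
    · rw [h.other k h1 h2]; exact hp.conn k hk
  nonempty k hk := by
    by_cases h1 : k = i
    · rw [h1, h.source]; exact hne
    by_cases h2 : k = j
    · rw [h2, h.target]; exact ⟨q, Finset.mem_union_left _ hq⟩
    · rw [h.other k h1 h2]; exact hp.nonempty k hk

theorem IsTransfer.weight_source (h : IsTransfer N own own' i j C) :
    weight N w own' i = ∑ a ∈ C, w a := by rw [weight, h.source]

theorem IsTransfer.weight_other (h : IsTransfer N own own' i j C) {k : ℕ} (hi : k ≠ i)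
    (hj : k ≠ j) : weight N w own' k = weight N w own k := by rw [weight, h.other k hi hj, weight]

theorem IsTransfer.le_weight_target (h : IsTransfer N own own' i j C)
    (hw : ∀ a < N, 0 ≤ w a) : weight N w own j ≤ weight N w own' j := by
  rw [weight, weight]
  refine Finset.sum_le_sum_of_subset_of_nonneg (h.target ▸ Finset.subset_union_left) ?_
  intro a ha _
  exact hw a (mem_marked.1 ha).1

end

/-! ### Moving cake from a big share towards a small one -/

/-- Find the atom of the share `vM` that is closest to the root of the search. -/
def Program.closest : Program :=
  .seq (.setNat vR (.const 0) (.var vQ))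
    (.forUpTo vI .atoms
      (.ite (.and (.eq (.at aOwn) (.var vM))
          (.not (.natLE (.cell aDist (.var vR)) (.at aDist))))
        (.setNat vR (.const 0) (.var vI)) .skip))

/-- Give a part of the share `vM` to another share, which becomes `vM`. -/
def Program.chainStep : Program :=
  .seq .closest
    (.seq (.setNat vTop (.const 0) (.var vR))
    (.seq .peel
    (.seq (.find vI .atoms (.and (.adj (.var vI) (.var vTop))
      (.not (.natLE (.cell aDist (.var vTop)) (.at aDist)))) vQ)
    (.seq (.setNat vDest (.const 0) (.cell aOwn (.var vQ)))
    (.seq (.fill vI .atoms aOwn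
      (.and (.eq (.at aOwn) (.var vM)) (.not (.eq (.at aSel) (.const 1)))) (.var vDest) (.at aOwn))
    (.seq (.setNat vM (.const 0) (.var vDest))
      (.sumIf vI .atoms (.eq (.at aOwn) (.var vM)) rWt rW)))))))

/-- Move cake from the share `vM` towards the share `vSmall`. -/
def Program.chain : Program :=
  .loop (.and (.not (.realLE (.var rWt) .cap)) (.not (.eq (.var vM) (.var vSmall)))) .chainStep

namespace Does

variable {O : Oracle} {L : ℕ} {s : Store} {Q : Store → Prop}

theorem closest {N m : ℕ} {own dist : ℕ → ℕ} (hN : s.nat aN 0 = N) (hL : N ≤ L)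
    (ho : s.nat aOwn = own) (hd : s.nat aDist = dist) (hm : s.nat vM 0 = m)
    (hq : s.nat vQ 0 < N) (hqm : own (s.nat vQ 0) = m)
    (post : ∀ s', Frame Program.closest s s' → s'.nat vR 0 < N → own (s'.nat vR 0) = m →
      dist (s'.nat vR 0) ≤ dist (s.nat vQ 0) →
      (∀ a < N, own a = m → dist (s'.nat vR 0) ≤ dist a) → Q s') :
    Does O L .closest s Q := by
  suffices Does O L .closest s fun s' => (s'.nat vR 0 < N ∧ own (s'.nat vR 0) = m ∧
      dist (s'.nat vR 0) ≤ dist (s.nat vQ 0)) ∧ (∀ a < N, own a = m →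
      dist (s'.nat vR 0) ≤ dist a) from
    this.imp fun s' hf h => post s' hf h.1.1 h.1.2.1 h.1.2.2 h.2
  refine Does.seq (Does.setNat ?_)
  simp only [NatExpr.value]
  have e1 : ∀ a, a ≠ vR → (s.setNat vR 0 (s.nat vQ 0)).nat a = s.nat a :=
    fun a ha => s.setNat_nat_of_ne _ _ ha
  refine Does.forUpTo N (fun k s' => (s'.nat vR 0 < N ∧ own (s'.nat vR 0) = m ∧
      dist (s'.nat vR 0) ≤ dist (s.nat vQ 0)) ∧ (∀ a < k, own a = m →
      dist (s'.nat vR 0) ≤ dist a)) hL (by decide)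
    (fun s' h => by simp [h.nat aN (by decide), hN]) (by simp [hq, hqm]) ?_ (fun s' _ h => h)
  rintro k hk s1 hf1 hik ⟨⟨h1, h2, h3⟩, h4⟩
  have eo : s1.nat aOwn = own := by rw [hf1.nat _ (by decide), e1 _ (by decide), ho]
  have ed : s1.nat aDist = dist := by rw [hf1.nat _ (by decide), e1 _ (by decide), hd]
  have em : s1.nat vM 0 = m := by rw [hf1.nat _ (by decide), e1 _ (by decide), hm]
  refine Does.ite (fun h => Does.setNat ?_) (fun h => Does.skip ?_)
  all_goals
    simp only [Test.Holds, Test.holds_eq, NatExpr.value, eo, ed, em, hik, not_le] at h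
    simp only [NatExpr.value, Store.setNat_nat, hik]
    simp only [Nat.reduceEqDiff, false_and, and_self, if_true, if_false]
  · refine ⟨⟨hk, h.1, h.2.le.trans h3⟩, fun a ha hm => ?_⟩
    rcases Nat.lt_succ_iff_lt_or_eq.1 ha with ha | rfl
    · exact h.2.le.trans (h4 a ha hm)
    · exact le_rfl
  · refine ⟨⟨h1, h2, h3⟩, fun a ha hm => ?_⟩
    rcases Nat.lt_succ_iff_lt_or_eq.1 ha with ha | rfl
    · exact h4 a ha hm
    · by_contra hlt
      exact h ⟨hm, by omega⟩

theorem chainStep {N n m x : ℕ} {U V own dist : ℕ → ℕ} {w : ℕ → ℝ} {t η : ℝ}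
    (hN : s.nat aN 0 = N) (hL : N ≤ L) (hU : s.nat aU = U) (hV : s.nat aV = V)
    (hw : s.real rW = w) (ho : s.nat aOwn = own) (hd : s.nat aDist = dist)
    (htv : s.real rT 0 = t) (hηv : s.real rEta 0 = η) (hm : s.nat vM 0 = m)
    (hA : AreAtoms N U V w η) (ht : 0 < t) (hp : IsPartition N n U V own)
    (hmn : m < n) (hq : s.nat vQ 0 < N) (hqm : own (s.nat vQ 0) = m)
    (hwt : s.real rWt 0 = weight N w own m) (hbig : 2 * t + η < weight N w own m)
    (hdist : ∀ a < N, a ≠ x → ∃ b < N, dist b < dist a ∧ Adj U V b a) (hx : own x ≠ m)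
    (post : ∀ s' j C, Frame Program.chainStep s s' → s'.nat vM 0 = j → j < n → j ≠ m →
      IsTransfer N own (s'.nat aOwn) m j C → IsPartition N n U V (s'.nat aOwn) →
      t ≤ ∑ a ∈ C, w a → ∑ a ∈ C, w a ≤ 2 * t + η →
      s'.nat vQ 0 < N → s'.nat aOwn (s'.nat vQ 0) = j → dist (s'.nat vQ 0) < dist (s.nat vQ 0) →
      s'.real rWt 0 = weight N w (s'.nat aOwn) j → Q s') :
    Does O L .chainStep s Q := by
  suffices Does O L .chainStep s fun s' => ∃ C, s'.nat vM 0 < n ∧ s'.nat vM 0 ≠ m ∧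
      IsTransfer N own (s'.nat aOwn) m (s'.nat vM 0) C ∧ IsPartition N n U V (s'.nat aOwn) ∧
      t ≤ ∑ a ∈ C, w a ∧ ∑ a ∈ C, w a ≤ 2 * t + η ∧
      s'.nat vQ 0 < N ∧ s'.nat aOwn (s'.nat vQ 0) = s'.nat vM 0 ∧
      dist (s'.nat vQ 0) < dist (s.nat vQ 0) ∧
      s'.real rWt 0 = weight N w (s'.nat aOwn) (s'.nat vM 0) by
    refine this.imp fun s' hf h => ?_
    obtain ⟨C, h1, h2, h3, h4, h5, h6, h7, h8, h9, h10⟩ := h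
    exact post s' _ C hf rfl h1 h2 h3 h4 h5 h6 h7 h8 h9 h10
  refine Does.seq (Does.closest hN hL ho hd hm hq hqm fun s1 hf1 hrN hrm hrq hrmin => ?_)
  refine Does.seq (Does.setNat ?_)
  simp only [NatExpr.value]
  set r := s1.nat vR 0 with hr
  set s2 := s1.setNat vTop 0 r with hs2
  have e2 : ∀ a, a ≠ vTop → s2.nat a = s1.nat a := fun a ha => s1.setNat_nat_of_ne _ _ ha
  have r2 : s2.nat vR 0 = r := by rw [e2 _ (by decide)]
  have m2 : s2.nat vM 0 = m := by rw [e2 _ (by decide), hf1.nat _ (by decide), hm]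
  have o2 : s2.nat aOwn = own := by rw [e2 _ (by decide), hf1.nat _ (by decide), ho]
  have d2 : s2.nat aDist = dist := by rw [e2 _ (by decide), hf1.nat _ (by decide), hd]
  have N2 : s2.nat aN 0 = N := by rw [e2 _ (by decide), hf1.nat _ (by decide), hN]
  have U2 : s2.nat aU = U := by rw [e2 _ (by decide), hf1.nat _ (by decide), hU]
  have V2 : s2.nat aV = V := by rw [e2 _ (by decide), hf1.nat _ (by decide), hV]
  have w2 : s2.real rW = w := (hf1.real _ (by decide)).trans hw
  have top2 : s2.nat vTop 0 = r := by simp [s2]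
  refine Does.seq (Does.peel (M := marked N own m) N2 hL U2 V2 w2 hA.le
    (by simp [s2, hf1.real rT (by decide), htv])
    (by simp [s2, hf1.real rEta (by decide), hηv]) ht hA.pos (by rw [o2, m2]) (hp.conn m hmn)
    (by rw [r2]; exact mem_marked.2 ⟨hrN, hrm⟩)
    (by simp [s2, hf1.real rWt (by decide), hwt, weight]) hbig ?_)
  intro s3 C hf3 hC hCm hCc hRc hrC htC hCt
  rw [r2] at hrC
  have N3 : s3.nat aN 0 = N := by rw [hf3.nat _ (by decide), N2]
  have o3 : s3.nat aOwn = own := by rw [hf3.nat _ (by decide), o2]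
  have d3 : s3.nat aDist = dist := by rw [hf3.nat _ (by decide), d2]
  have top3 : s3.nat vTop 0 = r := by rw [hf3.nat _ (by decide), top2]
  have U3 : s3.nat aU = U := by rw [hf3.nat _ (by decide), U2]
  have V3 : s3.nat aV = V := by rw [hf3.nat _ (by decide), V2]
  refine Does.seq (Does.find N (fun a => Adj U V a r ∧ dist a < dist r) hL (by decide)
    (fun s' h => by simp [h.nat aN (by decide), N3])
    (fun s' h _ => by
      simp [h.nat aDist (by decide), h.nat aU (by decide), h.nat aV (by decide),
        h.nat vTop (by decide), U3, V3, d3, top3]) fun s4 hf4 h4 => ?_)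
  have h4 := h4.resolve_left fun h => by
    obtain ⟨b, hb, hlt, hadj⟩ := hdist r hrN (by rintro h; rw [h] at hrm; exact hx hrm)
    exact h.2 b hb ⟨hadj, hlt⟩
  set q := s4.nat vQ 0 with hqd
  have o4 : s4.nat aOwn = own := by rw [hf4.nat _ (by decide), o3]
  have hjm : own q ≠ m := fun h => by
    have := hrmin q h4.1 h
    omega
  refine Does.seq (Does.setNat ?_)
  simp only [NatExpr.value, o4, ← hqd]
  set s5 := s4.setNat vDest 0 (own q) with hs5
  have e5 : ∀ a, a ≠ vDest → s5.nat a = s4.nat a := fun a ha => s4.setNat_nat_of_ne _ _ ha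
  have N5 : s5.nat aN 0 = N := by rw [e5 _ (by decide), hf4.nat _ (by decide), N3]
  have o5 : s5.nat aOwn = own := by rw [e5 _ (by decide), o4]
  have sel5 : s5.nat aSel = s3.nat aSel := by rw [e5 _ (by decide), hf4.nat _ (by decide)]
  have dest5 : s5.nat vDest 0 = own q := by simp [s5]
  have m5 : s5.nat vM 0 = m := by
    rw [e5 _ (by decide), hf4.nat _ (by decide), hf3.nat _ (by decide), m2]
  refine Does.seq (Does.fill N (fun a => if own a = m ∧ a ∉ C then own q else own a) hL (by decide)
    (fun s' h => by simp [h.nat aN (by decide), N5])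
    (fun s' h hlt he => by
      rw [o5] at he
      simp only [Test.Holds, Test.holds_eq, NatExpr.value, he, h.nat vM (by decide), m5,
        h.nat aSel (by decide), sel5, h.nat vDest (by decide), dest5]
      have : s'.nat vI 0 ∈ C ↔ s3.nat aSel (s'.nat vI 0) = 1 := by
        rw [← hC, mem_marked]; tauto
      rw [← this]
      constructor <;> intro h <;> simp [h]) fun s6 hf6 h6 => ?_)
  have hT : IsTransfer N own (s6.nat aOwn) m (own q) C := isTransfer hjm.symm hCm h6
  have hCne : C.Nonempty := by
    rw [Finset.nonempty_iff_ne_empty]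
    rintro rfl
    simp at htC
    linarith
  refine Does.seq (Does.setNat ?_)
  simp only [NatExpr.value, hf6.nat vDest (by decide), dest5]
  set s7 := s6.setNat vM 0 (own q) with hs7
  have e7 : ∀ a, a ≠ vM → s7.nat a = s6.nat a := fun a ha => s6.setNat_nat_of_ne _ _ ha
  have N7 : s7.nat aN 0 = N := by rw [e7 _ (by decide), hf6.nat _ (by decide), N5]
  have m7 : s7.nat vM 0 = own q := by simp [s7]
  have o7 : s7.nat aOwn = s6.nat aOwn := e7 _ (by decide)
  have q7 : s7.nat vQ 0 = q := by rw [e7 _ (by decide), hf6.nat _ (by decide), e5 _ (by decide)]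
  have w7 : s7.real rW = w := by
    change s6.real rW = w
    rw [hf6.real _ (by decide)]
    change s4.real rW = w
    rw [hf4.real _ (by decide), hf3.real _ (by decide), w2]
  refine Does.sumIf N (fun a => s6.nat aOwn a = own q) hL (by decide)
    (fun s' h => by simp [h.nat aN (by decide), N7])
    (fun s' h _ => by simp [h.nat aOwn (by decide), h.nat vM (by decide), m7, o7])
    fun s8 hf8 h8 => ?_
  rw [hf8.nat vM (by decide), hf8.nat aOwn (by decide), hf8.nat vQ (by decide), m7, o7, q7, h8, w7]
  refine ⟨C, hp.lt q h4.1, hjm, hT, ?_, htC, hCt, h4.1, ?_, h4.2.2.trans_le hrq, rfl⟩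
  · exact hT.isPartition hp hmn (hp.lt q h4.1) hCne hCc hRc (mem_marked.2 ⟨h4.1, rfl⟩)
      hrC h4.2.1
  · rw [h6 q h4.1, if_neg fun h => hjm h.1]

theorem chain {N n m x i : ℕ} {U V own dist : ℕ → ℕ} {w : ℕ → ℝ} {t η l : ℝ}
    (hN : s.nat aN 0 = N) (hL : N ≤ L) (hU : s.nat aU = U) (hV : s.nat aV = V)
    (hw : s.real rW = w) (ho : s.nat aOwn = own) (hd : s.nat aDist = dist)
    (htv : s.real rT 0 = t) (hηv : s.real rEta 0 = η) (hm : s.nat vM 0 = m)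
    (hi : s.nat vSmall 0 = i)
    (hA : AreAtoms N U V w η) (ht : 0 < t) (hp : IsPartition N n U V own)
    (hmn : m < n) (hq : s.nat vQ 0 < N) (hqm : own (s.nat vQ 0) = m)
    (hwt : s.real rWt 0 = weight N w own m) (hbig : 2 * t + η < weight N w own m)
    (hdist : ∀ a < N, a ≠ x → ∃ b < N, dist b < dist a ∧ Adj U V b a)
    (hdL : ∀ a < N, dist a ≤ L) (hxN : x < N) (hx : own x = i)
    (hsmall : weight N w own i < t) (hlt : l ≤ t) (hl : ∀ k < n, l ≤ weight N w own k)
    (post : ∀ s', Frame Program.chain s s' → IsPartition N n U V (s'.nat aOwn) →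
      (∀ k < n, l ≤ weight N w (s'.nat aOwn) k) →
      (bad N n w t η (s'.nat aOwn)).card < (bad N n w t η own).card → Q s') :
    Does O L .chain s Q := by
  have hη := hA.pos
  refine Does.loop (fun s' => IsPartition N n U V (s'.nat aOwn) ∧ s'.nat vM 0 < n ∧
    s'.nat vQ 0 < N ∧ s'.nat aOwn (s'.nat vQ 0) = s'.nat vM 0 ∧
    s'.real rWt 0 = weight N w (s'.nat aOwn) (s'.nat vM 0) ∧ s'.nat aOwn x = i ∧
    (∀ k < n, l ≤ weight N w (s'.nat aOwn) k) ∧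
    ((bad N n w t η (s'.nat aOwn)).erase (s'.nat vM 0)).card < (bad N n w t η own).card ∧
    (s'.nat vM 0 = i ∨ weight N w (s'.nat aOwn) (s'.nat vM 0) ≤ 2 * t + η →
      (bad N n w t η (s'.nat aOwn)).card < (bad N n w t η own).card) ∧
    (s'.nat vM 0 ≠ i → weight N w (s'.nat aOwn) i < t))
    (fun s' => dist (s'.nat vQ 0)) ?_ (hdL _ hq) ?_ ?_
  · rw [ho, hm]
    refine ⟨hp, hmn, hq, hqm, hwt, hx, hl, ?_, ?_, fun _ => hsmall⟩
    · exact Finset.card_erase_lt_of_mem (by simp [hmn, hbig])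
    · rintro (h | h)
      · rw [h] at hbig; linarith
      · linarith
  · rintro s1 hf1 ⟨hp1, hm1, hq1, hqm1, hwt1, hx1, hl1, hc1, -, hs1⟩ htest
    simp only [Test.Holds, Test.holds_eq, RealExpr.value, NatExpr.value, not_le,
      hf1.real rT (by decide), hf1.real rEta (by decide), htv, hηv, hf1.nat vSmall (by decide), hi,
      Rat.cast_ofNat, hwt1] at htest
    refine Does.chainStep (N := N) (n := n) (m := s1.nat vM 0) (x := x) (U := U) (V := V)
      (own := s1.nat aOwn) (dist := dist) (w := w) (t := t) (η := η) ?_ hL ?_ ?_ ?_ rfl ?_ ?_ ?_ rfl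
      hA ht hp1 hm1 hq1 hqm1 hwt1 htest.1 hdist (by rw [hx1]; exact fun h => htest.2 h.symm) ?_
    · rw [hf1.nat _ (by decide), hN]
    · rw [hf1.nat _ (by decide), hU]
    · rw [hf1.nat _ (by decide), hV]
    · rw [hf1.real _ (by decide), hw]
    · rw [hf1.nat _ (by decide), hd]
    · rw [hf1.real _ (by decide), htv]
    · rw [hf1.real _ (by decide), hηv]
    intro s2 j C hf2 hj hjn hjm hT hp2 htC hCt hq2 hqj hdq hwt2
    rw [hj]
    set own1 := s1.nat aOwn with hown1
    set own2 := s2.nat aOwn with hown2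
    set m1 := s1.nat vM 0 with hm1d
    have hsrc : weight N w own2 m1 = ∑ a ∈ C, w a := hT.weight_source
    have htgt := hT.le_weight_target hA.nonneg
    have hsub : ∀ k ∈ bad N n w t η own2, k ≠ m1 ∧ (k ≠ j → k ∈ bad N n w t η own1) := by
      intro k hk
      rw [mem_bad] at hk
      have hkm : k ≠ m1 := by
        rintro rfl
        rw [hsrc] at hk
        rcases hk.2 with h | h <;> linarith
      refine ⟨hkm, fun hkj => ?_⟩
      rw [hT.weight_other hkm hkj] at hk
      exact mem_bad.2 hk
    refine ⟨⟨hp2, hjn, hq2, hqj, hwt2, ?_, ?_, ?_, ?_, ?_⟩, hdq⟩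
    · by_cases hji : j = i
      · have : x ∈ marked N own2 j := by
          rw [hT.target]
          exact Finset.mem_union_left _ (by simp [hxN, hx1, hji])
        rw [(mem_marked.1 this).2, hji]
      · have : x ∈ marked N own2 i := by
          rw [hT.other i (fun h => htest.2 h.symm) (fun h => hji h.symm)]
          simp [hxN, hx1]
        exact (mem_marked.1 this).2
    · intro k hk
      by_cases hkm : k = m1
      · rw [hkm, hsrc]; linarith
      by_cases hkj : k = j
      · rw [hkj]; linarith [hl1 j hjn]
      · rw [hT.weight_other hkm hkj]; exact hl1 k hk
    · refine (Finset.card_le_card fun k hk => ?_).trans_lt hc1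
      rw [Finset.mem_erase] at hk ⊢
      exact ⟨(hsub k hk.2).1, (hsub k hk.2).2 hk.1⟩
    · intro h
      refine (Finset.card_le_card fun k hk => ?_).trans_lt hc1
      rw [Finset.mem_erase]
      refine ⟨(hsub k hk).1, ?_⟩
      by_cases hkj : k = j
      · subst hkj
        rw [mem_bad] at hk ⊢
        refine ⟨hjn, .inl ?_⟩
        rcases h with h | h
        · rw [h]; exact hs1 htest.2
        · rcases hk.2 with h' | h' <;> linarith
      · exact (hsub k hk).2 hkj
    · intro hji
      rw [hT.weight_other (fun h => htest.2 h.symm) (fun h => hji h.symm)]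
      exact hs1 htest.2
  · rintro s1 hf1 ⟨hp1, hm1, hq1, hqm1, hwt1, hx1, hl1, hc1, hc, hs1⟩ htest
    simp only [Test.Holds, Test.holds_eq, RealExpr.value, NatExpr.value, not_le,
      hf1.real rT (by decide), hf1.real rEta (by decide), htv, hηv, hf1.nat vSmall (by decide), hi,
      Rat.cast_ofNat, hwt1] at htest
    refine post s1 hf1 hp1 hl1 (hc ?_)
    by_contra h
    push Not at h
    exact htest ⟨h.2, h.1⟩

end Does

/-! ### Balancing a partition -/

/-- A test that always succeeds. -/
abbrev Test.true : Test := .natLE (.const 0) (.const 0)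

/-- The number of agents. -/
abbrev NatExpr.agents : NatExpr := .var aIn

/-- Store in `vBig` and `vSmall` agents whose shares are too big and too small; the number of agents
stands for none. -/
def Program.scan : Program :=
  .seq (.setNat vBig (.const 0) .agents)
    (.seq (.setNat vSmall (.const 0) .agents)
    (.forUpTo vK .agents
      (.seq (.sumIf vI .atoms (.eq (.at aOwn) (.var vK)) rSum rW)
      (.seq (.ite (.realLE (.var rSum) .cap) .skip (.setNat vBig (.const 0) (.var vK)))
        (.ite (.realLE (.var rT) (.var rSum)) .skip (.setNat vSmall (.const 0) (.var vK)))))))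

/-- Move cake from the share `vBig` towards the share `vSmall`. -/
def Program.move : Program :=
  .seq (.fill vI .atoms aSel .true (.const 1) (.const 1))
    (.seq (.find vI .atoms (.eq (.at aOwn) (.var vSmall)) vX)
    (.seq .reach
    (.seq (.fill vI .atoms aDist .true (.at aLab) (.at aLab))
    (.seq (.setNat vM (.const 0) (.var vBig))
    (.seq (.find vI .atoms (.eq (.at aOwn) (.var vM)) vQ)
    (.seq (.sumIf vI .atoms (.eq (.at aOwn) (.var vM)) rWt rW)
      .chain))))))

/-- Stop if no share is too big; raise the threshold if none is too small; otherwise move cake. -/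
def Program.balanceStep : Program :=
  .seq .scan
    (.ite (.natLE .agents (.var vBig)) (.setNat vDone (.const 0) (.const 1))
    (.ite (.natLE .agents (.var vSmall))
      (.seq (.setNat vLevel (.const 0) (.add (.var vLevel) (.const 1)))
        (.setReal rT (.const 0) (.mul (.ofNat (.var vLevel)) (.var rEta))))
      .move))

/-- Make the weights of the shares differ by a factor of little more than `2`. -/
def Program.balance : Program :=
  .seq (.setNat vDone (.const 0) (.const 0))
    (.seq (.setNat vLevel (.const 0) (.const 1))
    (.seq (.setReal rT (.const 0) (.var rEta))
    (.loop (.natLE (.var vDone) (.const 0)) .balanceStep)))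

namespace Does

variable {O : Oracle} {L : ℕ} {s : Store} {Q : Store → Prop}

theorem scan {N n : ℕ} {own : ℕ → ℕ} {w : ℕ → ℝ} {t η : ℝ}
    (hN : s.nat aN 0 = N) (hL : N ≤ L) (hn : s.nat aIn 0 = n) (hnL : n ≤ L)
    (hw : s.real rW = w) (ho : s.nat aOwn = own)
    (htv : s.real rT 0 = t) (hηv : s.real rEta 0 = η)
    (post : ∀ s', Frame Program.scan s s' →
      ((s'.nat vBig 0 = n ∧ ∀ i < n, weight N w own i ≤ 2 * t + η) ∨
        (s'.nat vBig 0 < n ∧ 2 * t + η < weight N w own (s'.nat vBig 0))) →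
      ((s'.nat vSmall 0 = n ∧ ∀ i < n, t ≤ weight N w own i) ∨
        (s'.nat vSmall 0 < n ∧ weight N w own (s'.nat vSmall 0) < t)) → Q s') :
    Does O L .scan s Q := by
  suffices Does O L .scan s fun s' =>
      ((s'.nat vBig 0 = n ∧ ∀ i < n, weight N w own i ≤ 2 * t + η) ∨
        (s'.nat vBig 0 < n ∧ 2 * t + η < weight N w own (s'.nat vBig 0))) ∧
      ((s'.nat vSmall 0 = n ∧ ∀ i < n, t ≤ weight N w own i) ∨
        (s'.nat vSmall 0 < n ∧ weight N w own (s'.nat vSmall 0) < t)) from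
    this.imp fun s' hf h => post s' hf h.1 h.2
  refine Does.seq (Does.setNat (Does.seq (Does.setNat ?_)))
  simp only [NatExpr.value, hn, Store.setNat_nat, Nat.reduceEqDiff, false_and, if_false]
  set s1 := (s.setNat vBig 0 n).setNat vSmall 0 n with hs1
  have e1 : ∀ a, a ≠ vBig → a ≠ vSmall → s1.nat a = s.nat a := fun a ha hb => by
    rw [hs1, Store.setNat_nat_of_ne _ _ _ hb, Store.setNat_nat_of_ne _ _ _ ha]
  refine Does.forUpTo n (fun k s' =>
      ((s'.nat vBig 0 = n ∧ ∀ i < k, weight N w own i ≤ 2 * t + η) ∨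
        (s'.nat vBig 0 < n ∧ 2 * t + η < weight N w own (s'.nat vBig 0))) ∧
      ((s'.nat vSmall 0 = n ∧ ∀ i < k, t ≤ weight N w own i) ∨
        (s'.nat vSmall 0 < n ∧ weight N w own (s'.nat vSmall 0) < t))) hnL (by decide)
    (fun s' h => by simp [h.nat aIn (by decide), e1, hn]) (by simp [s1]) ?_ (fun s' _ h => h)
  rintro k hk s2 hf2 hk2 ⟨hB, hS⟩
  have N2 : s2.nat aN 0 = N := by
    rw [hf2.nat _ (by decide), e1 _ (by decide) (by decide), hN]
  have o2 : s2.nat aOwn = own := by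
    rw [hf2.nat _ (by decide), e1 _ (by decide) (by decide), ho]
  have w2 : s2.real rW = w := (hf2.real _ (by decide)).trans hw
  have t2 : s2.real rT 0 = t := by rw [hf2.real _ (by decide)]; exact htv
  have η2 : s2.real rEta 0 = η := by rw [hf2.real _ (by decide)]; exact hηv
  refine Does.seq (Does.sumIf N (fun a => own a = k) hL (by decide)
    (fun s' h => by simp [h.nat aN (by decide), N2])
    (fun s' h _ => by simp [h.nat aOwn (by decide), h.nat vK (by decide), hk2, o2])
    fun s3 hf3 h3 => ?_)
  rw [w2] at h3
  change _ = weight N w own k at h3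
  have B3 : s3.nat vBig = s2.nat vBig := hf3.nat _ (by decide)
  have S3 : s3.nat vSmall = s2.nat vSmall := hf3.nat _ (by decide)
  have k3 : s3.nat vK 0 = k := by rw [hf3.nat _ (by decide), hk2]
  have t3 : s3.real rT 0 = t := by rw [hf3.real _ (by decide), t2]
  have η3 : s3.real rEta 0 = η := by rw [hf3.real _ (by decide), η2]
  have mid : Does O L (.ite (.realLE (.var rSum) .cap) .skip (.setNat vBig (.const 0) (.var vK)))
      s3 fun s' => (s'.nat vBig 0 = n ∧ ∀ i < k + 1, weight N w own i ≤ 2 * t + η) ∨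
        (s'.nat vBig 0 < n ∧ 2 * t + η < weight N w own (s'.nat vBig 0)) := by
    refine Does.ite (fun h => Does.skip ?_) (fun h => Does.setNat ?_)
    all_goals simp only [Test.Holds, RealExpr.value, NatExpr.value, h3, t3, η3, Rat.cast_ofNat] at h
    · rw [B3]
      refine hB.imp_left fun h' => ⟨h'.1, fun i hi => ?_⟩
      rcases Nat.lt_succ_iff_lt_or_eq.1 hi with hi | rfl
      · exact h'.2 i hi
      · exact h
    · right
      simpa [k3, hk] using h
  refine Does.seq (mid.imp fun s4 hf4 h4 => ?_)
  have k4 : s4.nat vK 0 = k := by rw [hf4.nat _ (by decide), k3]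
  have t4 : s4.real rT 0 = t := by rw [hf4.real _ (by decide), t3]
  have S4 : s4.nat vSmall = s2.nat vSmall := by rw [hf4.nat _ (by decide), S3]
  have h3' : s4.real rSum 0 = weight N w own k := by rw [hf4.real _ (by decide), h3]
  refine Does.ite (fun h => Does.skip ?_) (fun h => Does.setNat ?_)
  all_goals simp only [Test.Holds, RealExpr.value, NatExpr.value, h3', t4] at h
  · simp only [Store.setNat_nat, Nat.reduceEqDiff, false_and, if_false, S4]
    refine ⟨h4, hS.imp_left fun h' => ⟨h'.1, fun i hi => ?_⟩⟩
    rcases Nat.lt_succ_iff_lt_or_eq.1 hi with hi | rfl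
    · exact h'.2 i hi
    · exact h
  · simp only [Store.setNat_nat, Nat.reduceEqDiff, false_and, if_false, and_self, if_true,
      NatExpr.value, k4]
    exact ⟨h4, .inr ⟨hk, not_le.1 h⟩⟩

theorem move {N n : ℕ} {U V own : ℕ → ℕ} {w : ℕ → ℝ} {t η l : ℝ}
    (hN : s.nat aN 0 = N) (hL : N ≤ L) (hU : s.nat aU = U) (hV : s.nat aV = V)
    (hw : s.real rW = w) (ho : s.nat aOwn = own)
    (htv : s.real rT 0 = t) (hηv : s.real rEta 0 = η)
    (hA : AreAtoms N U V w η) (ht : 0 < t) (hp : IsPartition N n U V own)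
    (hB : s.nat vBig 0 < n) (hbig : 2 * t + η < weight N w own (s.nat vBig 0))
    (hS : s.nat vSmall 0 < n) (hsmall : weight N w own (s.nat vSmall 0) < t)
    (hlt : l ≤ t) (hl : ∀ k < n, l ≤ weight N w own k)
    (post : ∀ s', Frame Program.move s s' → IsPartition N n U V (s'.nat aOwn) →
      (∀ k < n, l ≤ weight N w (s'.nat aOwn) k) →
      (bad N n w t η (s'.nat aOwn)).card < (bad N n w t η own).card → Q s') :
    Does O L .move s Q := by
  suffices Does O L .move s fun s' => IsPartition N n U V (s'.nat aOwn) ∧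
      (∀ k < n, l ≤ weight N w (s'.nat aOwn) k) ∧
      (bad N n w t η (s'.nat aOwn)).card < (bad N n w t η own).card from
    this.imp fun s' hf h => post s' hf h.1 h.2.1 h.2.2
  refine Does.seq (Does.fill N (fun _ => 1) hL (by decide)
    (fun s' h => by simp [h.nat aN (by decide), hN]) (fun s' h _ _ => by simp) fun s1 hf1 h1 => ?_)
  have N1 : s1.nat aN 0 = N := by rw [hf1.nat _ (by decide), hN]
  have o1 : s1.nat aOwn = own := by rw [hf1.nat _ (by decide), ho]
  have S1 : s1.nat vSmall = s.nat vSmall := hf1.nat _ (by decide)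
  refine Does.seq (Does.find N (fun a => own a = s.nat vSmall 0) hL (by decide)
    (fun s' h => by simp [h.nat aN (by decide), N1])
    (fun s' h _ => by
      simp [h.nat aOwn (by decide), h.nat vSmall (by decide), o1, S1]) fun s2 hf2 h2 => ?_)
  have h2 := h2.resolve_left fun h => by
    obtain ⟨a, ha⟩ := hp.nonempty _ hS
    rw [mem_marked] at ha
    exact h.2 a ha.1 ha.2
  set x := s2.nat vX 0 with hx
  have N2 : s2.nat aN 0 = N := by rw [hf2.nat _ (by decide), N1]
  have U2 : s2.nat aU = U := by rw [hf2.nat _ (by decide), hf1.nat _ (by decide), hU]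
  have V2 : s2.nat aV = V := by rw [hf2.nat _ (by decide), hf1.nat _ (by decide), hV]
  have sel2 : ∀ a < N, s2.nat aSel a = 1 := by rw [hf2.nat _ (by decide)]; exact h1
  refine Does.seq (Does.reach (by rw [N2]; exact hL) (by rw [N2]; exact h2.1) (sel2 x h2.1)
    fun s3 hf3 h3 => ?_)
  rw [N2, U2, V2] at h3
  set lab := s3.nat aLab with hlab
  have hpos : ∀ a < N, lab a ≠ 0 := by
    have e : marked N (s2.nat aSel) 1 = Finset.range N := by
      ext a
      simpa using sel2 a
    exact fun a ha => h3.pos_of_conn h2.1 (by rw [e]; exact hA.conn) (by simp [ha, sel2])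
  have N3 : s3.nat aN 0 = N := by rw [hf3.nat _ (by decide), N2]
  refine Does.seq (Does.fill N lab hL (by decide)
    (fun s' h => by simp [h.nat aN (by decide), N3])
    (fun s' h _ _ => by simp [h.nat aLab (by decide), lab]) fun s4 hf4 h4 => ?_)
  refine Does.seq (Does.setNat ?_)
  have B4 : s4.nat vBig 0 = s.nat vBig 0 := by
    rw [hf4.nat _ (by decide), hf3.nat _ (by decide), hf2.nat _ (by decide),
      hf1.nat _ (by decide)]
  simp only [NatExpr.value, B4]
  set m := s.nat vBig 0 with hm
  set s5 := s4.setNat vM 0 m with hs5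
  have e5 : ∀ a, a ≠ vM → s5.nat a = s4.nat a := fun a ha => s4.setNat_nat_of_ne _ _ ha
  have m5 : s5.nat vM 0 = m := by simp [s5]
  have N5 : s5.nat aN 0 = N := by rw [e5 _ (by decide), hf4.nat _ (by decide), N3]
  have o5 : s5.nat aOwn = own := by
    rw [e5 _ (by decide), hf4.nat _ (by decide), hf3.nat _ (by decide), hf2.nat _ (by decide), o1]
  refine Does.seq (Does.find N (fun a => own a = m) hL (by decide)
    (fun s' h => by simp [h.nat aN (by decide), N5])
    (fun s' h _ => by
      simp [h.nat aOwn (by decide), h.nat vM (by decide), o5, m5]) fun s6 hf6 h6 => ?_)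
  have h6 := h6.resolve_left fun h => by
    obtain ⟨a, ha⟩ := hp.nonempty _ hB
    rw [mem_marked] at ha
    exact h.2 a ha.1 ha.2
  have N6 : s6.nat aN 0 = N := by rw [hf6.nat _ (by decide), N5]
  have o6 : s6.nat aOwn = own := by rw [hf6.nat _ (by decide), o5]
  have m6 : s6.nat vM 0 = m := by rw [hf6.nat _ (by decide), m5]
  have hr : ∀ a, a ≠ rSum → a ≠ rSum' → a ≠ rWt → s6.real a = s.real a := by
    intro a h8 h9 h10
    rw [hf6.real a (by simp [Program.find, Program.forUpTo, Program.realArrays])]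
    change s4.real a = s.real a
    rw [hf4.real a (by simp [Program.fill, Program.forUpTo, Program.realArrays]),
      hf3.real a (by
        simp [Program.reach, Program.reachScan, Program.fill, Program.forUpTo,
          Program.realArrays]),
      hf2.real a (by simp [Program.find, Program.forUpTo, Program.realArrays]),
      hf1.real a (by simp [Program.fill, Program.forUpTo, Program.realArrays])]
  refine Does.seq (Does.sumIf N (fun a => own a = m) hL (by decide)
    (fun s' h => by simp [h.nat aN (by decide), N6])
    (fun s' h _ => by simp [h.nat aOwn (by decide), h.nat vM (by decide), m6, o6])
    fun s7 hf7 h7 => ?_)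
  rw [hr rW (by decide) (by decide) (by decide), hw] at h7
  have U7 : s7.nat aU = U := by
    rw [hf7.nat _ (by decide), hf6.nat _ (by decide), e5 _ (by decide), hf4.nat _ (by decide),
      hf3.nat _ (by decide), U2]
  have V7 : s7.nat aV = V := by
    rw [hf7.nat _ (by decide), hf6.nat _ (by decide), e5 _ (by decide), hf4.nat _ (by decide),
      hf3.nat _ (by decide), V2]
  have S7 : s7.nat vSmall 0 = s.nat vSmall 0 := by
    rw [hf7.nat _ (by decide), hf6.nat _ (by decide), e5 _ (by decide), hf4.nat _ (by decide),
      hf3.nat _ (by decide), hf2.nat _ (by decide), S1]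
  have d7 : s7.nat aDist = s4.nat aDist := by
    rw [hf7.nat _ (by decide), hf6.nat _ (by decide), e5 _ (by decide)]
  have q7 : s7.nat vQ 0 = s6.nat vQ 0 := by rw [hf7.nat _ (by decide)]
  refine Does.chain (m := m) (x := x) (own := own) (dist := s4.nat aDist) (by
    rw [hf7.nat _ (by decide), N6]) hL U7 V7 ?_ (by rw [hf7.nat _ (by decide), o6]) d7 ?_ ?_
    (by rw [hf7.nat _ (by decide), m6]) S7 hA ht hp hB (by rw [q7]; exact h6.1)
    (by rw [q7]; exact h6.2) h7 hbig ?_ ?_ h2.1 h2.2 hsmall hlt hl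
    (fun s' _ h1 h2 h3 => ⟨h1, h2, h3⟩)
  · rw [hf7.real _ (by decide), hr _ (by decide) (by decide) (by decide), hw]
  · rw [hf7.real _ (by decide), hr _ (by decide) (by decide) (by decide), htv]
  · rw [hf7.real _ (by decide), hr _ (by decide) (by decide) (by decide), hηv]
  · intro a ha hax
    obtain ⟨b, hb, -, h, hab⟩ := h3.pred a ha (hpos a ha) hax
    exact ⟨b, hb, by rwa [h4 a ha, h4 b hb], hab⟩
  · intro a ha
    rw [h4 a ha]
    exact (h3.le a ha).trans hL

theorem balance {N n : ℕ} {U V own : ℕ → ℕ} {w : ℕ → ℝ} {η : ℝ}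
    (hN : s.nat aN 0 = N) (hL : N ≤ L) (hn : s.nat aIn 0 = n) (hn0 : 0 < n)
    (hKL : (⌊1 / η⌋₊ + 1) * (n + 1) ≤ L) (hU : s.nat aU = U) (hV : s.nat aV = V)
    (hw : s.real rW = w) (ho : s.nat aOwn = own) (hηv : s.real rEta 0 = η)
    (hA : AreAtoms N U V w η) (hp : IsPartition N n U V own)
    (post : ∀ s', Frame Program.balance s s' → IsPartition N n U V (s'.nat aOwn) →
      (∃ t, ∀ k < n, t - η ≤ weight N w (s'.nat aOwn) k ∧
        weight N w (s'.nat aOwn) k ≤ 2 * t + η) → Q s') :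
    Does O L .balance s Q := by
  suffices Does O L .balance s fun s' => IsPartition N n U V (s'.nat aOwn) ∧
      ∃ t, ∀ k < n, t - η ≤ weight N w (s'.nat aOwn) k ∧
        weight N w (s'.nat aOwn) k ≤ 2 * t + η from
    this.imp fun s' hf h => post s' hf h.1 h.2
  set K := ⌊1 / η⌋₊ with hK
  have hη := hA.pos
  have hnL : n ≤ L := by nlinarith
  refine Does.seq (Does.setNat (Does.seq (Does.setNat (Does.seq (Does.setReal ?_)))))
  simp only [NatExpr.value, RealExpr.value, Store.setNat_real, hηv]
  set s1 := ((s.setNat vDone 0 0).setNat vLevel 0 1).setReal rT 0 η with hs1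
  have e1 : ∀ a, a ≠ vDone → a ≠ vLevel → s1.nat a = s.nat a := fun a ha hb => by
    rw [hs1, Store.setReal_nat, Store.setNat_nat_of_ne _ _ _ hb, Store.setNat_nat_of_ne _ _ _ ha]
  have e1' : ∀ a, a ≠ rT → s1.real a = s.real a := fun a ha => by
    rw [hs1, Store.setReal_real_of_ne _ _ _ ha]; rfl
  refine Does.loop (fun s' => IsPartition N n U V (s'.nat aOwn) ∧ 1 ≤ s'.nat vLevel 0 ∧
      s'.real rT 0 = s'.nat vLevel 0 * η ∧
      (∀ k < n, s'.real rT 0 - η ≤ weight N w (s'.nat aOwn) k) ∧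
      (s'.nat vDone 0 ≠ 0 → ∀ k < n, weight N w (s'.nat aOwn) k ≤ 2 * s'.real rT 0 + η))
    (fun s' => if s'.nat vDone 0 = 0 then 1 + (K + 1 - s'.nat vLevel 0) * (n + 1) +
      (bad N n w (s'.real rT 0) η (s'.nat aOwn)).card else 0) ?_ ?_ ?_ ?_
  · refine ⟨by rw [e1 _ (by decide) (by decide), ho]; exact hp, by simp [s1], by simp [s1], ?_, ?_⟩
    · intro k hk
      simp only [s1, Store.setReal_real, and_self, if_true, sub_self]
      exact Finset.sum_nonneg fun a ha => hA.nonneg a (mem_marked.1 ha).1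
    · simp [s1]
  · have := card_bad_le (N := N) (n := n) (w := w) (t := s1.real rT 0) (η := η) (own := s1.nat aOwn)
    have h1 : s1.nat vDone 0 = 0 := by simp [s1]
    have h2 : s1.nat vLevel 0 = 1 := by simp [s1]
    rw [if_pos h1, h2, Nat.add_sub_cancel]
    nlinarith
  · rintro s2 hf2 ⟨hp2, hlev, ht2, hl2, -⟩ htest
    simp only [Test.Holds, NatExpr.value, Nat.le_zero] at htest
    have N2 : s2.nat aN 0 = N := by rw [hf2.nat _ (by decide), e1 _ (by decide) (by decide), hN]
    have n2 : s2.nat aIn 0 = n := by rw [hf2.nat _ (by decide), e1 _ (by decide) (by decide), hn]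
    have w2 : s2.real rW = w := by rw [hf2.real _ (by decide), e1' _ (by decide), hw]
    have η2 : s2.real rEta 0 = η := by rw [hf2.real _ (by decide), e1' _ (by decide), hηv]
    have U2 : s2.nat aU = U := by rw [hf2.nat _ (by decide), e1 _ (by decide) (by decide), hU]
    have V2 : s2.nat aV = V := by rw [hf2.nat _ (by decide), e1 _ (by decide) (by decide), hV]
    set t := s2.real rT 0 with htd
    set own2 := s2.nat aOwn with hown2
    have ht : 0 < t := by
      rw [ht2]
      exact mul_pos (by exact_mod_cast hlev) hη
    rw [if_pos htest]
    refine Does.seq (Does.scan (own := own2) (t := t) N2 hL n2 hnL w2 rfl rfl η2 fun s3 hf3 hB hS => ?_)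
    have o3 : s3.nat aOwn = own2 := hf3.nat _ (by decide)
    have t3 : s3.real rT 0 = t := by rw [hf3.real _ (by decide)]
    have η3 : s3.real rEta 0 = η := by rw [hf3.real _ (by decide), η2]
    have n3 : s3.nat aIn 0 = n := by rw [hf3.nat _ (by decide), n2]
    have lev3 : s3.nat vLevel 0 = s2.nat vLevel 0 := by rw [hf3.nat _ (by decide)]
    have done3 : s3.nat vDone 0 = 0 := by rw [hf3.nat _ (by decide), htest]
    refine Does.ite (fun h => Does.setNat ?_) (fun h => Does.ite
      (fun h' => Does.seq (Does.setNat (Does.setReal ?_))) (fun h' => ?_))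
    · simp only [Test.Holds, NatExpr.value, n3] at h
      have hB := hB.resolve_right fun h' => by omega
      simp only [NatExpr.value, Store.setNat_nat, Store.setNat_real, Nat.reduceEqDiff, false_and,
        if_false, and_self, if_true]
      rw [Store.setNat_nat_of_ne _ _ _ (by decide), o3, t3, lev3]
      exact ⟨⟨hp2, hlev, ht2, hl2, fun _ => hB.2⟩, by simp⟩
    · simp only [Test.Holds, NatExpr.value, n3] at h'
      have hS := hS.resolve_right fun h' => by omega
      simp only [NatExpr.value, RealExpr.value, Store.setNat_nat, Store.setNat_real,
        Store.setReal_nat, Store.setReal_real, Nat.reduceEqDiff, false_and,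
        if_false, and_self, if_true]
      rw [Store.setNat_nat_of_ne _ _ _ (by decide), o3, η3, lev3, done3, if_pos rfl, Nat.cast_add, Nat.cast_one]
      have hle : s2.nat vLevel 0 ≤ K := by
        refine Nat.le_floor ?_
        rw [le_div_iff₀ hη, ← ht2]
        have h1 := sum_weight (w := w) hp2.lt
        rw [hA.total] at h1
        have h2 : ∑ i ∈ Finset.range n, t ≤ ∑ i ∈ Finset.range n, weight N w own2 i :=
          Finset.sum_le_sum fun i hi => hS.2 i (Finset.mem_range.1 hi)
        rw [h1, Finset.sum_const, Finset.card_range, nsmul_eq_mul] at h2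
        have : (1 : ℝ) ≤ n := by exact_mod_cast hn0
        nlinarith
      refine ⟨⟨hp2, hlev.trans (Nat.le_succ _), rfl, fun k hk => ?_, fun h => absurd rfl h⟩, ?_⟩
      · have := hS.2 k hk
        rw [ht2] at this
        linarith
      · have hc := card_bad_le (N := N) (n := n) (w := w) (t := ((s2.nat vLevel 0 : ℝ) + 1) * η)
          (η := η) (own := own2)
        obtain ⟨d, hd⟩ := Nat.exists_eq_add_of_le hle
        rw [show K + 1 - (s2.nat vLevel 0 + 1) = d by omega,
          show K + 1 - s2.nat vLevel 0 = d + 1 by omega]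
        nlinarith
    · simp only [Test.Holds, NatExpr.value, n3, not_le] at h h'
      have hB := hB.resolve_left fun h' => by omega
      have hS := hS.resolve_left fun h' => by omega
      refine Does.move (n := n) (own := own2) (l := t - η) (by rw [hf3.nat _ (by decide), N2]) hL
        (by rw [hf3.nat _ (by decide), U2]) (by rw [hf3.nat _ (by decide), V2])
        (by rw [hf3.real _ (by decide), w2]) o3 t3 η3 hA ht hp2 hB.1 hB.2 hS.1 hS.2 (by linarith)
        hl2 fun s4 hf4 hp4 hl4 hb4 => ?_
      have t4 : s4.real rT 0 = t := by rw [hf4.real _ (by decide), t3]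
      have lev4 : s4.nat vLevel 0 = s2.nat vLevel 0 := by rw [hf4.nat _ (by decide), lev3]
      have done4 : s4.nat vDone 0 = 0 := by rw [hf4.nat _ (by decide), done3]
      rw [t4, lev4, done4, if_pos rfl]
      exact ⟨⟨hp4, hlev, ht2, hl4, fun h => absurd rfl h⟩, by omega⟩
  · rintro s2 hf2 ⟨hp2, hlev, ht2, hl2, hd⟩ htest
    simp only [Test.Holds, NatExpr.value, Nat.le_zero] at htest
    exact ⟨hp2, s2.real rT 0, fun k hk => ⟨hl2 k hk, hd htest k hk⟩⟩

end Does

/-! ### Intervals of edges -/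

namespace Graph

variable {G : Graph}

/-- The interval `[x, y]` of the edge with number `e`. -/
def seg (G : Graph) (e : ℕ) (x y : ℝ) : Set G.Point :=
  {p | ∃ h : e < G.m, p ∈ G.interval ⟨e, h⟩ x y}

theorem seg_eq {e : ℕ} (h : e < G.m) (x y : ℝ) : G.seg e x y = G.interval ⟨e, h⟩ x y := by
  ext p
  simp [seg, h]

/-- The point `p` is the point of the edge with number `e` that has coordinate `x`. -/
def NodeAt (G : Graph) (e : ℕ) (x : ℝ) (p : G.Point) : Prop :=
  ∃ (h : e < G.m) (u : I), (u : ℝ) = x ∧ p = G.point ⟨e, h⟩ u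

theorem NodeAt.mem_seg {e : ℕ} {x y z : ℝ} {p : G.Point} (h : G.NodeAt e z p) (hx : x ≤ z)
    (hy : z ≤ y) : p ∈ G.seg e x y := by
  obtain ⟨h, u, rfl, hp⟩ := h
  exact ⟨h, u, hx, hy, hp⟩

theorem exists_nodeAt {e : ℕ} (h : e < G.m) {x : ℝ} (h0 : 0 ≤ x) (h1 : x ≤ 1) :
    ∃ p, G.NodeAt e x p := ⟨_, h, ⟨x, h0, h1⟩, rfl, rfl⟩

theorem isPiece_seg {e : ℕ} {x y : ℝ} (h : e < G.m) (h0 : 0 ≤ x) (hxy : x ≤ y) (h1 : y ≤ 1) :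
    G.IsPiece (G.seg e x y) :=
  ⟨{(⟨e, h⟩, x, y)}, by simp [h0, hxy, h1], by simp [seg_eq h]⟩

theorem isPiece_empty : G.IsPiece ∅ := ⟨∅, by simp, by simp⟩

theorem IsPiece.union {A B : Set G.Point} (hA : G.IsPiece A) (hB : G.IsPiece B) :
    G.IsPiece (A ∪ B) := by
  classical
  obtain ⟨F, hF, rfl⟩ := hA
  obtain ⟨F', hF', rfl⟩ := hB
  refine ⟨F ∪ F', fun f hf => ?_, by rw [Finset.set_biUnion_union]⟩
  rcases Finset.mem_union.1 hf with hf | hf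
  · exact hF f hf
  · exact hF' f hf

theorem isPiece_biUnion {ι : Type*} (S : Finset ι) (A : ι → Set G.Point)
    (h : ∀ a ∈ S, G.IsPiece (A a)) : G.IsPiece (⋃ a ∈ S, A a) := by
  classical
  induction S using Finset.induction_on with
  | empty => simpa using isPiece_empty
  | insert a S ha ih =>
    rw [Finset.set_biUnion_insert]
    exact (h a (Finset.mem_insert_self _ _)).union
      (ih fun b hb => h b (Finset.mem_insert_of_mem hb))

theorem exists_eq_point (p : G.Point) : ∃ e u, p = G.point e u := by
  induction p using Quotient.inductionOn with
  | h p => exact ⟨p.1, p.2, rfl⟩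

theorem continuous_point (e : Fin G.m) : Continuous (G.point e) :=
  continuous_quotient_mk'.comp (Continuous.prodMk_right e)

theorem interval_eq_image (e : Fin G.m) (x y : ℝ) (h0 : 0 ≤ x) (h1 : y ≤ 1) :
    G.interval e x y =
      (fun t => G.point e (Set.projIcc 0 1 zero_le_one t)) '' Set.Icc x y := by
  ext p
  constructor
  · rintro ⟨u, hx, hy, rfl⟩
    exact ⟨u, ⟨hx, hy⟩, by simp⟩
  · rintro ⟨t, ⟨hx, hy⟩, rfl⟩
    have ht : t ∈ Set.Icc (0 : ℝ) 1 := ⟨h0.trans hx, hy.trans h1⟩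
    exact ⟨⟨t, ht⟩, hx, hy, by simp [Set.projIcc_of_mem zero_le_one ht]⟩

theorem isShare_seg {e : ℕ} {x y : ℝ} (h : e < G.m) (h0 : 0 ≤ x) (hxy : x ≤ y) (h1 : y ≤ 1) :
    G.IsShare (G.seg e x y) := by
  refine ⟨isPiece_seg h h0 hxy h1, ?_⟩
  rw [seg_eq h, interval_eq_image _ _ _ h0 h1]
  have hp : IsPathConnected (Set.Icc x y) :=
    (convex_Icc x y).isPathConnected (Set.nonempty_Icc.2 hxy)
  have := hp.image (f := fun t => G.point ⟨e, h⟩ (Set.projIcc 0 1 zero_le_one t))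
    ((continuous_point _).comp continuous_projIcc)
  exact fun p hp q hq => this.joinedIn p hp q hq

theorem point_eq {e e' : Fin G.m} {u u' : I} (h : G.point e u = G.point e' u') :
    (e = e' ∧ u = u') ∨ u = 0 ∨ u = 1 := by
  rcases Quotient.exact h with h | ⟨v, hv, -⟩
  · exact .inl ⟨congrArg Prod.fst h, congrArg Prod.snd h⟩
  · rcases hv with hv | hv
    · exact .inr (.inl hv.1)
    · exact .inr (.inr hv.1)

theorem seg_inter_finite {e e' : ℕ} {x y x' y' : ℝ} (h : e = e' → y ≤ x' ∨ y' ≤ x) :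
    (G.seg e x y ∩ G.seg e' x' y').Finite := by
  by_cases he : e < G.m
  · have hsub : ∀ z : ℝ, ({p | G.NodeAt e z p} : Set G.Point).Subsingleton := by
      rintro z p ⟨_, u, hu, rfl⟩ q ⟨_, u', hu', rfl⟩
      rw [Subtype.ext (hu.trans hu'.symm)]
    refine (((hsub 0).finite.union (hsub 1).finite).union
      ((hsub y).finite.union (hsub x).finite)).subset ?_
    rintro p ⟨⟨h1, u, hxu, huy, rfl⟩, ⟨h2, u', hxu', huy', hp⟩⟩
    rcases point_eq hp with ⟨hee, rfl⟩ | rfl | rfl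
    · rcases h (Fin.mk.inj hee) with h | h
      · exact .inr (.inl ⟨h1, u, le_antisymm huy (h.trans hxu'), rfl⟩)
      · exact .inr (.inr ⟨h1, u, le_antisymm (huy'.trans h) hxu, rfl⟩)
    · exact .inl (.inl ⟨h1, 0, rfl, rfl⟩)
    · exact .inl (.inr ⟨h1, 1, rfl, rfl⟩)
  · refine Set.finite_empty.subset ?_
    rintro p ⟨⟨h1, -⟩, -⟩
    exact absurd h1 he

/-- A connected union of shares is a share. -/
theorem isShare_biUnion {U V : ℕ → ℕ} {A : ℕ → Set G.Point} {S : Finset ℕ}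
    (hA : ∀ a ∈ S, G.IsShare (A a))
    (hadj : ∀ a ∈ S, ∀ b ∈ S, Adj U V a b → (A a ∩ A b).Nonempty) (hS : Conn (Adj U V) S) :
    G.IsShare (⋃ a ∈ S, A a) := by
  refine ⟨isPiece_biUnion S A fun a ha => (hA a ha).1, ?_⟩
  have hsub : ∀ a ∈ S, A a ⊆ ⋃ a ∈ S, A a := fun a ha => Set.subset_biUnion_of_mem ha
  have key : ∀ a ∈ S, ∀ b, Relation.ReflTransGen (fun x y => y ∈ S ∧ Adj U V x y) a b →
      b ∈ S ∧ ∀ p ∈ A a, ∀ q ∈ A b, JoinedIn (⋃ a ∈ S, A a) p q := by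
    intro a ha b h
    induction h with
    | refl => exact ⟨ha, fun p hp q hq => ((hA a ha).2 p hp q hq).mono (hsub a ha)⟩
    | @tail b c _ h ih =>
      refine ⟨h.1, fun p hp q hq => ?_⟩
      obtain ⟨z, hzb, hzc⟩ := hadj b ih.1 c h.1 h.2
      exact (ih.2 p hp z hzb).trans (((hA c h.1).2 z hzc q hq).mono (hsub c h.1))
  intro p hp q hq
  simp only [Set.mem_iUnion] at hp hq
  obtain ⟨a, ha, hp⟩ := hp
  obtain ⟨b, hb, hq⟩ := hq
  exact (key a ha b (hS a ha b hb)).2 p hp q hq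

end Graph

/-! ### Values of unions of intervals -/

namespace Valuation

variable {G : Graph} (μ : Valuation G)

theorem val_of_finite {A : Set G.Point} (hA : G.IsPiece A) (hf : A.Finite) : μ.val A = 0 := by
  have := μ.additive A A hA hA (by simpa using hf)
  rw [Set.union_self] at this
  linarith

theorem val_biUnion {ι : Type*} (S : Finset ι) (A : ι → Set G.Point)
    (h : ∀ a ∈ S, G.IsPiece (A a))
    (hd : ∀ a ∈ S, ∀ b ∈ S, a ≠ b → (A a ∩ A b).Finite) :
    μ.val (⋃ a ∈ S, A a) = ∑ a ∈ S, μ.val (A a) := by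
  classical
  induction S using Finset.induction_on with
  | empty => simpa using μ.val_of_finite Graph.isPiece_empty Set.finite_empty
  | insert a S ha ih =>
    have hS : ∀ b ∈ S, G.IsPiece (A b) := fun b hb => h b (Finset.mem_insert_of_mem hb)
    rw [Finset.set_biUnion_insert, Finset.sum_insert ha, ← ih hS fun b hb c hc =>
      hd b (Finset.mem_insert_of_mem hb) c (Finset.mem_insert_of_mem hc)]
    refine μ.additive _ _ (h a (Finset.mem_insert_self _ _)) (Graph.isPiece_biUnion S A hS) ?_
    rw [Set.inter_iUnion₂]
    refine S.finite_toSet.biUnion fun b hb => hd a (Finset.mem_insert_self _ _) b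
      (Finset.mem_insert_of_mem hb) ?_
    rintro rfl
    exact ha hb

theorem val_seg_nonneg {e : ℕ} {x y : ℝ} (h : e < G.m) (h0 : 0 ≤ x) (hxy : x ≤ y) (h1 : y ≤ 1) :
    0 ≤ μ.val (G.seg e x y) := μ.nonneg _ (Graph.isPiece_seg h h0 hxy h1)

theorem val_seg_self {e : ℕ} {x : ℝ} (h : e < G.m) (h0 : 0 ≤ x) (h1 : x ≤ 1) :
    μ.val (G.seg e x x) = 0 := by
  refine μ.val_of_finite (Graph.isPiece_seg h h0 le_rfl h1) ?_
  simpa using Graph.seg_inter_finite (G := G) (e := e) (e' := e) (x := x) (y := x) (x' := x)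
    (y' := x) fun _ => .inl le_rfl

theorem val_seg_add {e : ℕ} {x y z : ℝ} (h : e < G.m) (h0 : 0 ≤ x) (hxy : x ≤ y) (hyz : y ≤ z)
    (h1 : z ≤ 1) : μ.val (G.seg e x z) = μ.val (G.seg e x y) + μ.val (G.seg e y z) := by
  rw [← μ.additive _ _ (Graph.isPiece_seg h h0 hxy (hyz.trans h1))
    (Graph.isPiece_seg h (h0.trans hxy) hyz h1) (Graph.seg_inter_finite fun _ => .inl le_rfl)]
  congr 1
  ext p
  constructor
  · rintro ⟨h, u, hx, hz, rfl⟩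
    rcases le_total (u : ℝ) y with hu | hu
    · exact .inl ⟨h, u, hx, hu, rfl⟩
    · exact .inr ⟨h, u, hu, hz, rfl⟩
  · rintro (⟨h, u, hx, hz, rfl⟩ | ⟨h, u, hx, hz, rfl⟩)
    · exact ⟨h, u, hx, hz.trans hyz, rfl⟩
    · exact ⟨h, u, hxy.trans hx, hz, rfl⟩

theorem sum_edges : ∑ e ∈ Finset.range G.m, μ.val (G.seg e 0 1) = 1 := by
  rw [← μ.val_biUnion _ _ (fun e he => Graph.isPiece_seg (Finset.mem_range.1 he) le_rfl
    zero_le_one le_rfl) (fun e _ e' _ h => Graph.seg_inter_finite fun h' => absurd h' h)]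
  refine Eq.trans (congrArg μ.val ?_) μ.normalized
  refine Set.eq_univ_of_forall fun p => ?_
  obtain ⟨e, u, rfl⟩ := Graph.exists_eq_point p
  simp only [Set.mem_iUnion]
  exact ⟨e, by simp, e.2, u, u.2.1, u.2.2, rfl⟩

theorem val_edge_le_one {e : ℕ} (h : e < G.m) : μ.val (G.seg e 0 1) ≤ 1 := by
  refine le_of_le_of_eq ?_ μ.sum_edges
  exact Finset.single_le_sum (f := fun e => μ.val (G.seg e 0 1))
    (fun e he => μ.val_seg_nonneg (Finset.mem_range.1 he) le_rfl zero_le_one le_rfl)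
    (Finset.mem_range.2 h)

theorem edges_pos (μ : Valuation G) : 0 < G.m := by
  by_contra h
  have := μ.sum_edges
  simp [Nat.le_zero.1 (not_lt.1 h)] at this

end Valuation

/-! ### Cutting the cake into atoms -/

/-- The cake is cut into the intervals `[X a, Y a]` of the edges `E a`, and adjacent atoms meet. -/
structure IsCutting (G : Graph) (N : ℕ) (E U V : ℕ → ℕ) (X Y : ℕ → ℝ) : Prop where
  edge_lt : ∀ a < N, E a < G.m
  nonneg : ∀ a < N, 0 ≤ X a
  le : ∀ a < N, X a ≤ Y a
  le_one : ∀ a < N, Y a ≤ 1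
  meet : ∀ a < N, ∀ b < N, Adj U V a b →
    (G.seg (E a) (X a) (Y a) ∩ G.seg (E b) (X b) (Y b)).Nonempty
  disj : ∀ a < N, ∀ b < N, a ≠ b → E a = E b → Y a ≤ X b ∨ Y b ≤ X a
  cover : ∀ e < G.m, ∀ t, 0 ≤ t → t ≤ 1 → ∃ a < N, E a = e ∧ X a ≤ t ∧ t ≤ Y a

/-- The share of agent `i`. -/
def shareOf (G : Graph) (N : ℕ) (E : ℕ → ℕ) (X Y : ℕ → ℝ) (own : ℕ → ℕ) (i : ℕ) : Set G.Point :=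
  ⋃ a ∈ marked N own i, G.seg (E a) (X a) (Y a)

section

variable {G : Graph} {N n : ℕ} {E U V own : ℕ → ℕ} {X Y : ℕ → ℝ}

theorem IsCutting.inter_finite (h : IsCutting G N E U V X Y) {a b : ℕ} (ha : a < N) (hb : b < N)
    (hab : a ≠ b) : (G.seg (E a) (X a) (Y a) ∩ G.seg (E b) (X b) (Y b)).Finite :=
  Graph.seg_inter_finite (h.disj a ha b hb hab)

theorem IsCutting.val_biUnion (h : IsCutting G N E U V X Y) (μ : Valuation G) {S : Finset ℕ}
    (hS : S ⊆ Finset.range N) : μ.val (⋃ a ∈ S, G.seg (E a) (X a) (Y a)) =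
      ∑ a ∈ S, μ.val (G.seg (E a) (X a) (Y a)) := by
  have hlt : ∀ a ∈ S, a < N := fun a ha => Finset.mem_range.1 (hS ha)
  exact μ.val_biUnion S _ (fun a ha => Graph.isPiece_seg (h.edge_lt a (hlt a ha))
      (h.nonneg a (hlt a ha)) (h.le a (hlt a ha)) (h.le_one a (hlt a ha)))
    (fun a ha b hb => h.inter_finite (hlt a ha) (hlt b hb))

theorem IsCutting.iUnion_eq (h : IsCutting G N E U V X Y) :
    ⋃ a ∈ Finset.range N, G.seg (E a) (X a) (Y a) = Set.univ := by
  refine Set.eq_univ_of_forall fun p => ?_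
  obtain ⟨e, u, rfl⟩ := Graph.exists_eq_point p
  obtain ⟨a, ha, hae, hx, hy⟩ := h.cover e e.2 u u.2.1 u.2.2
  simp only [Set.mem_iUnion]
  exact ⟨a, Finset.mem_range.2 ha, hae ▸ ⟨e.2, u, hx, hy, rfl⟩⟩

theorem IsCutting.total (h : IsCutting G N E U V X Y) (μ : Valuation G) :
    ∑ a ∈ Finset.range N, μ.val (G.seg (E a) (X a) (Y a)) = 1 := by
  rw [← h.val_biUnion μ subset_rfl, h.iUnion_eq, μ.normalized]

theorem IsCutting.isAllocation (h : IsCutting G N E U V X Y) (hp : IsPartition N n U V own) :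
    IsAllocation G fun i : Fin n => shareOf G N E X Y own i where
  share i := by
    have hlt : ∀ a ∈ marked N own i, a < N := fun a ha => (mem_marked.1 ha).1
    exact Graph.isShare_biUnion (fun a ha => Graph.isShare_seg (h.edge_lt a (hlt a ha))
      (h.nonneg a (hlt a ha)) (h.le a (hlt a ha)) (h.le_one a (hlt a ha)))
      (fun a ha b hb => h.meet a (hlt a ha) b (hlt b hb)) (hp.conn i i.2)
  disjoint i j hij := by
    rw [shareOf, shareOf, Set.iUnion₂_inter]
    refine (marked N own i).finite_toSet.biUnion fun a ha => ?_
    rw [Set.inter_iUnion₂]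
    refine (marked N own j).finite_toSet.biUnion fun b hb => ?_
    rw [Finset.mem_coe, mem_marked] at ha hb
    refine h.inter_finite ha.1 hb.1 ?_
    rintro rfl
    exact hij (Fin.ext (ha.2.symm.trans hb.2))
  cover := by
    rw [← h.iUnion_eq]
    ext p
    simp only [shareOf, Set.mem_iUnion, mem_marked, Finset.mem_range]
    constructor
    · rintro ⟨i, a, ⟨ha, -⟩, hp⟩
      exact ⟨a, ha, hp⟩
    · rintro ⟨a, ha, hp'⟩
      exact ⟨⟨own a, hp.lt a ha⟩, a, ⟨ha, rfl⟩, hp'⟩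

theorem outputShares_eq (s : Store) (i : Fin n) : outputShares G n s i =
    shareOf G (s.nat aN 0) (s.nat aEdge) (s.real rX) (s.real rY) (s.nat aOwn) i := by
  ext p
  simp only [outputShares, shareOf, Set.mem_ofPred_eq, Set.mem_iUnion, mem_marked]
  constructor
  · rintro ⟨r, hr, ho, e, he, hp⟩
    exact ⟨r, ⟨hr, ho⟩, by rw [he]; exact e.2, by simpa only [he] using hp⟩
  · rintro ⟨r, ⟨hr, ho⟩, he, hp⟩
    exact ⟨r, hr, ho, ⟨_, he⟩, rfl, hp⟩

end

/-! ### The invariant of the cutting phase -/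

namespace Graph

/-- The number of the source of an edge. -/
def srcNat (G : Graph) (e : ℕ) : ℕ := if h : e < G.m then (G.src ⟨e, h⟩ : ℕ) else 0

/-- The number of the target of an edge. -/
def tgtNat (G : Graph) (e : ℕ) : ℕ := if h : e < G.m then (G.tgt ⟨e, h⟩ : ℕ) else 0

variable {G : Graph}

theorem srcNat_lt {e : ℕ} (h : e < G.m) : G.srcNat e < G.k := by simp [srcNat, h]

theorem tgtNat_lt {e : ℕ} (h : e < G.m) : G.tgtNat e < G.k := by simp [tgtNat, h]

theorem exists_vertex_map (h : 0 < G.m) : ∃ P : ℕ → G.Point,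
    ∀ e < G.m, G.NodeAt e 0 (P (G.srcNat e)) ∧ G.NodeAt e 1 (P (G.tgtNat e)) := by
  classical
  have key : ∀ v : ℕ, ∃ q : G.Point, ∀ (p : Fin G.m × I) (i : Fin G.k), (i : ℕ) = v →
      G.AtVertex p i → q = G.point p.1 p.2 := by
    intro v
    by_cases hv : ∃ (p : Fin G.m × I) (i : Fin G.k), (i : ℕ) = v ∧ G.AtVertex p i
    · obtain ⟨p, i, rfl, hp⟩ := hv
      refine ⟨G.point p.1 p.2, fun p' i' hi hp' => Quotient.sound (Or.inr ⟨i, hp, ?_⟩)⟩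
      rwa [← Fin.ext hi]
    · exact ⟨G.point ⟨0, h⟩ 0, fun p i hi hp => absurd ⟨p, i, hi, hp⟩ hv⟩
  choose P hP using key
  refine ⟨P, fun e he => ⟨⟨he, 0, rfl, ?_⟩, ⟨he, 1, rfl, ?_⟩⟩⟩
  · exact hP _ (⟨e, he⟩, 0) (G.src ⟨e, he⟩) (by simp [srcNat, he]) (Or.inl ⟨rfl, rfl⟩)
  · exact hP _ (⟨e, he⟩, 1) (G.tgt ⟨e, he⟩) (by simp [tgtNat, he]) (Or.inr ⟨rfl, rfl⟩)

end Graph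

/-- One of the atoms `n, …, N - 1` joins the nodes `p` and `q`. -/
def Step (n N : ℕ) (U V : ℕ → ℕ) (p q : ℕ) : Prop :=
  ∃ a, n ≤ a ∧ a < N ∧ ((U a = p ∧ V a = q) ∨ (U a = q ∧ V a = p))

/-- The nodes `p` and `q` are joined by a path of atoms. -/
def Link (n N : ℕ) (U V : ℕ → ℕ) : ℕ → ℕ → Prop := Relation.ReflTransGen (Step n N U V)

theorem Link.symm {n N : ℕ} {U V : ℕ → ℕ} {p q : ℕ} (h : Link n N U V p q) :
    Link n N U V q p := by
  induction h with
  | refl => exact .refl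
  | tail _ h ih =>
    obtain ⟨a, h1, h2, h3⟩ := h
    exact .head ⟨a, h1, h2, h3.symm⟩ ih

theorem Link.mono {n N N' : ℕ} {U V U' V' : ℕ → ℕ} {p q : ℕ} (h : Link n N U V p q)
    (hN : N ≤ N') (hU : ∀ a < N, U' a = U a) (hV : ∀ a < N, V' a = V a) :
    Link n N' U' V' p q := by
  refine Relation.ReflTransGen.mono ?_ _ _ h
  rintro p q ⟨a, h1, h2, h3⟩
  exact ⟨a, h1, h2.trans_le hN, by rwa [hU a h2, hV a h2]⟩

theorem Link.path {n N : ℕ} {U V : ℕ → ℕ} {p q a b : ℕ} {S : Finset ℕ} (h : Link n N U V p q)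
    (hS : ∀ a, n ≤ a → a < N → a ∈ S) (ha : U a = p ∨ V a = p)
    (hbS : b ∈ S) (hb : U b = q ∨ V b = q) :
    Relation.ReflTransGen (fun x y => y ∈ S ∧ Adj U V x y) a b := by
  induction h generalizing b with
  | refl => exact .single ⟨hbS, by unfold Adj; grind⟩
  | tail _ h ih =>
    obtain ⟨c, h1, h2, h3⟩ := h
    exact (ih (hS c h1 h2) (by tauto)).tail ⟨hbS, by unfold Adj; grind⟩

/-- The atoms of the store cut the edges before `e` and the part `[0, c]` of the edge `e`; the point of
node `v` is `P v`. The first `n` atoms are single points. -/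
structure IsCut (G : Graph) (μ : Valuation G) (η : ℝ) (n : ℕ) (P : ℕ → G.Point) (s : Store)
    (e : ℕ) (c : ℝ) : Prop where
  vertex : ∀ e < G.m, G.NodeAt e 0 (P (G.srcNat e)) ∧ G.NodeAt e 1 (P (G.tgtNat e))
  n_le : n ≤ s.nat aN 0
  edge_lt : ∀ a < s.nat aN 0, s.nat aEdge a < G.m
  nonneg : ∀ a < s.nat aN 0, 0 ≤ s.real rX a
  le : ∀ a < s.nat aN 0, s.real rX a ≤ s.real rY a
  le_one : ∀ a < s.nat aN 0, s.real rY a ≤ 1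
  weight_eq : ∀ a < s.nat aN 0,
    s.real rW a = μ.val (G.seg (s.nat aEdge a) (s.real rX a) (s.real rY a))
  weight_le : ∀ a < s.nat aN 0, s.real rW a ≤ η
  nodeU : ∀ a < s.nat aN 0, G.NodeAt (s.nat aEdge a) (s.real rX a) (P (s.nat aU a))
  nodeV : ∀ a < s.nat aN 0, G.NodeAt (s.nat aEdge a) (s.real rY a) (P (s.nat aV a))
  freshU : ∀ a < s.nat aN 0, s.nat aU a < G.k + s.nat aN 0
  freshV : ∀ a < s.nat aN 0, s.nat aV a < G.k + s.nat aN 0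
  before : ∀ a < s.nat aN 0, s.nat aEdge a < e ∨ (s.nat aEdge a = e ∧ s.real rY a ≤ c)
  disj : ∀ a < s.nat aN 0, ∀ b < s.nat aN 0, a ≠ b → s.nat aEdge a = s.nat aEdge b →
    s.real rY a ≤ s.real rX b ∨ s.real rY b ≤ s.real rX a
  cover : ∀ e' < e, ∀ t, 0 ≤ t → t ≤ 1 →
    ∃ a < s.nat aN 0, s.nat aEdge a = e' ∧ s.real rX a ≤ t ∧ t ≤ s.real rY a
  cover' : ∀ t, 0 ≤ t → t < c →
    ∃ a < s.nat aN 0, s.nat aEdge a = e ∧ s.real rX a ≤ t ∧ t ≤ s.real rY a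
  linkU : ∀ a < s.nat aN 0,
    Link n (s.nat aN 0) (s.nat aU) (s.nat aV) (G.srcNat (s.nat aEdge a)) (s.nat aU a)
  linkE : ∀ e' < e, Link n (s.nat aN 0) (s.nat aU) (s.nat aV) (G.srcNat e') (G.tgtNat e')
  own_lt : ∀ a < n, s.nat aOwn a = a
  own_ge : ∀ a, n ≤ a → a < s.nat aN 0 → s.nat aOwn a = 0

/-- The stores agree on the arrays that describe the atoms. -/
structure SameAtoms (s s' : Store) : Prop where
  nat : ∀ a ∈ [aN, aOwn, aEdge, aU, aV], s'.nat a = s.nat a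
  real : ∀ a ∈ [rX, rY, rW], s'.real a = s.real a

/-- The store `s'` has one more atom than `s`. -/
structure Added (s s' : Store) (e u v : ℕ) (x y w : ℝ) : Prop where
  count : s'.nat aN 0 = s.nat aN 0 + 1
  own : s'.nat aOwn = Function.update (s.nat aOwn) (s.nat aN 0) 0
  edge : s'.nat aEdge = Function.update (s.nat aEdge) (s.nat aN 0) e
  left : s'.nat aU = Function.update (s.nat aU) (s.nat aN 0) u
  right : s'.nat aV = Function.update (s.nat aV) (s.nat aN 0) v
  lower : s'.real rX = Function.update (s.real rX) (s.nat aN 0) x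
  upper : s'.real rY = Function.update (s.real rY) (s.nat aN 0) y
  weight : s'.real rW = Function.update (s.real rW) (s.nat aN 0) w

section

variable {G : Graph} {μ : Valuation G} {η : ℝ} {n : ℕ} {P P' : ℕ → G.Point} {s s' : Store}
  {e : ℕ} {c : ℝ}

theorem IsCut.congr (h : IsCut G μ η n P s e c) (hs : SameAtoms s s') :
    IsCut G μ η n P s' e c := by
  have h1 := hs.nat aN (by decide)
  have h2 := hs.nat aOwn (by decide)
  have h3 := hs.nat aEdge (by decide)
  have h4 := hs.nat aU (by decide)
  have h5 := hs.nat aV (by decide)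
  have h6 := hs.real rX (by decide)
  have h7 := hs.real rY (by decide)
  have h8 := hs.real rW (by decide)
  constructor
  all_goals try simp only [h1, h2, h3, h4, h5, h6, h7, h8]
  exacts [h.vertex, h.n_le, h.edge_lt, h.nonneg, h.le, h.le_one, h.weight_eq, h.weight_le, h.nodeU,
    h.nodeV, h.freshU, h.freshV, h.before, h.disj, h.cover, h.cover', h.linkU, h.linkE, h.own_lt,
    h.own_ge]

theorem IsCut.link_mono (ha : Added s s' e u v x y w) {p q : ℕ}
    (h : Link n (s.nat aN 0) (s.nat aU) (s.nat aV) p q) :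
    Link n (s'.nat aN 0) (s'.nat aU) (s'.nat aV) p q :=
  h.mono (by rw [ha.count]; exact Nat.le_succ _)
    (fun b hb => by rw [ha.left, Function.update_of_ne hb.ne])
    (fun b hb => by rw [ha.right, Function.update_of_ne hb.ne])

theorem IsCut.link_add (ha : Added s s' e u v x y w) (hn : n ≤ s.nat aN 0) {p : ℕ}
    (h : Link n (s.nat aN 0) (s.nat aU) (s.nat aV) p u) :
    Link n (s'.nat aN 0) (s'.nat aU) (s'.nat aV) p v :=
  (IsCut.link_mono ha h).tail ⟨s.nat aN 0, hn, by rw [ha.count]; exact Nat.lt_succ_self _, .inl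
    ⟨by rw [ha.left, Function.update_self], by rw [ha.right, Function.update_self]⟩⟩

theorem IsCut.add {u v : ℕ} {y w : ℝ} (h : IsCut G μ η n P s e c) (ha : Added s s' e u v c y w)
    (he : e < G.m) (hc : 0 ≤ c) (hcy : c ≤ y) (hy : y ≤ 1) (hu : G.NodeAt e c (P u))
    (huf : u < G.k + s.nat aN 0)
    (hul : Link n (s.nat aN 0) (s.nat aU) (s.nat aV) (G.srcNat e) u)
    (hP : ∀ j < G.k + s.nat aN 0, P' j = P j) (hv : G.NodeAt e y (P' v))
    (hvf : v < G.k + s.nat aN 0 + 1) (hw : w = μ.val (G.seg e c y)) (hwη : w ≤ η) :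
    IsCut G μ η n P' s' e y := by
  set N := s.nat aN 0 with hN
  have hN' : s'.nat aN 0 = N + 1 := ha.count
  have old : ∀ a, a < N → s'.nat aOwn a = s.nat aOwn a ∧ s'.nat aEdge a = s.nat aEdge a ∧
      s'.nat aU a = s.nat aU a ∧ s'.nat aV a = s.nat aV a ∧ s'.real rX a = s.real rX a ∧
      s'.real rY a = s.real rY a ∧ s'.real rW a = s.real rW a := by
    intro a ha'
    rw [ha.own, ha.edge, ha.left, ha.right, ha.lower, ha.upper, ha.weight]
    simp only [Function.update_of_ne ha'.ne, and_self, ← hN]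
  have n1 : s'.nat aOwn N = 0 := by rw [ha.own, Function.update_self]
  have n2 : s'.nat aEdge N = e := by rw [ha.edge, Function.update_self]
  have n3 : s'.nat aU N = u := by rw [ha.left, Function.update_self]
  have n4 : s'.nat aV N = v := by rw [ha.right, Function.update_self]
  have n5 : s'.real rX N = c := by rw [ha.lower, Function.update_self]
  have n6 : s'.real rY N = y := by rw [ha.upper, Function.update_self]
  have n7 : s'.real rW N = w := by rw [ha.weight, Function.update_self]
  have cases : ∀ {p : ℕ → Prop}, (∀ a < N, p a) → p N → ∀ a < s'.nat aN 0, p a := by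
    intro p h1 h2 a ha
    rw [hN'] at ha
    rcases Nat.lt_succ_iff_lt_or_eq.1 ha with ha | rfl
    · exact h1 a ha
    · exact h2
  have hP0 : ∀ j < G.k, P' j = P j := fun j hj => hP j (by omega)
  constructor
  · intro e' he'
    rw [hP0 _ (Graph.srcNat_lt he'), hP0 _ (Graph.tgtNat_lt he')]
    exact h.vertex e' he'
  · rw [hN']; exact h.n_le.trans (Nat.le_succ _)
  · exact cases (fun a ha => by rw [(old a ha).2.1]; exact h.edge_lt a ha) (by rw [n2]; exact he)
  · exact cases (fun a ha => by rw [(old a ha).2.2.2.2.1]; exact h.nonneg a ha)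
      (by rw [n5]; exact hc)
  · exact cases (fun a ha => by rw [(old a ha).2.2.2.2.1, (old a ha).2.2.2.2.2.1]; exact h.le a ha)
      (by rw [n5, n6]; exact hcy)
  · exact cases (fun a ha => by rw [(old a ha).2.2.2.2.2.1]; exact h.le_one a ha)
      (by rw [n6]; exact hy)
  · exact cases (fun a ha => by
      obtain ⟨-, o2, -, -, o5, o6, o7⟩ := old a ha
      rw [o2, o5, o6, o7]; exact h.weight_eq a ha) (by rw [n2, n5, n6, n7]; exact hw)
  · exact cases (fun a ha => by rw [(old a ha).2.2.2.2.2.2]; exact h.weight_le a ha)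
      (by rw [n7]; exact hwη)
  · exact cases (fun a ha => by
      obtain ⟨-, o2, o3, -, o5, -, -⟩ := old a ha
      rw [o2, o3, o5, hP _ (h.freshU a ha)]; exact h.nodeU a ha)
      (by rw [n2, n3, n5, hP _ huf]; exact hu)
  · exact cases (fun a ha => by
      obtain ⟨-, o2, -, o4, -, o6, -⟩ := old a ha
      rw [o2, o4, o6, hP _ (h.freshV a ha)]; exact h.nodeV a ha)
      (by rw [n2, n4, n6]; exact hv)
  · exact cases (fun a ha => by
      rw [(old a ha).2.2.1, hN']; exact (h.freshU a ha).trans (by omega)) (by rw [n3, hN']; omega)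
  · exact cases (fun a ha => by
      rw [(old a ha).2.2.2.1, hN']; exact (h.freshV a ha).trans (by omega))
      (by rw [n4, hN']; omega)
  · refine cases (fun a ha => ?_) (by rw [n2, n6]; exact .inr ⟨rfl, le_rfl⟩)
    obtain ⟨-, o2, -, -, -, o6, -⟩ := old a ha
    rw [o2, o6]
    exact (h.before a ha).imp_right fun h' => ⟨h'.1, h'.2.trans hcy⟩
  · have hlast : ∀ a < N, s.nat aEdge a = e → s.real rY a ≤ c := fun a ha hae =>
      ((h.before a ha).resolve_left (by omega)).2
    refine cases (fun a ha => cases (fun b hb => ?_) ?_) (cases (fun b hb => ?_) ?_)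
    · obtain ⟨-, o2, -, -, o5, o6, -⟩ := old a ha
      obtain ⟨-, o2', -, -, o5', o6', -⟩ := old b hb
      rw [o2, o5, o6, o2', o5', o6']
      exact h.disj a ha b hb
    · obtain ⟨-, o2, -, -, o5, o6, -⟩ := old a ha
      rw [o2, o5, o6, n2, n5, n6]
      exact fun _ hae => .inl (hlast a ha hae)
    · obtain ⟨-, o2, -, -, o5, o6, -⟩ := old b hb
      rw [o2, o5, o6, n2, n5, n6]
      exact fun _ hbe => .inr (hlast b hb hbe.symm)
    · exact fun h => absurd rfl h
  · intro e' he' t h0 h1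
    obtain ⟨a, ha, hh⟩ := h.cover e' he' t h0 h1
    obtain ⟨-, o2, -, -, o5, o6, -⟩ := old a ha
    exact ⟨a, by omega, by rwa [o2, o5, o6]⟩
  · intro t h0 hty
    rcases lt_or_ge t c with htc | htc
    · obtain ⟨a, ha, hh⟩ := h.cover' t h0 htc
      obtain ⟨-, o2, -, -, o5, o6, -⟩ := old a ha
      exact ⟨a, by omega, by rwa [o2, o5, o6]⟩
    · exact ⟨N, by omega, by rw [n2, n5, n6]; exact ⟨rfl, htc, hty.le⟩⟩
  · refine cases (fun a ha' => ?_) ?_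
    · rw [(old a ha').2.1, (old a ha').2.2.1]
      exact IsCut.link_mono ha (h.linkU a ha')
    · rw [n2, n3]
      exact IsCut.link_mono ha hul
  · exact fun e' he' => IsCut.link_mono ha (h.linkE e' he')
  · intro a ha
    rw [(old a (ha.trans_le h.n_le)).1]
    exact h.own_lt a ha
  · intro a hna
    revert hna
    revert a
    suffices ∀ a < s'.nat aN 0, n ≤ a → s'.nat aOwn a = 0 from fun a h1 h2 => this a h2 h1
    exact cases (fun a ha hna => by rw [(old a ha).1]; exact h.own_ge a hna ha) (fun _ => n1)

theorem IsCut.next (h : IsCut G μ η n P s e 1)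
    (hcov : ∃ a < s.nat aN 0, s.nat aEdge a = e ∧ s.real rX a ≤ 1 ∧ 1 ≤ s.real rY a)
    (hl : Link n (s.nat aN 0) (s.nat aU) (s.nat aV) (G.srcNat e) (G.tgtNat e)) :
    IsCut G μ η n P s (e + 1) 0 := by
  refine { h with before := ?_, cover := ?_, cover' := ?_, linkE := ?_ }
  · exact fun a ha => .inl (by rcases h.before a ha with h' | h' <;> omega)
  · intro e' he' t h0 h1
    rcases Nat.lt_succ_iff_lt_or_eq.1 he' with he' | rfl
    · exact h.cover e' he' t h0 h1
    · rcases h1.lt_or_eq with h1 | rfl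
      · exact h.cover' t h0 h1
      · exact hcov
  · intro t h0 h1
    linarith
  · intro e' he'
    rcases Nat.lt_succ_iff_lt_or_eq.1 he' with he' | rfl
    · exact h.linkE e' he'
    · exact hl

theorem IsCut.isCutting (h : IsCut G μ η n P s G.m 0) :
    IsCutting G (s.nat aN 0) (s.nat aEdge) (s.nat aU) (s.nat aV) (s.real rX) (s.real rY) where
  edge_lt := h.edge_lt
  nonneg := h.nonneg
  le := h.le
  le_one := h.le_one
  disj := h.disj
  cover := h.cover
  meet a ha b hb hab := by
    have hU : ∀ a < s.nat aN 0, P (s.nat aU a) ∈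
        G.seg (s.nat aEdge a) (s.real rX a) (s.real rY a) := fun a ha =>
      (h.nodeU a ha).mem_seg le_rfl (h.le a ha)
    have hV : ∀ a < s.nat aN 0, P (s.nat aV a) ∈
        G.seg (s.nat aEdge a) (s.real rX a) (s.real rY a) := fun a ha =>
      (h.nodeV a ha).mem_seg (h.le a ha) le_rfl
    rcases hab with e | e | e | e
    · exact ⟨_, hU a ha, e ▸ hU b hb⟩
    · exact ⟨_, hU a ha, e ▸ hV b hb⟩
    · exact ⟨_, hV a ha, e ▸ hU b hb⟩
    · exact ⟨_, hV a ha, e ▸ hV b hb⟩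

theorem IsCut.link_vertices (h : IsCut G μ η n P s G.m 0) (hG : G.IsConnectedGraph)
    (i j : Fin G.k) : Link n (s.nat aN 0) (s.nat aU) (s.nat aV) i j := by
  obtain ⟨p⟩ := hG.preconnected i j
  induction p with
  | nil => exact .refl
  | @cons i j l hadj _ ih =>
    refine Relation.ReflTransGen.trans ?_ ih
    have key : ∀ e : Fin G.m,
        Link n (s.nat aN 0) (s.nat aU) (s.nat aV) (G.src e) (G.tgt e) := fun e => by
      simpa [Graph.srcNat, Graph.tgtNat] using h.linkE e e.2
    rw [Graph.adjacency, SimpleGraph.fromRel_adj] at hadj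
    rcases hadj.2 with ⟨e, rfl, rfl⟩ | ⟨e, rfl, rfl⟩
    · exact key e
    · exact (key e).symm

theorem IsCut.conn (h : IsCut G μ η n P s G.m 0) (hG : G.IsConnectedGraph) {S : Finset ℕ}
    (hS : ∀ a, n ≤ a → a < s.nat aN 0 → a ∈ S) (hSN : ∀ a ∈ S, a < s.nat aN 0) :
    Conn (Adj (s.nat aU) (s.nat aV)) S := by
  intro a ha b hb
  have hea := h.edge_lt a (hSN a ha)
  have heb := h.edge_lt b (hSN b hb)
  have hab := h.link_vertices hG ⟨_, Graph.srcNat_lt hea⟩ ⟨_, Graph.srcNat_lt heb⟩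
  exact Link.path (((h.linkU a (hSN a ha)).symm.trans hab).trans (h.linkU b (hSN b hb))) hS
    (.inl rfl) hb (.inl rfl)

theorem IsCut.isPartition (h : IsCut G μ η n P s G.m 0) (hG : G.IsConnectedGraph) (hn : 0 < n) :
    IsPartition (s.nat aN 0) n (s.nat aU) (s.nat aV) (s.nat aOwn) where
  lt a ha := by
    rcases lt_or_ge a n with han | han
    · rwa [h.own_lt a han]
    · rwa [h.own_ge a han ha]
  conn i hi := by
    rcases Nat.eq_zero_or_pos i with rfl | hi0
    · exact h.conn hG (fun a ha haN => mem_marked.2 ⟨haN, h.own_ge a ha haN⟩)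
        fun a ha => (mem_marked.1 ha).1
    · have : marked (s.nat aN 0) (s.nat aOwn) i = {i} := by
        ext a
        rw [mem_marked, Finset.mem_singleton]
        constructor
        · rintro ⟨ha, hai⟩
          rcases lt_or_ge a n with han | han
          · rw [← hai, h.own_lt a han]
          · rw [h.own_ge a han ha] at hai; omega
        · rintro rfl
          exact ⟨hi.trans_le h.n_le, h.own_lt a hi⟩
      rw [this]
      exact conn_singleton i
  nonempty i hi := ⟨i, mem_marked.2 ⟨hi.trans_le h.n_le, h.own_lt i hi⟩⟩

theorem IsCut.areAtoms (h : IsCut G μ η n P s G.m 0) (hG : G.IsConnectedGraph) (hη : 0 < η) :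
    AreAtoms (s.nat aN 0) (s.nat aU) (s.nat aV) (s.real rW) η where
  pos := hη
  nonneg a ha := by
    rw [h.weight_eq a ha]
    exact μ.val_seg_nonneg (h.edge_lt a ha) (h.nonneg a ha) (h.le a ha) (h.le_one a ha)
  le := h.weight_le
  total := by
    rw [← h.isCutting.total μ]
    exact Finset.sum_congr rfl fun a ha => h.weight_eq a (Finset.mem_range.1 ha)
  conn := h.conn hG (fun a _ ha => Finset.mem_range.2 ha) fun a ha => Finset.mem_range.1 ha

end

/-! ### Cutting the edges into atoms -/

/-- Record the atom `[rCur, rCut]` of the edge `vK` with ends `vNode` and `vNew` and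
weight `rWt`. -/
def Program.addAtom : Program :=
  .seq (.setNat aOwn .atoms (.const 0))
    (.seq (.setNat aEdge .atoms (.var vK))
    (.seq (.setNat aU .atoms (.var vNode))
    (.seq (.setNat aV .atoms (.var vNew))
    (.seq (.setReal rX .atoms (.var rCur))
    (.seq (.setReal rY .atoms (.var rCut))
    (.seq (.setReal rW .atoms (.var rWt))
      (.setNat aN (.const 0) (.add .atoms (.const 1)))))))))

/-- Query the value of the rest `[rCur, 1]` of the edge `vK`. -/
def Program.evalRest : Program :=
  .evalQuery rEv (.const 0) (.const 0) (.var vK) (.var rCur) (.const 1)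

/-- Cut an atom of weight `rEta` off the edge `vK`. -/
def Program.cutStep : Program :=
  .seq (.cutQuery rCut (.const 0) (.const 0) (.var vK) (.var rCur) (.var rEta))
    (.seq (.setNat vNew (.const 0) (.add (.cell aIn (.const 1)) .atoms))
    (.seq (.setReal rWt (.const 0) (.var rEta))
    (.seq .addAtom
    (.seq (.setNat vNode (.const 0) (.var vNew))
    (.seq (.setReal rCur (.const 0) (.var rCut))
      .evalRest)))))

/-- Cut the edge `vK` into atoms. -/
def Program.cutEdge : Program :=
  .seq (.setReal rCur (.const 0) (.const 0))
    (.seq (.setNat vNode (.const 0) (.cell aSrc (.var vK)))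
    (.seq .evalRest
    (.seq (.loop (.not (.realLE (.var rEv) (.var rEta))) .cutStep)
    (.seq (.setReal rCut (.const 0) (.const 1))
    (.seq (.setNat vNew (.const 0) (.cell aTgt (.var vK)))
    (.seq (.setReal rWt (.const 0) (.var rEv))
      .addAtom))))))

/-- Give each agent an atom that consists of a single point, the end `0` of edge `0`. -/
def Program.start : Program :=
  .seq (.setReal rEta (.const 0) (.div (.var rEps) (.mul (.mul (.const 8) (.ofNat .agents))
      (.add (.const 1) (.var rEps)))))
    (.seq (.fill vI .agents aOwn .true (.var vI) (.var vI))
    (.seq (.fill vI .agents aU .true (.var aSrc) (.var aSrc))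
    (.seq (.fill vI .agents aV .true (.var aSrc) (.var aSrc))
      (.setNat aN (.const 0) .agents))))

/-- The whole algorithm. -/
def Program.main : Program :=
  .seq .start (.seq (.forUpTo vK (.cell aIn (.const 2)) .cutEdge) .balance)

namespace Does

variable {O : Oracle} {L : ℕ} {s : Store} {Q : Store → Prop}

theorem addAtom (post : ∀ s', Frame Program.addAtom s s' →
      Added s s' (s.nat vK 0) (s.nat vNode 0) (s.nat vNew 0) (s.real rCur 0) (s.real rCut 0)
        (s.real rWt 0) → Q s') :
    Does O L .addAtom s Q := by
  suffices Does O L .addAtom s fun s' => Added s s' (s.nat vK 0) (s.nat vNode 0) (s.nat vNew 0)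
      (s.real rCur 0) (s.real rCut 0) (s.real rWt 0) from this.imp post
  refine Does.seq (Does.setNat (Does.seq (Does.setNat (Does.seq (Does.setNat (Does.seq
    (Does.setNat (Does.seq (Does.setReal (Does.seq (Does.setReal (Does.seq (Does.setReal
    (Does.setNat ?_))))))))))))))
  constructor
  · simp
  all_goals
    funext j
    simp [Function.update_apply]

section

variable {G : Graph} {n : ℕ} {μ : Fin n → Valuation G} {i : Fin n} {η : ℝ} {e : ℕ}

theorem evalRest (hO : O.Truthful μ) (hi : (i : ℕ) = 0) (he : e < G.m) (hk : s.nat vK 0 = e)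
    (h0 : 0 ≤ s.real rCur 0) (h1 : s.real rCur 0 ≤ 1)
    (post : ∀ s', Frame Program.evalRest s s' →
      s'.real rEv 0 = (μ i).val (G.seg e (s.real rCur 0) 1) → Q s') :
    Does O L .evalRest s Q := by
  suffices Does O L .evalRest s fun s' =>
    s'.real rEv 0 = (μ i).val (G.seg e (s.real rCur 0) 1) from this.imp post
  refine Does.evalQuery ?_
  have := (hO i ⟨e, he⟩ (s.real rCur 0) h0 h1).1 1 h1 le_rfl
  rw [hi] at this
  simp [hk, this, Graph.seg_eq he]

/-- The state of the loop of `Program.cutEdge`: the part `[0, rCur]` of the edge is cut. -/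
def CutState (G : Graph) (μ : Valuation G) (η : ℝ) (n e : ℕ) (s : Store) : Prop :=
  ∃ P, IsCut G μ η n P s e (s.real rCur 0) ∧ 0 ≤ s.real rCur 0 ∧ s.real rCur 0 ≤ 1 ∧
    G.NodeAt e (s.real rCur 0) (P (s.nat vNode 0)) ∧ s.nat vNode 0 < G.k + s.nat aN 0 ∧
    Link n (s.nat aN 0) (s.nat aU) (s.nat aV) (G.srcNat e) (s.nat vNode 0) ∧
    s.real rEv 0 = μ.val (G.seg e (s.real rCur 0) 1) ∧
    ((s.nat aN 0 : ℝ) - n - e) * η + s.real rEv 0 ≤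
      ∑ e ∈ Finset.range (e + 1), μ.val (G.seg e 0 1)

theorem cutStep (hO : O.Truthful μ) (hi : (i : ℕ) = 0) (he : e < G.m) (hk : s.nat vK 0 = e)
    (hkG : s.nat aIn 1 = G.k) (hη : 0 < η) (hηv : s.real rEta 0 = η)
    (h : CutState G (μ i) η n e s) (hbig : η < s.real rEv 0)
    (post : ∀ s', Frame Program.cutStep s s' → CutState G (μ i) η n e s' →
      s'.real rEv 0 = s.real rEv 0 - η → Q s') :
    Does O L .cutStep s Q := by
  suffices Does O L .cutStep s fun s' => CutState G (μ i) η n e s' ∧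
    s'.real rEv 0 = s.real rEv 0 - η from this.imp fun s' hf h => post s' hf h.1 h.2
  obtain ⟨P, hc, h0, h1, hnode, hfresh, hlink, hev, hcount⟩ := h
  set x := s.real rCur 0 with hx
  set N := s.nat aN 0 with hN
  have hcut := (hO i ⟨e, he⟩ x h0 h1).2 η hη.le (by
    rw [← Graph.seg_eq he, ← hev]; exact hbig.le)
  rw [hi, ← Graph.seg_eq he] at hcut
  set y := O.cutAnswer 0 e x η with hy
  obtain ⟨hxy, hy1, hval⟩ := hcut
  refine Does.seq (Does.cutQuery (Does.seq (Does.setNat (Does.seq (Does.setReal (Does.seq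
    (Does.addAtom ?_)))))))
  simp only [NatExpr.value, RealExpr.value, Store.setReal_nat, Store.setReal_real, Store.setNat_nat,
    Store.setNat_real, Nat.reduceEqDiff, false_and, if_false, and_self, if_true, hk, hηv, hkG,
    ← hx, ← hN, ← hy]
  set s1 := ((s.setReal rCut 0 y).setNat vNew 0 (G.k + N)).setReal rWt 0 η with hs1
  have e1 : ∀ a, a ≠ vNew → s1.nat a = s.nat a := fun a ha => by
    rw [hs1, Store.setReal_nat, Store.setNat_nat_of_ne _ _ _ ha]; rfl
  have e1' : ∀ a, a ≠ rCut → a ≠ rWt → s1.real a = s.real a := fun a ha hb => by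
    rw [hs1, Store.setReal_real_of_ne _ _ _ hb, Store.setNat_real,
      Store.setReal_real_of_ne _ _ _ ha]
  have hsame : SameAtoms s s1 := ⟨by simp [e1], by simp [e1']⟩
  intro s2 hf2 hadd
  refine Does.seq (Does.setNat (Does.seq (Does.setReal ?_)))
  have hnew : s2.nat vNew 0 = G.k + N := by rw [hf2.nat _ (by decide)]; simp [s1]
  have hcut2 : s2.real rCut 0 = y := by rw [hf2.real _ (by decide)]; simp [s1]
  simp only [NatExpr.value, RealExpr.value, Store.setNat_real, hnew, hcut2]
  set s3 := (s2.setNat vNode 0 (G.k + N)).setReal rCur 0 y with hs3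
  have e3 : ∀ a, a ≠ vNode → s3.nat a = s2.nat a := fun a ha => by
    rw [hs3, Store.setReal_nat, Store.setNat_nat_of_ne _ _ _ ha]
  have e3' : ∀ a, a ≠ rCur → s3.real a = s2.real a := fun a ha => by
    rw [hs3, Store.setReal_real_of_ne _ _ _ ha]; rfl
  have hcur3 : s3.real rCur 0 = y := by simp [s3]
  have hnode3 : s3.nat vNode 0 = G.k + N := by simp [s3]
  refine Does.evalRest hO hi he (by rw [e3 _ (by decide), hf2.nat _ (by decide),
    e1 _ (by decide), hk]) (by rw [hcur3]; linarith) (by rw [hcur3]; exact hy1) ?_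
  intro s4 hf4 hev4
  rw [hcur3] at hev4
  have hcur4 : s4.real rCur 0 = y := by rw [hf4.real _ (by decide), hcur3]
  have hnode4 : s4.nat vNode 0 = G.k + N := by rw [hf4.nat _ (by decide), hnode3]
  have hsame4 : SameAtoms s2 s4 := by
    constructor
    · intro a ha
      rw [hf4.nat a (by simp [Program.evalRest, Program.natArrays]), e3 a]
      rintro rfl
      simp at ha
    · intro a ha
      rw [hf4.real a, e3' a]
      · rintro rfl
        simp at ha
      · rintro h
        rw [Program.evalRest, Program.realArrays, List.mem_singleton] at h
        simp [h] at ha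
  have hN4 : s4.nat aN 0 = N + 1 := by
    rw [hsame4.nat aN (by decide), hadd.count, e1 _ (by decide)]
  have hN1 : s1.nat aN 0 = N := by rw [e1 _ (by decide)]
  have hsplit := (μ i).val_seg_add he h0 hxy hy1 le_rfl
  have hev' : s4.real rEv 0 = s.real rEv 0 - η := by rw [hev4, hev]; linarith
  obtain ⟨p, hp⟩ := Graph.exists_nodeAt he (h0.trans hxy) hy1
  refine ⟨⟨Function.update P (G.k + N) p, ?_, ?_, ?_, ?_, ?_, ?_, ?_, ?_⟩, hev'⟩
  · rw [hcur4]
    refine IsCut.congr ?_ hsame4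
    refine (hc.congr hsame).add hadd he h0 hxy hy1 hnode ?_ ?_ ?_ ?_ ?_ hval.symm le_rfl
    · rwa [hN1]
    · rwa [hN1, e1 _ (by decide), e1 _ (by decide)]
    · intro j hj
      rw [hN1] at hj
      exact Function.update_of_ne hj.ne _ _
    · rwa [Function.update_self]
    · rw [hN1]; omega
  · rw [hcur4]; linarith
  · rw [hcur4]; exact hy1
  · rw [hcur4, hnode4, Function.update_self]; exact hp
  · rw [hnode4, hN4]; omega
  · rw [hnode4, hsame4.nat aN (by decide), hsame4.nat aU (by decide), hsame4.nat aV (by decide)]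
    refine IsCut.link_add hadd (by rw [hN1]; exact hc.n_le) ?_
    rwa [hN1, e1 _ (by decide), e1 _ (by decide)]
  · rw [hcur4, hev4]
  · rw [hN4, hev']
    push_cast
    linarith

theorem cutEdge {P : ℕ → G.Point} (hO : O.Truthful μ) (hi : (i : ℕ) = 0) (he : e < G.m)
    (hk : s.nat vK 0 = e) (hkG : s.nat aIn 1 = G.k) (hsrc : s.nat aSrc e = G.srcNat e)
    (htgt : s.nat aTgt e = G.tgtNat e)
    (hη : 0 < η) (hηv : s.real rEta 0 = η) (hL : ⌊1 / η⌋₊ ≤ L)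
    (hc : IsCut G (μ i) η n P s e 0)
    (hcount : ((s.nat aN 0 : ℝ) - n - e) * η ≤ ∑ e ∈ Finset.range e, (μ i).val (G.seg e 0 1))
    (post : ∀ s' P, Frame Program.cutEdge s s' → IsCut G (μ i) η n P s' (e + 1) 0 →
      ((s'.nat aN 0 : ℝ) - n - (e + 1)) * η ≤
        ∑ e ∈ Finset.range (e + 1), (μ i).val (G.seg e 0 1) → Q s') :
    Does O L .cutEdge s Q := by
  suffices Does O L .cutEdge s fun s' => ∃ P, IsCut G (μ i) η n P s' (e + 1) 0 ∧
      ((s'.nat aN 0 : ℝ) - n - (e + 1)) * η ≤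
        ∑ e ∈ Finset.range (e + 1), (μ i).val (G.seg e 0 1) by
    refine this.imp fun s' hf h => ?_
    obtain ⟨P, h1, h2⟩ := h
    exact post s' P hf h1 h2
  refine Does.seq (Does.setReal (Does.seq (Does.setNat (Does.seq ?_))))
  simp only [NatExpr.value, RealExpr.value, Rat.cast_zero, Store.setReal_nat, hk, hsrc]
  set s1 := (s.setReal rCur 0 0).setNat vNode 0 (G.srcNat e) with hs1
  have e1 : ∀ a, a ≠ vNode → s1.nat a = s.nat a := fun a ha => by
    rw [hs1, Store.setNat_nat_of_ne _ _ _ ha]; rfl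
  have e1' : ∀ a, a ≠ rCur → s1.real a = s.real a := fun a ha => by
    rw [hs1, Store.setNat_real, Store.setReal_real_of_ne _ _ _ ha]
  have hcur1 : s1.real rCur 0 = 0 := by simp [s1]
  have hnode1 : s1.nat vNode 0 = G.srcNat e := by simp [s1]
  have hk1 : s1.nat vK 0 = e := by rw [e1 _ (by decide), hk]
  refine Does.evalRest hO hi he hk1 hcur1.ge (by rw [hcur1]; exact zero_le_one) ?_
  intro s2 hf2 hev2
  rw [hcur1] at hev2
  have hcur2 : s2.real rCur 0 = 0 := by rw [hf2.real _ (by decide), hcur1]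
  have hnode2 : s2.nat vNode 0 = G.srcNat e := by rw [hf2.nat _ (by decide), hnode1]
  have hsame2 : SameAtoms s s2 := by
    constructor
    · intro a ha
      rw [hf2.nat a (by simp [Program.evalRest, Program.natArrays]), e1 a]
      rintro rfl
      simp at ha
    · intro a ha
      rw [hf2.real a, e1' a]
      · rintro rfl
        simp at ha
      · rintro h
        rw [Program.evalRest, Program.realArrays, List.mem_singleton] at h
        simp [h] at ha
  have hstate : CutState G (μ i) η n e s2 := by
    refine ⟨P, ?_, hcur2.ge, by rw [hcur2]; exact zero_le_one, ?_, ?_, ?_, by rw [hev2, hcur2], ?_⟩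
    · rw [hcur2]; exact hc.congr hsame2
    · rw [hcur2, hnode2]; exact (hc.vertex e he).1
    · rw [hnode2]; exact (Graph.srcNat_lt he).trans_le (Nat.le_add_right _ _)
    · rw [hnode2]; exact .refl
    · rw [hev2, hsame2.nat aN (by decide), Finset.sum_range_succ]
      linarith
  refine Does.seq (Does.loop (CutState G (μ i) η n e) (fun s' => ⌊s'.real rEv 0 / η⌋₊) hstate
    ?_ ?_ ?_)
  · rw [hev2]
    refine (Nat.floor_le_floor ?_).trans hL
    gcongr
    exact (μ i).val_edge_le_one he
  · intro s3 hf3 hst htest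
    have hη3 : s3.real rEta 0 = η := by
      rw [hf3.real _ (by decide), hf2.real _ (by decide), e1' _ (by decide), hηv]
    simp only [Test.Holds, RealExpr.value, NatExpr.value, hη3, not_le] at htest
    refine Does.cutStep hO hi he (by rw [hf3.nat _ (by decide), hf2.nat _ (by decide), hk1])
      (by rw [hf3.nat _ (by decide), hf2.nat _ (by decide), e1 _ (by decide), hkG]) hη hη3 hst htest
      fun s4 hf4 hst4 hev4 => ⟨hst4, ?_⟩
    have hfl : 1 ≤ ⌊s3.real rEv 0 / η⌋₊ := Nat.le_floor (by
      rw [Nat.cast_one, le_div_iff₀ hη]; linarith)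
    rw [hev4, sub_div, div_self hη.ne', Nat.floor_sub_one]
    omega
  · intro s3 hf3 hst htest
    have hη3 : s3.real rEta 0 = η := by
      rw [hf3.real _ (by decide), hf2.real _ (by decide), e1' _ (by decide), hηv]
    have hk3 : s3.nat vK 0 = e := by rw [hf3.nat _ (by decide), hf2.nat _ (by decide), hk1]
    have htgt3 : s3.nat aTgt e = G.tgtNat e := by
      rw [hf3.nat _ (by decide), hf2.nat _ (by decide), e1 _ (by decide), htgt]
    simp only [Test.Holds, RealExpr.value, NatExpr.value, hη3, not_not] at htest
    obtain ⟨P, hc3, h0, h1, hnode, hfresh, hlink, hev, hcount3⟩ := hst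
    refine Does.seq (Does.setReal (Does.seq (Does.setNat (Does.seq (Does.setReal
      (Does.addAtom ?_))))))
    simp only [NatExpr.value, RealExpr.value, Store.setReal_nat, Store.setReal_real,
      Store.setNat_nat, Store.setNat_real, Nat.reduceEqDiff, false_and, if_false, and_self, if_true,
      hk3, htgt3, Rat.cast_one]
    set s4 := ((s3.setReal rCut 0 1).setNat vNew 0 (G.tgtNat e)).setReal rWt 0 (s3.real rEv 0)
      with hs4
    have e4 : ∀ a, a ≠ vNew → s4.nat a = s3.nat a := fun a ha => by
      rw [hs4, Store.setReal_nat, Store.setNat_nat_of_ne _ _ _ ha]; rfl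
    have e4' : ∀ a, a ≠ rCut → a ≠ rWt → s4.real a = s3.real a := fun a ha hb => by
      rw [hs4, Store.setReal_real_of_ne _ _ _ hb, Store.setNat_real,
        Store.setReal_real_of_ne _ _ _ ha]
    have hsame4 : SameAtoms s3 s4 := ⟨by simp [e4], by simp [e4']⟩
    have hN4 : s4.nat aN 0 = s3.nat aN 0 := by rw [e4 _ (by decide)]
    intro s5 hf5 hadd
    have htl := Graph.tgtNat_lt he
    have hc5 : IsCut G (μ i) η n P s5 e 1 := by
      refine (hc3.congr hsame4).add hadd he h0 h1 le_rfl hnode ?_ ?_ (fun _ _ => rfl)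
        (hc3.vertex e he).2 ?_ hev htest
      · rwa [hN4]
      · rwa [hN4, e4 _ (by decide), e4 _ (by decide)]
      · omega
    refine ⟨P, hc5.next ⟨s3.nat aN 0, ?_, ?_, ?_, ?_⟩ ?_, ?_⟩
    · rw [hadd.count, hN4]; exact Nat.lt_succ_self _
    · rw [hadd.edge, hN4, Function.update_self]
    · rw [hadd.lower, hN4, Function.update_self]; exact h1
    · rw [hadd.upper, hN4, Function.update_self]
    · refine IsCut.link_add hadd (by rw [hN4]; exact hc3.n_le) ?_
      rwa [hN4, e4 _ (by decide), e4 _ (by decide)]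
    · rw [hadd.count, hN4]
      have := (μ i).val_seg_nonneg he h0 h1 le_rfl
      push_cast
      linarith

end

end Does

/-! ### The whole algorithm -/

/-- The weight of an atom. -/
noncomputable def eta (n : ℕ) (ε : ℝ) : ℝ := ε / (8 * n * (1 + ε))

theorem eta_pos {n : ℕ} {ε : ℝ} (hn : 0 < n) (hε : 0 < ε) : 0 < eta n ε := by
  unfold eta; positivity

theorem one_div_eta {n : ℕ} {ε : ℝ} (hε : 0 < ε) :
    1 / eta n ε = 8 * n * (1 / ε + 1) := by
  unfold eta
  rw [one_div_div]
  field_simp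

theorem ratio_le {n : ℕ} {ε t : ℝ} (hn : 0 < n) (hε : 0 < ε)
    (h : 1 ≤ n * (2 * t + eta n ε)) : 2 * t + eta n ε ≤ (2 + ε) * (t - eta n ε) := by
  have hn' : (0 : ℝ) < n := by exact_mod_cast hn
  set η := eta n ε with hη
  have hη0 : 0 < η := eta_pos hn hε
  have e : 8 * ((1 + ε) * (n * η)) = ε := by
    rw [hη, eta]; field_simp
  have h0 : 0 < n * η := mul_pos hn' hη0
  have h1 : 8 * (n * η) ≤ 1 := by
    by_contra hlt
    nlinarith
  have h2 : 0 ≤ n * ((2 + ε) * (t - η) - (2 * t + η)) := by nlinarith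
  nlinarith [nonneg_of_mul_nonneg_right h2 hn']

/-- A bound for the number of iterations of each loop. -/
noncomputable def iterations (G : Graph) (n : ℕ) (ε : ℝ) : ℕ :=
  (⌊1 / eta n ε⌋₊ + 1) * (n + 1) + (n + G.m + ⌊1 / eta n ε⌋₊)

namespace Does

variable {O : Oracle} {L : ℕ} {G : Graph} {n : ℕ} {ε : ℝ}

theorem start {Q : Store → Prop} (μ : Valuation G) (hn : 0 < n) (hε : 0 < ε) (hL : n ≤ L)
    (post : ∀ s' P, Frame Program.start (inputStore G n ε) s' →
      s'.real rEta 0 = eta n ε → s'.nat aN 0 = n → IsCut G μ (eta n ε) n P s' 0 0 → Q s') :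
    Does O L .start (inputStore G n ε) Q := by
  have hm := μ.edges_pos
  obtain ⟨P, hP⟩ := Graph.exists_vertex_map hm
  suffices Does O L .start (inputStore G n ε) fun s' => s'.real rEta 0 = eta n ε ∧
      s'.nat aN 0 = n ∧ (∀ a < n, s'.nat aOwn a = a) ∧ (∀ a < n, s'.nat aU a = G.srcNat 0) ∧
      (∀ a < n, s'.nat aV a = G.srcNat 0) by
    refine this.imp fun s' hf h => ?_
    obtain ⟨h1, h2, h3, h4, h5⟩ := h
    refine post s' P hf h1 h2 ?_
    have hE : ∀ a, s'.nat aEdge a = 0 := fun a => by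
      rw [hf.nat _ (by decide)]; simp [inputStore]
    have hX : ∀ a, s'.real rX a = 0 := fun a => by
      rw [hf.real _ (by decide)]; simp [inputStore]
    have hY : ∀ a, s'.real rY a = 0 := fun a => by
      rw [hf.real _ (by decide)]; simp [inputStore]
    have hW : ∀ a, s'.real rW a = 0 := fun a => by
      rw [hf.real _ (by decide)]; simp [inputStore]
    have hv := Graph.srcNat_lt hm
    constructor <;> try simp only [h2, hE, hX, hY, hW]
    · exact hP
    · exact le_rfl
    · exact fun _ _ => hm
    · exact fun _ _ => le_rfl
    · exact fun _ _ => le_rfl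
    · exact fun _ _ => zero_le_one
    · exact fun _ _ => (μ.val_seg_self hm le_rfl zero_le_one).symm
    · exact fun _ _ => (eta_pos hn hε).le
    · exact fun a ha => by rw [h4 a ha]; exact (hP 0 hm).1
    · exact fun a ha => by rw [h5 a ha]; exact (hP 0 hm).1
    · exact fun a ha => by rw [h4 a ha]; omega
    · exact fun a ha => by rw [h5 a ha]; omega
    · exact fun _ _ => .inr ⟨trivial, le_rfl⟩
    · exact fun _ _ _ _ _ _ => .inl le_rfl
    · exact fun e he => absurd he (Nat.not_lt_zero e)
    · exact fun t h0 h1 => absurd h1 (not_lt.2 h0)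
    · exact fun a ha => by rw [h4 a ha]; exact .refl
    · exact fun e he => absurd he (Nat.not_lt_zero e)
    · exact h3
    · exact fun a h h' => absurd h' (not_lt.2 h)
  refine Does.seq (Does.setReal ?_)
  set s0 := inputStore G n ε with hs0
  have hval : (RealExpr.div (.var rEps) (.mul (.mul (.const 8) (.ofNat .agents))
      (.add (.const 1) (.var rEps)))).value s0 = eta n ε := by
    simp [s0, inputStore, eta]
  rw [hval]
  simp only [NatExpr.value]
  set s1 := s0.setReal rEta 0 (eta n ε) with hs1
  have n1 : s1.nat aIn 0 = n := by simp [s1, s0, inputStore]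
  have src1 : s1.nat aSrc 0 = G.srcNat 0 := by simp [s1, s0, inputStore, Graph.srcNat]
  refine Does.seq (Does.fill n (fun a => a) hL (by decide)
    (fun s' h => by simp [h.nat aIn (by decide), n1]) (fun s' h _ _ => by simp)
    fun s2 hf2 h2 => ?_)
  have n2 : s2.nat aIn 0 = n := by rw [hf2.nat _ (by decide), n1]
  have src2 : s2.nat aSrc 0 = G.srcNat 0 := by rw [hf2.nat _ (by decide), src1]
  refine Does.seq (Does.fill n (fun _ => G.srcNat 0) hL (by decide)
    (fun s' h => by simp [h.nat aIn (by decide), n2])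
    (fun s' h _ _ => by simp [h.nat aSrc (by decide), src2]) fun s3 hf3 h3 => ?_)
  have n3 : s3.nat aIn 0 = n := by rw [hf3.nat _ (by decide), n2]
  have src3 : s3.nat aSrc 0 = G.srcNat 0 := by rw [hf3.nat _ (by decide), src2]
  refine Does.seq (Does.fill n (fun _ => G.srcNat 0) hL (by decide)
    (fun s' h => by simp [h.nat aIn (by decide), n3])
    (fun s' h _ _ => by simp [h.nat aSrc (by decide), src3]) fun s4 hf4 h4 => Does.setNat ?_)
  have n4 : s4.nat aIn 0 = n := by rw [hf4.nat _ (by decide), n3]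
  simp only [NatExpr.value, n4, Store.setNat_nat, Store.setNat_real, Nat.reduceEqDiff, false_and,
    if_false, and_self, if_true]
  refine ⟨?_, trivial, ?_, ?_, h4⟩
  · rw [hf4.real _ (by decide), hf3.real _ (by decide), hf2.real _ (by decide)]
    simp [s1]
  · rw [hf4.nat _ (by decide), hf3.nat _ (by decide)]; exact h2
  · rw [hf4.nat _ (by decide)]; exact h3

theorem main {μ : Fin n → Valuation G} (hn : 0 < n) (hG : G.IsConnectedGraph)
    (hid : Identical μ) (hε : 0 < ε) (hO : O.Truthful μ) :
    Does O (iterations G n ε) .main (inputStore G n ε) fun s => OutputValid G n s ∧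
      IsAllocation G (outputShares G n s) ∧ IsEF μ (2 + ε) (outputShares G n s) := by
  set i : Fin n := ⟨0, hn⟩ with hi
  set η := eta n ε with hη
  have hη0 : 0 < η := eta_pos hn hε
  set K := ⌊1 / η⌋₊ with hK
  have hL : iterations G n ε = (K + 1) * (n + 1) + (n + G.m + K) := rfl
  set L := iterations G n ε with hLd
  refine Does.seq (Does.start (μ i) hn hε (by omega) fun s1 P hf1 hη1 hN1 hc1 => Does.seq ?_)
  have k1 : s1.nat aIn 1 = G.k := by rw [hf1.nat _ (by decide)]; simp [inputStore]
  have m1 : s1.nat aIn 2 = G.m := by rw [hf1.nat _ (by decide)]; simp [inputStore]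
  have n1 : s1.nat aIn 0 = n := by rw [hf1.nat _ (by decide)]; simp [inputStore]
  have src1 : ∀ e, s1.nat aSrc e = G.srcNat e := fun e => by
    rw [hf1.nat _ (by decide)]; simp [inputStore, Graph.srcNat]
  have tgt1 : ∀ e, s1.nat aTgt e = G.tgtNat e := fun e => by
    rw [hf1.nat _ (by decide)]; simp [inputStore, Graph.tgtNat]
  refine Does.forUpTo G.m (fun e s => ∃ P, IsCut G (μ i) η n P s e 0 ∧
      ((s.nat aN 0 : ℝ) - n - e) * η ≤ ∑ e ∈ Finset.range e, (μ i).val (G.seg e 0 1))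
    (by omega) (by decide) (fun s' h => by simp [h.nat aIn (by decide), m1])
    ⟨P, hc1.congr ⟨by simp [Store.setNat_nat_of_ne], fun _ _ => rfl⟩, by simp [hN1]⟩ ?_ ?_
  · rintro e he s2 hf2 hk2 ⟨P, hc2, hcount⟩
    refine Does.cutEdge hO (i := i) rfl he hk2 (by rw [hf2.nat _ (by decide), k1])
      (by rw [hf2.nat _ (by decide), src1]) (by rw [hf2.nat _ (by decide), tgt1]) hη0
      (by rw [hf2.real _ (by decide), hη1]) (show K ≤ L by omega) hc2 hcount ?_
    intro s3 P' hf3 hc3 hcount3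
    refine ⟨P', hc3.congr ⟨by simp [Store.setNat_nat_of_ne], fun _ _ => rfl⟩, ?_⟩
    simpa using hcount3
  · rintro s2 hf2 ⟨P, hc2, hcount⟩
    rw [(μ i).sum_edges] at hcount
    have hN : s2.nat aN 0 ≤ n + G.m + K := by
      have : s2.nat aN 0 - n - G.m ≤ K := by
        refine Nat.le_floor ?_
        rw [le_div_iff₀ hη0]
        rcases le_total (n + G.m) (s2.nat aN 0) with h | h
        · rw [Nat.sub_sub, Nat.cast_sub h]
          push_cast
          linarith
        · rw [Nat.sub_sub, Nat.sub_eq_zero_of_le h]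
          simp
      omega
    have n2 : s2.nat aIn 0 = n := by rw [hf2.nat _ (by decide), n1]
    have hA := hc2.areAtoms hG hη0
    refine Does.balance (U := s2.nat aU) (V := s2.nat aV) (own := s2.nat aOwn) (w := s2.real rW)
      rfl (by omega) n2 hn (show (K + 1) * (n + 1) ≤ L by omega) rfl rfl rfl rfl
      (by rw [hf2.real _ (by decide), hη1]) hA (hc2.isPartition hG hn) ?_
    rintro s3 hf3 hp ⟨t, ht⟩
    have hcut := hc2.isCutting
    have N3 : s3.nat aN = s2.nat aN := hf3.nat _ (by decide)
    have E3 : s3.nat aEdge = s2.nat aEdge := hf3.nat _ (by decide)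
    have X3 : s3.real rX = s2.real rX := hf3.real _ (by decide)
    have Y3 : s3.real rY = s2.real rY := hf3.real _ (by decide)
    have hout : outputShares G n s3 = fun j : Fin n => shareOf G (s2.nat aN 0) (s2.nat aEdge)
        (s2.real rX) (s2.real rY) (s3.nat aOwn) j := by
      funext j
      rw [outputShares_eq, N3, E3, X3, Y3]
    have hall := hcut.isAllocation hp
    rw [hout]
    refine ⟨?_, hall, ?_⟩
    · intro r hr
      rw [N3] at hr
      rw [E3, X3, Y3]
      exact ⟨hp.lt r hr, hcut.edge_lt r hr, hcut.nonneg r hr, hcut.le r hr, hcut.le_one r hr⟩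
    · have hval : ∀ j k : Fin n, (μ j).val (shareOf G (s2.nat aN 0) (s2.nat aEdge)
          (s2.real rX) (s2.real rY) (s3.nat aOwn) k) =
          weight (s2.nat aN 0) (s2.real rW) (s3.nat aOwn) k := by
        intro j k
        rw [hid j i _ (hall.share k), shareOf, hcut.val_biUnion (S := marked _ _ _) (μ i) (Finset.filter_subset _ _),
          weight]
        exact Finset.sum_congr rfl fun a ha => (hc2.weight_eq a (mem_marked.1 ha).1).symm
      have hsum : 1 ≤ n * (2 * t + η) := by
        have h1 := sum_weight (w := s2.real rW) hp.lt
        rw [hA.total] at h1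
        rw [← h1]
        refine (Finset.sum_le_sum fun k hk => (ht k (Finset.mem_range.1 hk)).2).trans_eq ?_
        rw [Finset.sum_const, Finset.card_range, nsmul_eq_mul]
      have hratio := ratio_le hn hε hsum
      intro j k
      rw [hval, hval, ge_iff_le, div_le_iff₀ (by linarith)]
      have h1 := (ht j j.2).1
      have h2 := (ht k k.2).2
      nlinarith

end Does

/-- The running time is bounded by a polynomial. -/
theorem exists_cost_bound : ∃ P : MvPolynomial (Fin 3) ℕ, ∀ (G : Graph) (n : ℕ) (ε : ℝ), 0 < ε →
    ((Program.main.cost (iterations G n ε) : ℕ) : ℝ) ≤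
      MvPolynomial.aeval ![(n : ℝ), 1 / ε, (G.size : ℝ)] P := by
  let X : Fin 3 → MvPolynomial (Fin 3) ℕ := MvPolynomial.X
  let Z : MvPolynomial (Fin 3) ℕ :=
    (8 * X 0 * (X 1 + 1) + 1) * (X 0 + 1) + (X 0 + X 2 + 8 * X 0 * (X 1 + 1))
  refine ⟨Program.main.cost Z, fun G n ε hε => ?_⟩
  have h1 := Program.map_cost (Nat.castRingHom ℝ) (iterations G n ε) Program.main
  have h2 := Program.map_cost (MvPolynomial.aeval (R := ℕ)
    ![(n : ℝ), 1 / ε, (G.size : ℝ)]).toRingHom Z Program.main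
  simp only [eq_natCast] at h1
  refine h1.trans_le (le_of_le_of_eq (Program.cost_mono (Nat.cast_nonneg _) ?_ _) h2.symm)
  have hZ : (MvPolynomial.aeval (R := ℕ) ![(n : ℝ), 1 / ε, (G.size : ℝ)]).toRingHom Z =
      (8 * n * (1 / ε + 1) + 1) * (n + 1) + (n + G.size + 8 * n * (1 / ε + 1)) := by
    simp [Z, X]
  rw [hZ, ← one_div_eta hε, iterations]
  have hK : (⌊1 / eta n ε⌋₊ : ℝ) ≤ 1 / eta n ε := Nat.floor_le (by
    rw [one_div_eta hε]; positivity)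
  have hm : (G.m : ℝ) ≤ G.size := by
    exact_mod_cast Nat.le_add_left G.m G.k
  push_cast
  gcongr

/-- There are correct answers to all queries. -/
theorem exists_truthful {G : Graph} {n : ℕ} (μ : Fin n → Valuation G) :
    ∃ O : Oracle, O.Truthful μ := by
  classical
  have hcut : ∀ (i : Fin n) (e : Fin G.m) (x a : ℝ), ∃ y, 0 ≤ x → x ≤ 1 → 0 ≤ a →
      a ≤ (μ i).val (G.interval e x 1) →
      x ≤ y ∧ y ≤ 1 ∧ (μ i).val (G.interval e x y) = a := by
    intro i e x a
    by_cases h : 0 ≤ x ∧ x ≤ 1 ∧ 0 ≤ a ∧ a ≤ (μ i).val (G.interval e x 1)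
    · obtain ⟨h0, h1, ha, hle⟩ := h
      obtain ⟨z, hxz, hz1, hz⟩ := (μ i).divisible e x 1 (a / (μ i).val (G.interval e x 1)) h0 h1
        le_rfl (div_nonneg ha (ha.trans hle)) (div_le_one_of_le₀ hle (ha.trans hle))
      refine ⟨z, fun _ _ _ _ => ⟨hxz, hz1, hz.trans ?_⟩⟩
      rcases (ha.trans hle).eq_or_lt with hv | hv
      · rw [← hv] at hle ⊢
        simp [le_antisymm hle ha]
      · exact div_mul_cancel₀ _ hv.ne'
    · exact ⟨0, fun h0 h1 ha hle => absurd ⟨h0, h1, ha, hle⟩ h⟩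
  choose f hf using hcut
  refine ⟨⟨fun i e x y => if h : i < n ∧ e < G.m then
      (μ ⟨i, h.1⟩).val (G.interval ⟨e, h.2⟩ x y) else 0,
    fun i e x a => if h : i < n ∧ e < G.m then f ⟨i, h.1⟩ ⟨e, h.2⟩ x a else 0⟩, ?_⟩
  intro i e x h0 h1
  refine ⟨fun y _ _ => by simp, fun a ha hle => ?_⟩
  simpa using hf i e x a h0 h1 ha hle

end GraphCake

theorem mainTheorem3 :
    (∀ (n : ℕ) (G : GraphCake.Graph) (μ : Fin n → GraphCake.Valuation G) (ε : ℝ),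
      2 ≤ n → G.IsConnectedGraph → GraphCake.Identical μ → 0 < ε →
      ∃ A : Fin n → Set G.Point,
        GraphCake.IsAllocation G A ∧ GraphCake.IsEF μ (2 + ε) A) ∧
    (∃ (c : GraphCake.Program) (P : MvPolynomial (Fin 3) ℕ),
      ∀ (n : ℕ) (G : GraphCake.Graph) (μ : Fin n → GraphCake.Valuation G) (ε : ℝ)
        (O : GraphCake.Oracle),
      2 ≤ n → G.IsConnectedGraph → GraphCake.Identical μ → 0 < ε → O.Truthful μ →
      ∃ (s : GraphCake.Store) (T : ℕ),
        GraphCake.Runs O c (GraphCake.inputStore G n ε) s T ∧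
        (T : ℝ) ≤ MvPolynomial.aeval ![(n : ℝ), 1 / ε, (G.size : ℝ)] P ∧
        GraphCake.OutputValid G n s ∧
        GraphCake.IsAllocation G (GraphCake.outputShares G n s) ∧
        GraphCake.IsEF μ (2 + ε) (GraphCake.outputShares G n s)) := by
  constructor
  · intro n G μ ε hn hG hid hε
    obtain ⟨O, hO⟩ := GraphCake.exists_truthful μ
    obtain ⟨s, T, -, -, -, hA, hEF⟩ :=
      GraphCake.Does.main (by omega : 0 < n) hG hid hε hO
    exact ⟨_, hA, hEF⟩
  · obtain ⟨P, hP⟩ := GraphCake.exists_cost_bound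
    refine ⟨GraphCake.Program.main, P, fun n G μ ε O hn hG hid hε hO => ?_⟩
    obtain ⟨s, T, hrun, hT, hval, hA, hEF⟩ :=
      GraphCake.Does.main (by omega : 0 < n) hG hid hε hO
    exact ⟨s, T, hrun, (Nat.cast_le.2 hT).trans (hP G n ε hε), hval, hA, hEF⟩
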